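/- Let $\mathcal P=[p_l,p_h]$ with $0<p_l<p_h$, let $\sigma>0$, let $\mu_d,\mu_c$ be mean functions and $k_d,k_c$ kernels on $\mathcal P$, and let $a_d,b_d,a_c,b_c>0$ and $\delta\in(0,1)$. Put $$\varphi_t = 2\log\!\Big(\frac{2t^2\pi^2}{3\delta}\Big)+2\log(t^2),\qquad \gamma_T=\sup_{A\subset\mathcal P,\ |A|=T}\ \tfrac12\log\det\big(I+\sigma^{-2}[k_d(p,q)+k_c(p,q)]_{p,q\in A}\big).$$ **Model.** The expected demand $f_d$ and the expected claims $f_c$ are independent Gaussian processes on $\mathcal P$, $f_d\sim\mathcal{GP}(\mu_d,k_d)$ and $f_c\sim\mathcal{GP}(\mu_c,k_c)$. Their sample paths are almost surely continuously differentiable, and for all $J>0$ $$\mathbb P\big(\sup_{p\in\mathcal P}|f_d'(p)|>J\big)\le a_d e^{-(J/b_d)^2},\qquad \mathbb P\big(\sup_{p\in\mathcal P}|f_c'(p)|>J\big)\le a_c e^{-(J/b_c)^2}.$$ In round $t=1,2,\dots$ a price $p_t\in\mathcal P$ is chosen and $d_t=f_d(p_t)+\varepsilon^d_t$ and $c_t=f_c(p_t)+\varepsilon^c_t$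 are observed, where all the noises $\varepsilon^d_t,\varepsilon^c_t$ are i.i.d. $\mathcal N(0,\sigma^2)$ and independent of $(f_d,f_c)$. **GP-UCB pricing rule.** Given prices $p_1,\dots,p_n$ and observations $y\in\mathbb R^n$ of a $\mathcal{GP}(\mu,k)$ prior, let $K_n=[k(p_i,p_j)]_{i,j\le n}$ and $\mathbf k_n(p)=[k(p_i,p)]_{i\le n}$. The posterior mean and variance are $$\mu_n(p)=\mu(p)+\mathbf k_n(p)^\top(K_n+\sigma^2I)^{-1}\big(y-(\mu(p_i))_{i\le n}\big),\qquad \sigma_n(p)^2=k(p,p)-\mathbf k_n(p)^\top(K_n+\sigma^2I)^{-1}\mathbf k_n(p).$$ Let $\mu^d_n,\sigma^d_n$ be obtained in this way from $(\mu_d,k_d)$ and $(d_1,\dots,d_n)$, and $\mu^c_n,\sigma^c_n$ from $(\mu_c,k_c)$ and $(c_1,\dots,c_n)$. The price $p_t$ is a measurable function of the history $(p_i,d_i,c_i)_{i<t}$ with $$p_t\in\operatorname*{arg\,max}_{p\in\mathcal P}\ \Big\{p\,\mu^d_{t-1}(p)-\mu^c_{t-1}(p)+\sqrt{\varphi_t}\,\big(p\,\sigma^d_{t-1}(p)+\sigma^c_{t-1}(p)\big)\Big\},$$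 the maximising property holding for every possible history with prices in $\mathcal P$. **Claim.** Let $r(p)=p f_d(p)-f_c(p)$ and $R(T)=\sum_{t=1}^T\big(\max_{q\in\mathcal P}r(q)-r(p_t)\big)$. There is a constant $C>0$, depending only on $p_l,p_h,\sigma,\mu_d,\mu_c,k_d,k_c,a_d,b_d,a_c,b_c,\delta$ (not on $T$, the underlying probability space or the tie-breaking), such that with probability at least $1-\delta$ $$R(T)\le C\sqrt{\gamma_T\,T\log(T+1)}\qquad\text{for all } T\ge1 .$$ Moreover $R(T)$ is integrable and $\mathbb E[R(T)]\le C\sqrt{\gamma_T\,T\log(T+1)}$ for all $T\ge1$. In particular the regret is $O(\sqrt{\gamma_T T\log T})$ in both senses. -/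

import Mathlib

open MeasureTheory ProbabilityTheory

namespace GPPricing

noncomputable section

/-! ### Gaussian process priors -/

/-- `f` is (a realisation on `Ω` of) a Gaussian process on the price set `S` with mean function `μ`
and covariance kernel `k`. Only the values `f p` for `p ∈ S` matter. -/
structure IsGPSample {Ω : Type*} [MeasurableSpace Ω] (P : Measure Ω) (S : Set ℝ)
    (μ : ℝ → ℝ) (k : ℝ → ℝ → ℝ) (f : ℝ → Ω → ℝ) : Prop where
  measurable : ∀ p ∈ S, Measurable (f p)
  gaussian : IsGaussianProcess (fun p : S => f p) P
  mean : ∀ p ∈ S, ∫ ω, f p ω ∂P = μ p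
  covariance : ∀ p ∈ S, ∀ q ∈ S, cov[f p, f q; P] = k p q

/-- The sample paths of `f` are almost surely continuously differentiable on `S`, and
`P (sup_{p ∈ S} |f'(p)| > J) ≤ a * exp (-(J / b) ^ 2)` for all `J > 0`. -/
structure HasSubgaussianDeriv {Ω : Type*} [MeasurableSpace Ω] (P : Measure Ω) (S : Set ℝ)
    (a b : ℝ) (f : ℝ → Ω → ℝ) : Prop where
  contDiffOn : ∀ᵐ ω ∂P, ContDiffOn ℝ 1 (fun p => f p ω) S
  tail : ∀ J : ℝ, 0 < J →
    P {ω | ∃ p ∈ S, J < |derivWithin (fun q => f q ω) S p|}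
      ≤ ENNReal.ofReal (a * Real.exp (-(J / b) ^ 2))

/-! ### The randomness of the model -/

/-- The demand function `fd`, the claims function `fc` and the observation noises `εd t`, `εc t`
(`t = 1, 2, …`) are all independent, and the noises have law `N(0, σ²)`. -/
structure IsIndependentNoisyModel {Ω : Type*} [MeasurableSpace Ω] (P : Measure Ω) (S : Set ℝ)
    (σ : ℝ) (fd fc : ℝ → Ω → ℝ) (εd εc : ℕ → Ω → ℝ) : Prop where
  measurable_demand : ∀ t, Measurable (εd t)
  measurable_claims : ∀ t, Measurable (εc t)
  law_demand : ∀ t, HasLaw (εd t) (gaussianReal 0 (σ ^ 2).toNNReal) P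
  law_claims : ∀ t, HasLaw (εc t) (gaussianReal 0 (σ ^ 2).toNNReal) P
  indep_noise : iIndepFun (Sum.elim εd εc) P
  indep_functions :
    IndepFun (fun ω (p : S) => fd p ω) (fun ω (p : S) => fc p ω) P
  indep_functions_noise :
    IndepFun (fun ω => ((fun p : S => fd p ω), (fun p : S => fc p ω)))
      (fun ω => ((fun t => εd t ω), (fun t => εc t ω))) P

/-! ### Gaussian process regression -/

/-- The matrix `K_n + σ² I` of the input points `x 0, …, x (n - 1)`. -/
def regMatrix (k : ℝ → ℝ → ℝ) (σ : ℝ) {n : ℕ} (x : Fin n → ℝ) : Matrix (Fin n) (Fin n) ℝ :=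
  Matrix.of (fun i j => k (x i) (x j)) + σ ^ 2 • (1 : Matrix (Fin n) (Fin n) ℝ)

/-- Posterior mean at `p` after the observations `y i = f (x i) + noise`, for the prior
`GP(μ, k)`: `μ(p) + k_n(p)ᵀ (K_n + σ² I)⁻¹ (y - μ(x))`. -/
def postMean (μ : ℝ → ℝ) (k : ℝ → ℝ → ℝ) (σ : ℝ) {n : ℕ} (x y : Fin n → ℝ) (p : ℝ) : ℝ :=
  μ p + dotProduct (fun i => k (x i) p)
    (((regMatrix k σ x)⁻¹).mulVec (fun i => y i - μ (x i)))

/-- Posterior covariance `k(p, q) - k_n(p)ᵀ (K_n + σ² I)⁻¹ k_n(q)`. -/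
def postCov (k : ℝ → ℝ → ℝ) (σ : ℝ) {n : ℕ} (x : Fin n → ℝ) (p q : ℝ) : ℝ :=
  k p q - dotProduct (fun i => k (x i) p)
    (((regMatrix k σ x)⁻¹).mulVec (fun i => k (x i) q))

/-- Posterior standard deviation. -/
def postStd (k : ℝ → ℝ → ℝ) (σ : ℝ) {n : ℕ} (x : Fin n → ℝ) (p : ℝ) : ℝ :=
  Real.sqrt (postCov k σ x p p)

/-! ### The upper confidence bound pricing rule -/

/-- The exploration weight `φ_t = 2 log (2 t² π² / (3 δ)) + 2 log (t²)`. -/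
def phi (δ : ℝ) (t : ℕ) : ℝ :=
  2 * Real.log (2 * (t : ℝ) ^ 2 * Real.pi ^ 2 / (3 * δ)) + 2 * Real.log ((t : ℝ) ^ 2)

/-- A history of length `n`: the triples (price, demand, claims) of the first `n` rounds. -/
abbrev History (n : ℕ) : Type := Fin n → ℝ × ℝ × ℝ

/-- The upper confidence function used in round `n + 1`, given the history `h` of the first `n`
rounds: `μʳ(p) + √φ_{n+1} σʳ(p)` with `μʳ(p) = p μᵈ(p) - μᶜ(p)` and `σʳ(p) = p σᵈ(p) + σᶜ(p)`,
where `μᵈ, σᵈ` and `μᶜ, σᶜ` are the posterior means and standard deviations of the demand and of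
the claims function. -/
def ucb (μd μc : ℝ → ℝ) (kd kc : ℝ → ℝ → ℝ) (σ δ : ℝ) {n : ℕ} (h : History n) (p : ℝ) : ℝ :=
  (p * postMean μd kd σ (fun i => (h i).1) (fun i => (h i).2.1) p
      - postMean μc kc σ (fun i => (h i).1) (fun i => (h i).2.2) p)
    + Real.sqrt (phi δ (n + 1)) *
      (p * postStd kd σ (fun i => (h i).1) p + postStd kc σ (fun i => (h i).1) p)

/-- A pricing policy chooses the price of round `n + 1` from the history of the first `n` rounds.
It is a GP-UCB policy on the price set `S` if it is measurable and always chooses a maximiser over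
`S` of the upper confidence function (ties are broken in an arbitrary measurable way). -/
structure IsUCBPolicy (S : Set ℝ) (μd μc : ℝ → ℝ) (kd kc : ℝ → ℝ → ℝ) (σ δ : ℝ)
    (π : (n : ℕ) → History n → ℝ) : Prop where
  measurable : ∀ n, Measurable (π n)
  mem : ∀ n (h : History n), (∀ i, (h i).1 ∈ S) → π n h ∈ S
  isMaxOn : ∀ n (h : History n), (∀ i, (h i).1 ∈ S) →
    IsMaxOn (ucb μd μc kd kc σ δ h) S (π n h)

/-- The history of the first `n` rounds when the policy `π` is followed: in round `t` the price
`p_t` is chosen by `π`, and demand `fd p_t + εd t` and claims `fc p_t + εc t` are observed. -/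
def history {Ω : Type*} (π : (n : ℕ) → History n → ℝ) (fd fc : ℝ → Ω → ℝ)
    (εd εc : ℕ → Ω → ℝ) (ω : Ω) : (n : ℕ) → History n
  | 0 => Fin.elim0
  | n + 1 =>
    Fin.snoc (α := fun _ => ℝ × ℝ × ℝ) (history π fd fc εd εc ω n)
      (π n (history π fd fc εd εc ω n),
        fd (π n (history π fd fc εd εc ω n)) ω + εd (n + 1) ω,
        fc (π n (history π fd fc εd εc ω n)) ω + εc (n + 1) ω)

/-- The price `p_t` charged in round `t ≥ 1`. -/
def price {Ω : Type*} (π : (n : ℕ) → History n → ℝ) (fd fc : ℝ → Ω → ℝ)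
    (εd εc : ℕ → Ω → ℝ) (t : ℕ) (ω : Ω) : ℝ :=
  π (t - 1) (history π fd fc εd εc ω (t - 1))

/-! ### Regret and information gain -/

/-- Expected revenue at price `p` for given demand and claims functions: `p fd(p) - fc(p)`. -/
def revenue {Ω : Type*} (fd fc : ℝ → Ω → ℝ) (p : ℝ) (ω : Ω) : ℝ :=
  p * fd p ω - fc p ω

/-- The cumulative regret `∑_{t=1}^T (r(p*) - r(p_t))` of the price sequence `p`, where
`r(p*) = max_{q ∈ S} r(q)`. -/
def regret {Ω : Type*} (S : Set ℝ) (fd fc : ℝ → Ω → ℝ) (p : ℕ → Ω → ℝ) (T : ℕ) (ω : Ω) : ℝ :=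
  ∑ t ∈ Finset.Icc 1 T,
    (sSup ((fun q => revenue fd fc q ω) '' S) - revenue fd fc (p t ω) ω)

/-- The mutual information `I(y_A; f_A) = ½ log det (I + σ⁻² K_A)` between the values on the finite
set `A` of a Gaussian process with kernel `k` and their observations under `N(0, σ²)` noise. -/
def infoGain (k : ℝ → ℝ → ℝ) (σ : ℝ) (A : Finset ℝ) : ℝ :=
  1 / 2 * Real.log (Matrix.det
    ((1 : Matrix A A ℝ) + (σ ^ 2)⁻¹ • Matrix.of (fun p q : A => k p q)))

/-- The maximum information gain `γ_T(k)` over the sets of `T` prices in `S`. -/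
def maxInfoGain (S : Set ℝ) (k : ℝ → ℝ → ℝ) (σ : ℝ) (T : ℕ) : ℝ :=
  sSup (infoGain k σ '' {A : Finset ℝ | (A : Set ℝ) ⊆ S ∧ A.card = T})

end

end GPPricing

/-! The argument is optimism on a discretised price range. Round t compares the best revenue with
the revenue on a grid of t² prices. Suppose that on the grid the demand lies below its upper and the
claims above their lower confidence bound, and that the opposite inequalities hold at the charged
price. Since that price maximises the upper confidence function, the regret of the round is at most
a discretisation error L (ph - pl) / t² plus twice the confidence width
(`revenue_sub_le_of_isMaxOn`). Violated bounds enter as positive parts instead of being excluded by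
an event. The inequality is therefore pathwise and gives both the high-probability and the mean
bound.

Widths. Adding an independent process can only increase a posterior variance, so the demand and the
claims variance are both dominated by that of the kernel kd + kc (`IsPSDKernel.postCov_le_add`). The
latter variances sum to at most a constant times γ_T, because log det (I + σ⁻²K) is the sum of the
terms log (1 + σ⁻² v) along the sequence (`IsPSDKernel.sum_postCov_le`). Cauchy-Schwarz gives √(γ_T
T log(T+1)) (`sum_width_le`).

Confidence bounds. Prices depend on past data, so Gaussian regression at fixed points does not apply
directly. However, the joint law of the paths and the observations has an explicit density with
respect to Lebesgue measure in the observations y (`lintegral_observations`). Once y is frozen, the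
prices are frozen, and the fixed-design identity for the posterior moment generating function
applies (`lintegral_exp_mul_prod_gaussianPDF`). It has to hold for every y, not almost every y,
since the design varies with y. Chernoff bounds give each one-sided bound the failure probability
exp(-φ_t/2) = 3δ/(2π²t⁴). Summed over 2(t²+1) bounds per round, this is at most 5δ/6, and the mean
excesses are summable too.

Regularity. The tail of the derivative gives a random Lipschitz constant whose second moment is
bounded by the data (`exists_envelope`). It makes means and kernels continuous and bounded, and its
mean pays for discretisation. Markov's inequality for it uses the remaining δ/6.

The additive constants are absorbed because γ_T is bounded below by the information of one price,
unless both priors have zero variance; in that case the regret vanishes almost surely. -/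

namespace GPPricing

open Matrix Filter Topology

/-! ### Positive semidefinite kernels and posterior variances -/

/-- `k` is a symmetric positive semidefinite kernel on `ℝ`. -/
structure IsPSDKernel (k : ℝ → ℝ → ℝ) : Prop where
  symm : ∀ p q, k p q = k q p
  nonneg : ∀ (n : ℕ) (x c : Fin n → ℝ), 0 ≤ ∑ i, ∑ j, c i * c j * k (x i) (x j)

/-- The matrix of a kernel at the points `x`. -/
def kernelMatrix (k : ℝ → ℝ → ℝ) {n : ℕ} (x : Fin n → ℝ) : Matrix (Fin n) (Fin n) ℝ :=
  Matrix.of (fun i j => k (x i) (x j))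

lemma regMatrix_eq (k : ℝ → ℝ → ℝ) (σ : ℝ) {n : ℕ} (x : Fin n → ℝ) :
    regMatrix k σ x = kernelMatrix k x + σ ^ 2 • (1 : Matrix (Fin n) (Fin n) ℝ) := rfl

/-- The variance of `f q - ∑ i, w i * (f (x i) + noise)`. -/
noncomputable def residualVar (k : ℝ → ℝ → ℝ) (σ : ℝ) {n : ℕ} (x : Fin n → ℝ) (q : ℝ)
    (w : Fin n → ℝ) : ℝ :=
  k q q - 2 * (w ⬝ᵥ fun i => k (x i) q) + w ⬝ᵥ (regMatrix k σ x *ᵥ w)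

/-- The weights of the observations in the posterior mean at `q`. -/
noncomputable def postWeights (k : ℝ → ℝ → ℝ) (σ : ℝ) {n : ℕ} (x : Fin n → ℝ) (q : ℝ) :
    Fin n → ℝ :=
  (regMatrix k σ x)⁻¹ *ᵥ fun i => k (x i) q

lemma one_le_prod_of_one_le {ι : Type*} (s : Finset ι) (f : ι → ℝ) (h : ∀ i ∈ s, 1 ≤ f i) :
    1 ≤ ∏ i ∈ s, f i :=
  Finset.prod_induction f (1 ≤ ·) (fun _ _ => one_le_mul_of_one_le_of_one_le) le_rfl h

section PSD

variable {k k₁ k₂ : ℝ → ℝ → ℝ} {σ : ℝ} {n : ℕ}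

lemma quadratic_form_eq (k : ℝ → ℝ → ℝ) (x c : Fin n → ℝ) :
    c ⬝ᵥ (kernelMatrix k x *ᵥ c) = ∑ i, ∑ j, c i * c j * k (x i) (x j) := by
  simp only [dotProduct, mulVec, kernelMatrix, Matrix.of_apply, Finset.mul_sum]
  refine Finset.sum_congr rfl fun i _ => Finset.sum_congr rfl fun j _ => by ring

lemma IsPSDKernel.posSemidef (hk : IsPSDKernel k) (x : Fin n → ℝ) :
    (kernelMatrix k x).PosSemidef := by
  refine PosSemidef.of_dotProduct_mulVec_nonneg ?_ fun c => ?_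
  · ext i j
    simp [kernelMatrix, hk.symm (x j) (x i)]
  · rw [star_trivial, quadratic_form_eq]
    exact hk.nonneg n x c

lemma IsPSDKernel.posDef (hk : IsPSDKernel k) (hσ : 0 < σ) (x : Fin n → ℝ) :
    (regMatrix k σ x).PosDef := by
  rw [regMatrix_eq]
  exact Matrix.PosDef.posSemidef_add (hk.posSemidef x) (PosDef.one.smul (by positivity))

lemma IsPSDKernel.det_pos (hk : IsPSDKernel k) (hσ : 0 < σ) (x : Fin n → ℝ) :
    0 < (regMatrix k σ x).det := (hk.posDef hσ x).det_pos

lemma IsPSDKernel.add (h₁ : IsPSDKernel k₁) (h₂ : IsPSDKernel k₂) :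
    IsPSDKernel (fun p q => k₁ p q + k₂ p q) where
  symm p q := by rw [h₁.symm, h₂.symm]
  nonneg n x c := by
    simp only [mul_add, Finset.sum_add_distrib]
    exact add_nonneg (h₁.nonneg n x c) (h₂.nonneg n x c)

lemma IsPSDKernel.self_nonneg (hk : IsPSDKernel k) (p : ℝ) : 0 ≤ k p p := by
  simpa using hk.nonneg 1 (fun _ => p) (fun _ => 1)

/-- Positivity of the kernel at the points `q, x` with the coefficients `-1, w`: the noise-free mean
squared error of a linear predictor. -/
lemma IsPSDKernel.sub_two_mul_add_nonneg (hk : IsPSDKernel k) (x : Fin n → ℝ) (q : ℝ)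
    (w : Fin n → ℝ) :
    0 ≤ k q q - 2 * (w ⬝ᵥ fun i => k (x i) q) + w ⬝ᵥ (kernelMatrix k x *ᵥ w) := by
  have h := hk.nonneg (n + 1) (Fin.cons q x) (Fin.cons (-1) w)
  rw [quadratic_form_eq]
  simp only [Fin.sum_univ_succ, Fin.cons_zero, Fin.cons_succ] at h
  have e : ∑ i, w i * k (x i) q = ∑ i, w i * k q (x i) :=
    Finset.sum_congr rfl fun i _ => by rw [hk.symm]
  have e1 : ∑ i, -1 * w i * k q (x i) = - ∑ i, w i * k (x i) q := by
    rw [e, ← Finset.sum_neg_distrib]; exact Finset.sum_congr rfl fun i _ => by ring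
  have e2 : ∑ i, w i * -1 * k (x i) q = - ∑ i, w i * k (x i) q := by
    rw [← Finset.sum_neg_distrib]; exact Finset.sum_congr rfl fun i _ => by ring
  rw [Finset.sum_add_distrib, e1, e2] at h
  simp only [dotProduct]
  linarith

lemma regMatrix_form (k : ℝ → ℝ → ℝ) (σ : ℝ) (x w : Fin n → ℝ) :
    w ⬝ᵥ (regMatrix k σ x *ᵥ w) = w ⬝ᵥ (kernelMatrix k x *ᵥ w) + σ ^ 2 * (w ⬝ᵥ w) := by
  simp [regMatrix_eq, Matrix.add_mulVec, dotProduct_add, Matrix.smul_mulVec, dotProduct_smul]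

lemma IsPSDKernel.residualVar_nonneg (hk : IsPSDKernel k) (x : Fin n → ℝ) (q : ℝ)
    (w : Fin n → ℝ) : 0 ≤ residualVar k σ x q w := by
  have := hk.sub_two_mul_add_nonneg x q w
  have h2 : 0 ≤ w ⬝ᵥ w := by simpa using dotProduct_star_self_nonneg w
  rw [residualVar, regMatrix_form]
  nlinarith [mul_nonneg (sq_nonneg σ) h2]

lemma IsPSDKernel.regMatrix_mulVec_postWeights (hk : IsPSDKernel k) (hσ : 0 < σ)
    (x : Fin n → ℝ) (q : ℝ) :
    regMatrix k σ x *ᵥ postWeights k σ x q = fun i => k (x i) q := by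
  rw [postWeights, Matrix.mulVec_mulVec, Matrix.mul_nonsing_inv _ (hk.det_pos hσ x).ne'.isUnit,
    Matrix.one_mulVec]

lemma IsPSDKernel.regMatrix_transpose (hk : IsPSDKernel k) (σ : ℝ) (x : Fin n → ℝ) :
    (regMatrix k σ x)ᵀ = regMatrix k σ x := by
  rw [regMatrix_eq]
  ext i j
  simp [kernelMatrix, hk.symm (x j) (x i), Matrix.one_apply, eq_comm]

lemma IsPSDKernel.dotProduct_inv_mulVec (hk : IsPSDKernel k) (σ : ℝ) (x : Fin n → ℝ) (q : ℝ)
    (v : Fin n → ℝ) :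
    (fun i => k (x i) q) ⬝ᵥ ((regMatrix k σ x)⁻¹ *ᵥ v) = postWeights k σ x q ⬝ᵥ v := by
  rw [postWeights, dotProduct_mulVec, ← Matrix.mulVec_transpose, Matrix.transpose_nonsing_inv,
    hk.regMatrix_transpose]

lemma IsPSDKernel.postMean_eq (hk : IsPSDKernel k) (σ : ℝ) (μ : ℝ → ℝ) (x y : Fin n → ℝ)
    (q : ℝ) :
    postMean μ k σ x y q = μ q + postWeights k σ x q ⬝ᵥ (fun i => y i - μ (x i)) := by
  rw [postMean, hk.dotProduct_inv_mulVec]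

lemma postCov_eq (k : ℝ → ℝ → ℝ) (σ : ℝ) (x : Fin n → ℝ) (q : ℝ) :
    postCov k σ x q q = k q q - postWeights k σ x q ⬝ᵥ (fun i => k (x i) q) := by
  rw [postCov, dotProduct_comm]; rfl

/-- Completing the square around the posterior weights. The posterior variance is thus the least
mean squared error among linear predictors, which is how posterior variances are compared below. -/
lemma IsPSDKernel.residualVar_eq (hk : IsPSDKernel k) (hσ : 0 < σ) (x : Fin n → ℝ) (q : ℝ)
    (w : Fin n → ℝ) :
    residualVar k σ x q w = postCov k σ x q q +
      (w - postWeights k σ x q) ⬝ᵥ (regMatrix k σ x *ᵥ (w - postWeights k σ x q)) := by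
  have h1 := hk.regMatrix_mulVec_postWeights hσ x q
  have h2 : postWeights k σ x q ⬝ᵥ (regMatrix k σ x *ᵥ w) = w ⬝ᵥ fun i => k (x i) q := by
    rw [dotProduct_mulVec, ← Matrix.mulVec_transpose, hk.regMatrix_transpose, h1,
      dotProduct_comm]
  rw [residualVar, postCov_eq, Matrix.mulVec_sub, h1, sub_dotProduct, dotProduct_sub,
    dotProduct_sub, h2]
  ring

lemma IsPSDKernel.postCov_le_residualVar (hk : IsPSDKernel k) (hσ : 0 < σ) (x : Fin n → ℝ)
    (q : ℝ) (w : Fin n → ℝ) : postCov k σ x q q ≤ residualVar k σ x q w := by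
  rw [hk.residualVar_eq hσ]
  have := (hk.posDef hσ x).posSemidef.dotProduct_mulVec_nonneg (w - postWeights k σ x q)
  rw [star_trivial] at this
  linarith

lemma IsPSDKernel.residualVar_postWeights (hk : IsPSDKernel k) (hσ : 0 < σ) (x : Fin n → ℝ)
    (q : ℝ) : residualVar k σ x q (postWeights k σ x q) = postCov k σ x q q := by
  rw [hk.residualVar_eq hσ]; simp

lemma IsPSDKernel.postCov_nonneg (hk : IsPSDKernel k) (hσ : 0 < σ) (x : Fin n → ℝ) (q : ℝ) :
    0 ≤ postCov k σ x q q := by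
  rw [← hk.residualVar_postWeights hσ]
  exact hk.residualVar_nonneg _ _ _

lemma IsPSDKernel.postCov_le (hk : IsPSDKernel k) (hσ : 0 < σ) (x : Fin n → ℝ) (q : ℝ) :
    postCov k σ x q q ≤ k q q := by
  simpa [residualVar] using hk.postCov_le_residualVar hσ x q 0

/-- Posterior variances are monotone in the kernel. -/
lemma IsPSDKernel.postCov_le_add (h₁ : IsPSDKernel k₁) (h₂ : IsPSDKernel k₂) (hσ : 0 < σ)
    (x : Fin n → ℝ) (q : ℝ) :
    postCov k₁ σ x q q ≤ postCov (fun p q => k₁ p q + k₂ p q) σ x q q := by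
  set w := postWeights (fun p q => k₁ p q + k₂ p q) σ x q
  rw [← (h₁.add h₂).residualVar_postWeights hσ]
  -- The optimal weights for the sum are merely admissible for `k₁`. The noise term appears once on
  -- each side, so what remains is the noise-free error for `k₂`.
  refine (h₁.postCov_le_residualVar hσ x q w).trans ?_
  have h := h₂.sub_two_mul_add_nonneg x q w
  have e1 : (w ⬝ᵥ fun i => k₁ (x i) q + k₂ (x i) q)
      = (w ⬝ᵥ fun i => k₁ (x i) q) + w ⬝ᵥ fun i => k₂ (x i) q := by
    rw [← dotProduct_add]; rfl
  have e2 : w ⬝ᵥ (kernelMatrix (fun p q => k₁ p q + k₂ p q) x *ᵥ w)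
      = w ⬝ᵥ (kernelMatrix k₁ x *ᵥ w) + w ⬝ᵥ (kernelMatrix k₂ x *ᵥ w) := by
    rw [← dotProduct_add, ← Matrix.add_mulVec]; rfl
  simp only [residualVar, regMatrix_form]
  change _ ≤ _ - 2 * (w ⬝ᵥ fun i => k₁ (x i) q + k₂ (x i) q) + _
  rw [e1]
  linarith

/-! ### Information gain along a sequence of points -/

/-- The second factor is the Schur complement of the block of the first `n` points. -/
lemma IsPSDKernel.det_regMatrix_succ (hk : IsPSDKernel k) (hσ : 0 < σ) (x : Fin (n + 1) → ℝ) :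
    (regMatrix k σ x).det = (regMatrix k σ (fun i : Fin n => x i.castSucc)).det *
      (σ ^ 2 + postCov k σ (fun i : Fin n => x i.castSucc) (x (Fin.last n)) (x (Fin.last n))) := by
  set A := regMatrix k σ (fun i : Fin n => x i.castSucc)
  set q := x (Fin.last n)
  set b : Fin n → ℝ := fun i => k (x i.castSucc) q
  have hA : IsUnit A.det := (hk.det_pos hσ _).ne'.isUnit
  have : Invertible A := A.invertibleOfIsUnitDet hA
  have hblock : (regMatrix k σ x).submatrix (finSumFinEquiv (m := n) (n := 1))
      (finSumFinEquiv (m := n) (n := 1)) =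
      Matrix.fromBlocks A (Matrix.of fun i _ => b i) (Matrix.of fun _ i => b i)
        (Matrix.of fun _ _ => k q q + σ ^ 2) := by
    ext i j
    rcases i with i | i <;> rcases j with j | j
    · simp [A, regMatrix_eq, kernelMatrix, Matrix.one_apply, Fin.castSucc, Fin.ext_iff]
    · have hj : (Fin.natAdd n j) = Fin.last n := by ext; simp
      have : (Fin.castAdd 1 i) ≠ Fin.last n := (Fin.castSucc_lt_last i).ne
      simp [hj, regMatrix_eq, kernelMatrix, b, this, q]
      rfl
    · have hj : (Fin.natAdd n i) = Fin.last n := by ext; simp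
      have : (Fin.last n) ≠ Fin.castAdd 1 j := (Fin.castSucc_lt_last j).ne'
      simp [hj, regMatrix_eq, kernelMatrix, b, this, q]
      rw [hk.symm]
      rfl
    · have hj : ∀ j : Fin 1, (Fin.natAdd n j) = Fin.last n := fun j => by ext; simp
      simp [hj, regMatrix_eq, kernelMatrix, q]
  rw [← Matrix.det_submatrix_equiv_self (finSumFinEquiv (m := n) (n := 1)), hblock,
    Matrix.det_fromBlocks₁₁]
  congr 1
  rw [Matrix.det_unique]
  have : (⅟A : Matrix _ _ ℝ) = A⁻¹ := Matrix.invOf_eq_nonsing_inv A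
  rw [this, postCov]
  have hm : ((Matrix.of fun (_ : Fin 1) i => b i) * A⁻¹ * Matrix.of fun i (_ : Fin 1) => b i)
      default default = b ⬝ᵥ (A⁻¹ *ᵥ b) := by
    rw [Matrix.mul_assoc]
    rfl
  rw [Matrix.sub_apply, hm]
  simp only [Matrix.of_apply]
  change k q q + σ ^ 2 - _ = σ ^ 2 + (k q q - b ⬝ᵥ (A⁻¹ *ᵥ b))
  ring

lemma one_add_smul_kernelMatrix (hσ : 0 < σ) (k : ℝ → ℝ → ℝ) (x : Fin n → ℝ) :
    (1 : Matrix (Fin n) (Fin n) ℝ) + (σ ^ 2)⁻¹ • kernelMatrix k x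
      = (σ ^ 2)⁻¹ • regMatrix k σ x := by
  rw [regMatrix_eq, smul_add, smul_smul, inv_mul_cancel₀ (by positivity), one_smul, add_comm]

/-- `det (I + σ⁻² K)` for the points `x`. -/
noncomputable def gainDet (k : ℝ → ℝ → ℝ) (σ : ℝ) {n : ℕ} (x : Fin n → ℝ) : ℝ :=
  ((1 : Matrix (Fin n) (Fin n) ℝ) + (σ ^ 2)⁻¹ • kernelMatrix k x).det

/-- The chain rule for information: by the Schur complement, each new point multiplies the
determinant by one plus its signal-to-noise ratio given the earlier points. -/
lemma IsPSDKernel.gainDet_eq_prod (hk : IsPSDKernel k) (hσ : 0 < σ) (p : ℕ → ℝ) (n : ℕ) :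
    gainDet k σ (fun i : Fin n => p i) =
      ∏ i ∈ Finset.range n, (1 + (σ ^ 2)⁻¹ * postCov k σ (fun j : Fin i => p j) (p i) (p i)) := by
  induction n with
  | zero => simp [gainDet]
  | succ n ih =>
    rw [Finset.prod_range_succ, ← ih, gainDet, gainDet, one_add_smul_kernelMatrix hσ,
      one_add_smul_kernelMatrix hσ, Matrix.det_smul, Matrix.det_smul, hk.det_regMatrix_succ hσ]
    simp only [Fintype.card_fin, Fin.val_castSucc, Fin.val_last]
    have : σ ^ 2 ≠ 0 := by positivity
    rw [pow_succ]
    field_simp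

lemma IsPSDKernel.gainDet_ge_one (hk : IsPSDKernel k) (hσ : 0 < σ) (x : Fin n → ℝ) :
    1 ≤ gainDet k σ x := by
  -- The points are continued by 0 to a sequence; only the first `n` entries enter.
  have h := hk.gainDet_eq_prod hσ (fun i => if h : i < n then x ⟨i, h⟩ else 0) n
  simp only [Fin.is_lt, dite_true, Fin.eta] at h
  rw [h]
  refine one_le_prod_of_one_le _ _ fun i _ => ?_
  have := hk.postCov_nonneg hσ
    (fun j : Fin i => if h : (j : ℕ) < n then x ⟨j, h⟩ else 0) (if h : i < n then x ⟨i, h⟩ else 0)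
  have h2 : 0 ≤ (σ ^ 2)⁻¹ := by positivity
  nlinarith [mul_nonneg h2 this]

lemma IsPSDKernel.gainDet_le (hk : IsPSDKernel k) (hσ : 0 < σ) {B : ℝ} (hB : ∀ p, k p p ≤ B)
    (x : Fin n → ℝ) : gainDet k σ x ≤ (1 + (σ ^ 2)⁻¹ * B) ^ n := by
  have h := hk.gainDet_eq_prod hσ (fun i => if h : i < n then x ⟨i, h⟩ else 0) n
  simp only [Fin.is_lt, dite_true, Fin.eta] at h
  rw [h]
  have h2 : 0 ≤ (σ ^ 2)⁻¹ := by positivity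
  refine (Finset.prod_le_prod (g := fun _ => 1 + (σ ^ 2)⁻¹ * B) (fun i _ => ?_)
    fun i _ => ?_).trans_eq (by simp)
  · have := mul_nonneg h2 (hk.postCov_nonneg hσ
      (fun j : Fin i => if h : (j : ℕ) < n then x ⟨j, h⟩ else 0)
      (if h : i < n then x ⟨i, h⟩ else 0))
    linarith
  · gcongr
    exact (hk.postCov_le hσ _ _).trans (hB _)

lemma infoGain_eq (k : ℝ → ℝ → ℝ) (σ : ℝ) (A : Finset ℝ) (e : Fin n ≃ A) :
    infoGain k σ A = 1 / 2 * Real.log (gainDet k σ (fun i => (e i : ℝ))) := by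
  rw [infoGain, gainDet, ← Matrix.det_submatrix_equiv_self e]
  congr 3
  ext i j
  simp [kernelMatrix, Matrix.one_apply]

lemma IsPSDKernel.bddAbove_infoGain (hk : IsPSDKernel k) (hσ : 0 < σ) {B : ℝ}
    (hB : ∀ p, k p p ≤ B) (S : Set ℝ) (T : ℕ) :
    BddAbove (infoGain k σ '' {A : Finset ℝ | (A : Set ℝ) ⊆ S ∧ A.card = T}) := by
  refine ⟨1 / 2 * Real.log ((1 + (σ ^ 2)⁻¹ * B) ^ T), ?_⟩
  rintro _ ⟨A, ⟨-, hA⟩, rfl⟩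
  rw [infoGain_eq k σ A (A.equivFinOfCardEq hA).symm]
  gcongr
  · exact zero_lt_one.trans_le (hk.gainDet_ge_one hσ _)
  · exact hk.gainDet_le hσ hB _

lemma continuous_gainDet (hc : Continuous (Function.uncurry k)) (σ : ℝ) (n : ℕ) :
    Continuous (fun x : Fin n → ℝ => gainDet k σ x) := by
  unfold gainDet
  refine Continuous.matrix_det ?_
  have h : Continuous fun x : Fin n → ℝ => kernelMatrix k x :=
    continuous_matrix fun i j => by
      change Continuous fun x : Fin n → ℝ => Function.uncurry k (x i, x j)
      fun_prop
  exact continuous_const.add ((continuous_const_smul ((σ ^ 2)⁻¹)).comp h)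

/-- The information gain of `T` points of an interval, repetitions allowed, is at most the maximum
information gain over sets of `T` points. -/
lemma IsPSDKernel.log_gainDet_le_maxInfoGain (hk : IsPSDKernel k) (hσ : 0 < σ) {B : ℝ}
    (hB : ∀ p, k p p ≤ B) (hc : Continuous (Function.uncurry k)) {a b : ℝ} (hab : a < b)
    (x : Fin n → ℝ) (hx : ∀ i, x i ∈ Set.Icc a b) :
    1 / 2 * Real.log (gainDet k σ x) ≤ maxInfoGain (Set.Icc a b) k σ n := by
  -- The supremum runs over sets of exactly `n` distinct prices, whereas a policy may repeat prices.
  -- Moving `x` slightly towards distinct points `z` removes coincidences and stays in the interval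
  -- by convexity; continuity of the determinant recovers `x` in the limit.
  set z : Fin n → ℝ := fun i => a + (b - a) * ((i : ℝ) / n)
  have hz : ∀ i, z i ∈ Set.Icc a b := fun i => by
    have h0 : (0 : ℝ) ≤ (i : ℝ) / n := by positivity
    have h1 : (i : ℝ) / n ≤ 1 :=
      div_le_one_of_le₀ (by exact_mod_cast i.2.le) (Nat.cast_nonneg n)
    constructor <;> simp only [z] <;> nlinarith
  have hzinj : ∀ i j, i ≠ j → z i ≠ z j := fun i j hij h => hij <| by
    have hn : (n : ℝ) ≠ 0 := by exact_mod_cast (i.pos).ne'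
    have h1 : (b - a) * ((i : ℝ) / n) = (b - a) * ((j : ℝ) / n) := by
      simpa [z] using h
    have h2 := mul_left_cancel₀ (sub_pos.2 hab).ne' h1
    rw [div_left_inj' hn] at h2
    exact Fin.ext (by exact_mod_cast h2)
  set y : ℝ → Fin n → ℝ := fun ε i => (1 - ε) * x i + ε * z i
  have hycont : Continuous y := by fun_prop
  have hy0 : y 0 = x := by ext; simp [y]
  have hlim : Tendsto (fun ε => 1 / 2 * Real.log (gainDet k σ (y ε))) (𝓝[>] 0)
      (𝓝 (1 / 2 * Real.log (gainDet k σ x))) := by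
    have h : ContinuousAt (fun ε => 1 / 2 * Real.log (gainDet k σ (y ε))) 0 := by
      refine continuousAt_const.mul (ContinuousAt.log ?_ ?_)
      · exact ((continuous_gainDet hc σ n).comp hycont).continuousAt
      · rw [hy0]
        exact (zero_lt_one.trans_le (hk.gainDet_ge_one hσ _)).ne'
    have := h.tendsto.mono_left (nhdsWithin_le_nhds (s := Set.Ioi 0))
    rwa [hy0] at this
  refine le_of_tendsto hlim ?_
  have hinj : ∀ᶠ ε in 𝓝[>] (0 : ℝ), ∀ i j, i ≠ j → y ε i ≠ y ε j := by
    rw [Filter.eventually_all]; intro i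
    rw [Filter.eventually_all]; intro j
    by_cases hij : i = j
    · exact Filter.Eventually.of_forall fun _ h => absurd hij h
    -- Coinciding points are separated by `z` for every `ε > 0`; distinct points stay distinct for
    -- small `ε` by continuity.
    by_cases hxx : x i = x j
    · filter_upwards [self_mem_nhdsWithin] with ε hε _ h
      simp only [y, hxx, add_right_inj] at h
      exact hzinj i j hij (mul_left_cancel₀ (ne_of_gt hε) h)
    · have hc : Continuous fun ε => y ε i - y ε j :=
        ((continuous_apply i).comp hycont).sub ((continuous_apply j).comp hycont)
      have h0 : y 0 i - y 0 j ≠ 0 := by rw [hy0]; exact sub_ne_zero.2 hxx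
      filter_upwards [(hc.continuousAt.eventually_ne h0).filter_mono nhdsWithin_le_nhds]
        with ε hε _
      exact sub_ne_zero.1 hε
  have h01 : ∀ᶠ ε in 𝓝[>] (0 : ℝ), ε ∈ Set.Ioo (0 : ℝ) 1 := Ioo_mem_nhdsGT zero_lt_one
  filter_upwards [hinj, h01] with ε hε hε1
  have hyinj : Function.Injective (y ε) := fun i j h => by
    by_contra hne
    exact hε i j hne h
  set A : Finset ℝ := Finset.univ.map ⟨y ε, hyinj⟩
  have hA : A.card = n := by simp [A]
  let e : Fin n ≃ A := Equiv.ofBijective (fun i => ⟨y ε i, by simp [A]⟩) <| by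
    constructor
    · intro i j h
      exact hyinj (congrArg Subtype.val h)
    · rintro ⟨_, h⟩
      obtain ⟨i, -, rfl⟩ := Finset.mem_map.1 h
      exact ⟨i, rfl⟩
  have := infoGain_eq k σ A e
  change _ = 1 / 2 * Real.log (gainDet k σ (y ε)) at this
  rw [← this]
  refine le_csSup (hk.bddAbove_infoGain hσ hB _ _) ⟨A, ⟨?_, hA⟩, rfl⟩
  intro p hp
  obtain ⟨i, -, rfl⟩ := Finset.mem_map.1 (Finset.mem_coe.1 hp)
  have h1 := hx i
  have h2 := hz i
  have h3 := hε1.1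
  have h4 := hε1.2
  change (1 - ε) * x i + ε * z i ∈ _
  exact (convex_Icc a b) h1 h2 (by linarith) h3.le (by ring)

/-- The sum of the posterior variances along a sequence of points is at most a constant times the
maximum information gain. -/
lemma IsPSDKernel.sum_postCov_le (hk : IsPSDKernel k) (hσ : 0 < σ) {B : ℝ}
    (hB : ∀ p, k p p ≤ B) (hc : Continuous (Function.uncurry k)) {a b : ℝ} (hab : a < b)
    (p : ℕ → ℝ) (hp : ∀ i, p i ∈ Set.Icc a b) (n : ℕ) :
    ∑ i ∈ Finset.range n, postCov k σ (fun j : Fin i => p j) (p i) (p i)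
      ≤ 2 * (σ ^ 2 + B) * maxInfoGain (Set.Icc a b) k σ n := by
  have hmax := hk.log_gainDet_le_maxInfoGain hσ hB hc hab (fun i : Fin n => p i) fun i => hp i
  have hB0 : 0 ≤ B := (hk.self_nonneg 0).trans (hB 0)
  have hσ2 : 0 < σ ^ 2 := by positivity
  set v : ℕ → ℝ := fun i => postCov k σ (fun j : Fin i => p j) (p i) (p i)
  have hv0 : ∀ i, 0 ≤ v i := fun i => hk.postCov_nonneg hσ _ _
  have hvB : ∀ i, v i ≤ B := fun i => (hk.postCov_le hσ _ _).trans (hB _)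
  have hpos : ∀ i, 0 < 1 + (σ ^ 2)⁻¹ * v i := fun i => by
    have := hv0 i; positivity
  rw [hk.gainDet_eq_prod hσ, Real.log_prod (fun i _ => (hpos i).ne')] at hmax
  calc ∑ i ∈ Finset.range n, v i
      ≤ ∑ i ∈ Finset.range n, (σ ^ 2 + B) * Real.log (1 + (σ ^ 2)⁻¹ * v i) := by
        refine Finset.sum_le_sum fun i _ => ?_
        -- The inequality 1 - 1/u ≤ log u at u = 1 + v/σ² gives v/(σ² + v) ≤ log(1 + v/σ²), and σ² +
        -- v ≤ σ² + B turns the left side into a multiple of v.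
        have h1 := Real.one_sub_inv_le_log_of_pos (hpos i)
        have h2 : 1 - (1 + (σ ^ 2)⁻¹ * v i)⁻¹ = v i / (σ ^ 2 + v i) := by
          have := hv0 i
          have h3 : σ ^ 2 + v i ≠ 0 := by positivity
          field_simp
          ring
        have h3 : v i ≤ (σ ^ 2 + B) * (v i / (σ ^ 2 + v i)) := by
          have h4 := hv0 i
          have h5 := hvB i
          rw [mul_div_assoc', le_div_iff₀ (by positivity)]
          nlinarith
        rw [h2] at h1
        exact h3.trans (by gcongr)
    _ = 2 * (σ ^ 2 + B) *
        (1 / 2 * ∑ i ∈ Finset.range n, Real.log (1 + (σ ^ 2)⁻¹ * v i)) := by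
        rw [← Finset.mul_sum]; ring
    _ ≤ _ := by gcongr

/-- The maximum information gain is bounded below by the information gain of one point. -/
lemma IsPSDKernel.log_le_maxInfoGain (hk : IsPSDKernel k) (hσ : 0 < σ) {B : ℝ}
    (hB : ∀ p, k p p ≤ B) (hc : Continuous (Function.uncurry k)) {a b : ℝ} (hab : a < b)
    {p : ℝ} (hp : p ∈ Set.Icc a b) (hn : 1 ≤ n) :
    1 / 2 * Real.log (1 + (σ ^ 2)⁻¹ * k p p) ≤ maxInfoGain (Set.Icc a b) k σ n := by
  refine le_trans ?_ (hk.log_gainDet_le_maxInfoGain hσ hB hc hab (fun _ : Fin n => p) fun _ => hp)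
  have h0 := hk.self_nonneg p
  gcongr
  -- The price `p` is repeated `n` times: the factor of index 0 uses the prior variance, and the
  -- later factors are at least 1.
  have := hk.gainDet_eq_prod hσ (fun _ => p) n
  rw [this]
  obtain ⟨m, rfl⟩ : ∃ m, n = m + 1 := ⟨n - 1, by omega⟩
  rw [Finset.prod_range_succ']
  have h1 : postCov k σ (fun _ : Fin 0 => p) p p = k p p := by simp [postCov]
  rw [h1]
  refine le_mul_of_one_le_left (by positivity) ?_
  refine one_le_prod_of_one_le _ _ fun i _ => ?_
  have := hk.postCov_nonneg hσ (fun _ : Fin (i + 1) => p) p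
  have : 0 ≤ (σ ^ 2)⁻¹ * postCov k σ (fun _ : Fin (i + 1) => p) p p := by positivity
  linarith

end PSD

end GPPricing

namespace GPPricing

open scoped ENNReal

/-! ### The law of adaptively collected observations -/

section Adaptive

variable {Θ E Ω : Type*}

/-- The points chosen by the rule `x` along the observations `y`. -/
def chosenPoints (x : (n : ℕ) → (Fin n → E) → ℝ) (n : ℕ) (y : Fin n → E) (i : Fin n) : ℝ :=
  x i (fun j : Fin i => y (Fin.castLE i.2.le j))

/-- The first `n` observations of the function `m θ` with noise `e`, when the points are chosen by
the rule `x` from the earlier observations. -/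
def observations [Add E] (m : Θ → ℝ → E) (x : (n : ℕ) → (Fin n → E) → ℝ) (θ : Θ) (e : ℕ → E) :
    (n : ℕ) → Fin n → E
  | 0 => Fin.elim0
  | n + 1 => Fin.snoc (α := fun _ => E) (observations m x θ e n)
      (m θ (x n (observations m x θ e n)) + e (n + 1))

/-- The likelihood of the observations `y` given `θ`, for noise of density `ρ`. -/
noncomputable def likelihood [Sub E] (ρ : E → ℝ≥0∞) (m : Θ → ℝ → E)
    (x : (n : ℕ) → (Fin n → E) → ℝ) (n : ℕ) (θ : Θ) (y : Fin n → E) : ℝ≥0∞ :=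
  ∏ i, ρ (y i - m θ (chosenPoints x n y i))

lemma chosenPoints_snoc_castSucc (x : (n : ℕ) → (Fin n → E) → ℝ) (n : ℕ) (o : Fin n → E) (y : E)
    (i : Fin n) :
    chosenPoints x (n + 1) (Fin.snoc (α := fun _ => E) o y) i.castSucc = chosenPoints x n o i := by
  unfold chosenPoints
  congr 1
  funext j
  exact Fin.snoc_castSucc (α := fun _ => E) y o (Fin.castLE i.2.le j)

lemma chosenPoints_snoc_last (x : (n : ℕ) → (Fin n → E) → ℝ) (n : ℕ) (o : Fin n → E) (y : E) :
    chosenPoints x (n + 1) (Fin.snoc (α := fun _ => E) o y) (Fin.last n) = x n o := by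
  unfold chosenPoints
  congr 1
  funext j
  exact Fin.snoc_castSucc (α := fun _ => E) y o j

lemma likelihood_snoc [Sub E] (ρ : E → ℝ≥0∞) (m : Θ → ℝ → E) (x : (n : ℕ) → (Fin n → E) → ℝ)
    (n : ℕ) (θ : Θ) (o : Fin n → E) (y : E) :
    likelihood ρ m x (n + 1) θ (Fin.snoc (α := fun _ => E) o y)
      = likelihood ρ m x n θ o * ρ (y - m θ (x n o)) := by
  simp only [likelihood, Fin.prod_univ_castSucc, chosenPoints_snoc_castSucc,
    chosenPoints_snoc_last, Fin.snoc_castSucc, Fin.snoc_last]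

lemma measurable_chosenPoints [MeasurableSpace E] {x : (n : ℕ) → (Fin n → E) → ℝ}
    (hx : ∀ n, Measurable (x n)) (n : ℕ) : Measurable (chosenPoints x n) :=
  measurable_pi_lambda _ fun i =>
    (hx i).comp (measurable_pi_lambda _ fun _ => measurable_pi_apply _)

lemma measurable_snoc [MeasurableSpace E] {α : Type*} {mα : MeasurableSpace α} {n : ℕ}
    {f : α → Fin n → E} {g : α → E} (hf : Measurable f) (hg : Measurable g) :
    Measurable (fun a => Fin.snoc (α := fun _ => E) (f a) (g a) : α → Fin (n + 1) → E) := by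
  refine measurable_pi_lambda _ fun i => ?_
  refine Fin.lastCases ?_ (fun j => ?_) i
  · simpa only [Fin.snoc_last] using hg
  · simp only [Fin.snoc_castSucc]
    exact (measurable_pi_apply j).comp hf

variable [MeasurableSpace Θ] [AddCommGroup E] [MeasureSpace E] [MeasurableAdd₂ E] [MeasurableSub₂ E]

omit [MeasurableAdd₂ E] in
lemma measurable_likelihood {ρ : E → ℝ≥0∞} (hρ : Measurable ρ) {m : Θ → ℝ → E}
    (hm : Measurable (Function.uncurry m)) {x : (n : ℕ) → (Fin n → E) → ℝ}
    (hx : ∀ n, Measurable (x n)) (n : ℕ) :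
    Measurable (fun z : Θ × (Fin n → E) => likelihood ρ m x n z.1 z.2) := by
  unfold likelihood
  refine Finset.measurable_fun_prod _ fun i _ => hρ.comp ?_
  refine ((measurable_pi_apply i).comp measurable_snd).sub (hm.comp (measurable_fst.prodMk ?_))
  exact (measurable_pi_apply i).comp ((measurable_chosenPoints hx n).comp measurable_snd)

omit [MeasurableSub₂ E] in
lemma measurable_observations {m : Θ → ℝ → E} (hm : Measurable (Function.uncurry m))
    {x : (n : ℕ) → (Fin n → E) → ℝ} (hx : ∀ n, Measurable (x n)) {𝓖 : ℕ → MeasurableSpace Ω}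
    (h𝓖 : Monotone 𝓖) {θ : Ω → Θ} (hθ : Measurable[𝓖 0] θ) {ε : ℕ → Ω → E}
    (hε : ∀ n, Measurable[𝓖 n] (ε n)) (n : ℕ) :
    Measurable[𝓖 n] (fun ω => observations m x (θ ω) (fun t => ε t ω) n) := by
  induction n with
  | zero => exact @measurable_const _ _ _ (𝓖 0) Fin.elim0
  | succ n ih =>
    have h1 : Measurable[𝓖 (n + 1)] (fun ω => observations m x (θ ω) (fun t => ε t ω) n) :=
      ih.mono (h𝓖 n.le_succ) le_rfl
    have h2 : Measurable[𝓖 (n + 1)] θ := hθ.mono (h𝓖 (Nat.zero_le _)) le_rfl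
    exact @measurable_snoc E _ Ω (𝓖 (n + 1)) n _ _ h1 <|
      (hm.comp (h2.prodMk ((hx n).comp h1))).add (hε (n + 1))

variable {mΩ : MeasurableSpace Ω} {P : Measure Ω} [IsProbabilityMeasure P]
  [SigmaFinite (volume : Measure E)] [(volume : Measure E).IsAddRightInvariant]

/-- Given `θ`, adaptively collected observations have the density `likelihood`. -/
theorem lintegral_observations {ρ : E → ℝ≥0∞} (hρ : Measurable ρ) {m : Θ → ℝ → E}
    (hm : Measurable (Function.uncurry m)) {x : (n : ℕ) → (Fin n → E) → ℝ}
    (hx : ∀ n, Measurable (x n)) {𝓖 : ℕ → MeasurableSpace Ω} (h𝓖 : Monotone 𝓖)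
    (h𝓖le : ∀ n, 𝓖 n ≤ mΩ) {θ : Ω → Θ} (hθ : Measurable[𝓖 0] θ) {ε : ℕ → Ω → E}
    (hε : ∀ n, Measurable[𝓖 n] (ε n))
    (hlaw : ∀ n, P.map (ε n) = volume.withDensity ρ)
    (hindep : ∀ n, Indep (𝓖 n) (MeasurableSpace.comap (ε (n + 1)) inferInstance) P)
    (n : ℕ) {Ψ : Θ → (Fin n → E) → ℝ≥0∞} (hΨ : Measurable (Function.uncurry Ψ)) :
    ∫⁻ ω, Ψ (θ ω) (observations m x (θ ω) (fun t => ε t ω) n) ∂P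
      = ∫⁻ y, ∫⁻ ω, Ψ (θ ω) y * likelihood ρ m x n (θ ω) y ∂P := by
  have hθm : Measurable θ := hθ.mono (h𝓖le 0) le_rfl
  have hεm : ∀ n, Measurable (ε n) := fun n => (hε n).mono (h𝓖le n) le_rfl
  induction n with
  | zero =>
    rw [volume_pi, Measure.pi_of_empty, lintegral_dirac]
    simp only [likelihood, Finset.univ_eq_empty, Finset.prod_empty, mul_one]
    refine lintegral_congr fun ω => ?_
    congr 1
  | succ n ih =>
    set obs := fun ω => observations m x (θ ω) (fun t => ε t ω) n
    have hobs𝓖 : Measurable[𝓖 n] obs := measurable_observations hm hx h𝓖 hθ hε n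
    have hobs : Measurable obs := hobs𝓖.mono (h𝓖le n) le_rfl
    have hθobs𝓖 : Measurable[𝓖 n] (fun ω => (θ ω, obs ω)) :=
      (hθ.mono (h𝓖 (Nat.zero_le n)) le_rfl).prodMk hobs𝓖
    have hθobs : Measurable (fun ω => (θ ω, obs ω)) := hθm.prodMk hobs
    have hind : IndepFun (fun ω => (θ ω, obs ω)) (ε (n + 1)) P :=
      indep_of_indep_of_le_left (hindep n) hθobs𝓖.comap_le
    have hsf : SFinite (volume.withDensity ρ) := inferInstance
    set G : (Θ × (Fin n → E)) × E → ℝ≥0∞ := fun z =>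
      Ψ z.1.1 (Fin.snoc (α := fun _ => E) z.1.2 (m z.1.1 (x n z.1.2) + z.2))
    have hmx : Measurable fun z : Θ × (Fin n → E) => m z.1 (x n z.2) :=
      hm.comp (measurable_fst.prodMk ((hx n).comp measurable_snd))
    have hG : Measurable G := by
      refine hΨ.comp ((measurable_fst.comp measurable_fst).prodMk
        (measurable_snoc (measurable_snd.comp measurable_fst) ?_))
      exact (hmx.comp measurable_fst).add measurable_snd
    have hΨ' : Measurable fun z : (Θ × (Fin n → E)) × E =>
        Ψ z.1.1 (Fin.snoc (α := fun _ => E) z.1.2 z.2) * ρ (z.2 - m z.1.1 (x n z.1.2)) := by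
      refine Measurable.mul ?_ ?_
      · exact hΨ.comp ((measurable_fst.comp measurable_fst).prodMk
          (measurable_snoc (measurable_snd.comp measurable_fst) measurable_snd))
      · exact hρ.comp (measurable_snd.sub (hmx.comp measurable_fst))
    -- The next point is a function of `(θ, obs)`, which is independent of the new noise.
    -- Integrating this noise out and translating by the noiseless value produces the new likelihood
    -- factor.
    have step : ∫⁻ ω, Ψ (θ ω) (observations m x (θ ω) (fun t => ε t ω) (n + 1)) ∂P
        = ∫⁻ ω, (∫⁻ y, Ψ (θ ω) (Fin.snoc (α := fun _ => E) (obs ω) y)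
            * ρ (y - m (θ ω) (x n (obs ω)))) ∂P := by
      have h1 : ∫⁻ ω, G ((θ ω, obs ω), ε (n + 1) ω) ∂P
          = ∫⁻ z, G z ∂((P.map fun ω => (θ ω, obs ω)).prod (volume.withDensity ρ)) := by
        rw [← hlaw (n + 1), ← (indepFun_iff_map_prod_eq_prod_map_map hθobs.aemeasurable
          (hεm (n + 1)).aemeasurable).1 hind, lintegral_map hG (hθobs.prodMk (hεm (n + 1)))]
      have h2 : ∀ z : Θ × (Fin n → E), ∫⁻ e, G (z, e) ∂(volume.withDensity ρ)
          = ∫⁻ y, Ψ z.1 (Fin.snoc (α := fun _ => E) z.2 y) * ρ (y - m z.1 (x n z.2)) := by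
        intro z
        have hGz : Measurable fun e => G (z, e) := hG.comp measurable_prodMk_left
        rw [lintegral_withDensity_eq_lintegral_mul _ hρ hGz,
          ← lintegral_sub_right_eq_self _ (m z.1 (x n z.2))]
        refine lintegral_congr fun y => ?_
        simp only [Pi.mul_apply, G, add_sub_cancel]
        rw [mul_comm]
      change ∫⁻ ω, G ((θ ω, obs ω), ε (n + 1) ω) ∂P = _
      rw [h1, lintegral_prod _ hG.aemeasurable]
      simp_rw [h2]
      rw [lintegral_map _ hθobs]
      exact hΨ'.lintegral_prod_right'
    rw [step]
    -- The induction hypothesis is used for the function already integrated over the last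
    -- observation; the rest is Tonelli and splitting off the last coordinate.
    rw [ih (Ψ := fun t o => ∫⁻ y, Ψ t (Fin.snoc (α := fun _ => E) o y) * ρ (y - m t (x n o)))
      hΨ'.lintegral_prod_right']
    have hmp := (volume_preserving_piFinSuccAbove (fun _ : Fin (n + 1) => E) (Fin.last n)).symm
    rw [← hmp.lintegral_comp_emb (MeasurableEquiv.measurableEmbedding _), Measure.volume_eq_prod]
    have hF : Measurable fun z : (E × (Fin n → E)) × Ω =>
        Ψ (θ z.2) (Fin.snoc (α := fun _ => E) z.1.2 z.1.1) *
          (likelihood ρ m x n (θ z.2) z.1.2 * ρ (z.1.1 - m (θ z.2) (x n z.1.2))) := by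
      have h1 : Measurable fun z : (E × (Fin n → E)) × Ω => (θ z.2, z.1.2) := by fun_prop
      refine Measurable.mul ?_ (((measurable_likelihood hρ hm hx n).comp h1).mul ?_)
      · exact hΨ.comp ((hθm.comp measurable_snd).prodMk (measurable_snoc
          (measurable_snd.comp measurable_fst) (measurable_fst.comp measurable_fst)))
      · exact hρ.comp ((measurable_fst.comp measurable_fst).sub (hmx.comp h1))
    have hsymm : ∀ z : E × (Fin n → E),
        (MeasurableEquiv.piFinSuccAbove (fun _ : Fin (n + 1) => E) (Fin.last n)).symm z
          = Fin.snoc (α := fun _ => E) z.2 z.1 := fun z => by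
      change Fin.insertNth (α := fun _ => E) (Fin.last n) z.1 z.2 = _
      rw [Fin.insertNth_last']
    simp_rw [hsymm, likelihood_snoc]
    rw [lintegral_prod_symm' _ hF.lintegral_prod_right']
    refine lintegral_congr fun o => ?_
    rw [lintegral_lintegral_swap]
    · refine lintegral_congr fun ω => ?_
      rw [← lintegral_mul_const]
      · refine lintegral_congr fun y => ?_
        ring
      · exact hΨ'.comp (f := fun y : E => ((θ ω, o), y)) (by fun_prop)
    · exact (hF.comp (f := fun w : E × Ω => ((w.1, o), w.2)) (by fun_prop)).aemeasurable

end Adaptive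

end GPPricing

namespace GPPricing

open scoped ENNReal
open Matrix

/-! ### Gaussian process regression at fixed points -/

section FixedDesign

variable {Ω : Type*} {mΩ : MeasurableSpace Ω} {P : Measure Ω} [IsProbabilityMeasure P]

/-- The hypotheses make the joint law a product of three measures, which may be bracketed the other
way. -/
lemma indepFun_prodMk_left {α β γ : Type*} {mα : MeasurableSpace α}
    {mβ : MeasurableSpace β} {mγ : MeasurableSpace γ} {X : Ω → α} {Y : Ω → β} {Z : Ω → γ}
    (hX : Measurable X) (hY : Measurable Y) (hZ : Measurable Z)
    (h1 : IndepFun X (fun ω => (Y ω, Z ω)) P) (h2 : IndepFun Y Z P) :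
    IndepFun (fun ω => (X ω, Y ω)) Z P := by
  have h3 : IndepFun X Y P := h1.comp measurable_id measurable_fst
  rw [indepFun_iff_map_prod_eq_prod_map_map (by fun_prop) (by fun_prop)] at h1 h2 h3 ⊢
  rw [h2] at h1
  have := Measure.isProbabilityMeasure_map (μ := P) hX.aemeasurable
  have := Measure.isProbabilityMeasure_map (μ := P) hY.aemeasurable
  have := Measure.isProbabilityMeasure_map (μ := P) hZ.aemeasurable
  have h4 : P.map (fun ω => ((X ω, Y ω), Z ω))
      = (P.map fun ω => (X ω, (Y ω, Z ω))).map MeasurableEquiv.prodAssoc.symm := by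
    rw [Measure.map_map (by fun_prop) (by fun_prop)]
    rfl
  rw [h4, h1, h3, ← Measure.prodAssoc_prod, MeasurableEquiv.map_symm_map]

/-- The filtration of the parameter and the past noise. -/
lemma exists_noise_filtration {Θ E : Type*} [MeasurableSpace Θ] [MeasurableSpace E] {θ : Ω → Θ}
    (hθ : Measurable θ) {ε : ℕ → Ω → E} (hε : ∀ n, Measurable (ε n))
    (h1 : IndepFun θ (fun ω t => ε t ω) P)
    (h2 : ∀ n, IndepFun (fun ω (i : Finset.Iic n) => ε i ω) (ε (n + 1)) P) :
    ∃ 𝓖 : ℕ → MeasurableSpace Ω, Monotone 𝓖 ∧ (∀ n, 𝓖 n ≤ mΩ) ∧ Measurable[𝓖 0] θ ∧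
      (∀ n, Measurable[𝓖 n] (ε n)) ∧
      ∀ n, Indep (𝓖 n) (MeasurableSpace.comap (ε (n + 1)) inferInstance) P := by
  -- `𝓖 n` is generated by `θ` and the noises of index at most `n`. Round `n + 1` uses `ε (n + 1)`,
  -- so `ε 0` enters no observation.
  set Z : (n : ℕ) → Ω → Θ × (Finset.Iic n → E) := fun n ω => (θ ω, fun i => ε i ω)
  have hZ : ∀ n, Measurable (Z n) := fun n =>
    hθ.prodMk (measurable_pi_lambda _ fun i => hε i)
  refine ⟨fun n => MeasurableSpace.comap (Z n) inferInstance, ?_, ?_, ?_, ?_, ?_⟩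
  · intro m n hmn
    have : Z m = (fun z : Θ × (Finset.Iic n → E) => ((z.1, fun i : Finset.Iic m =>
        z.2 ⟨i, Finset.mem_Iic.2 ((Finset.mem_Iic.1 i.2).trans hmn)⟩) :
        Θ × (Finset.Iic m → E))) ∘ Z n := rfl
    change MeasurableSpace.comap (Z m) _ ≤ _
    rw [this, ← MeasurableSpace.comap_comp]
    refine MeasurableSpace.comap_mono ?_
    exact Measurable.comap_le (by fun_prop)
  · exact fun n => (hZ n).comap_le
  · exact measurable_fst.comp (comap_measurable (Z 0))
  · intro n
    have : ε n = (fun z : Θ × (Finset.Iic n → E) => z.2 ⟨n, Finset.mem_Iic.2 le_rfl⟩) ∘ Z n := rfl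
    have h : Measurable (fun z : Θ × (Finset.Iic n → E) => z.2 ⟨n, Finset.mem_Iic.2 le_rfl⟩) := by
      fun_prop
    exact h.comp (comap_measurable (Z n))
  · intro n
    refine indepFun_prodMk_left hθ (measurable_pi_lambda _ fun i => hε i) (hε _) ?_ (h2 n)
    exact h1.comp measurable_id (ψ := fun e : ℕ → E => ((fun i : Finset.Iic n => e i), e (n + 1)))
      (by fun_prop)

variable {μ : ℝ → ℝ} {k : ℝ → ℝ → ℝ} {g : ℝ → Ω → ℝ}

omit [IsProbabilityMeasure P] in
lemma IsGPSample.memLp (hg : IsGPSample P Set.univ μ k g) (p : ℝ) : MemLp (g p) 2 P :=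
  (hg.gaussian.hasGaussianLaw_eval ⟨p, Set.mem_univ p⟩).memLp_two

/-- The quadratic form is the variance of a linear combination of values of the process. -/
lemma IsGPSample.isPSDKernel (hg : IsGPSample P Set.univ μ k g) : IsPSDKernel k where
  symm p q := by
    rw [← hg.covariance p (Set.mem_univ p) q (Set.mem_univ q), covariance_comm,
      hg.covariance q (Set.mem_univ q) p (Set.mem_univ p)]
  nonneg n x c := by
    have h := covariance_fun_sum_fun_sum (μ := P) (X := fun i ω => c i * g (x i) ω)
      (Y := fun i ω => c i * g (x i) ω) (fun i => (hg.memLp (x i)).const_mul _)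
      (fun i => (hg.memLp (x i)).const_mul _)
    simp only [covariance_const_mul_left, covariance_const_mul_right,
      hg.covariance _ (Set.mem_univ _) _ (Set.mem_univ _)] at h
    calc 0 ≤ cov[fun ω => ∑ i, c i * g (x i) ω, fun ω => ∑ i, c i * g (x i) ω; P] := by
          rw [covariance_self]
          · exact variance_nonneg _ _
          · exact Finset.aemeasurable_fun_sum _ fun i _ => ((hg.memLp _).const_mul _).1.aemeasurable
      _ = _ := by
          rw [h]
          exact Finset.sum_congr rfl fun i _ => Finset.sum_congr rfl fun j _ => by ring

omit [IsProbabilityMeasure P] in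
lemma IsGPSample.hasGaussianLaw_pi (hg : IsGPSample P Set.univ μ k g) {n : ℕ} (x : Fin n → ℝ) :
    HasGaussianLaw (fun ω i => g (x i) ω) P := by
  have h := hg.gaussian.comp_right fun i : Fin n => (⟨x i, Set.mem_univ _⟩ : (Set.univ : Set ℝ))
  exact (h.hasGaussianLaw Finset.univ).map_fun
    (ContinuousLinearMap.pi fun i : Fin n =>
      ContinuousLinearMap.proj (R := ℝ) (φ := fun _ : (Finset.univ : Finset (Fin n)) => ℝ)
        ⟨i, Finset.mem_univ i⟩)

/-- The residual of the regression of `g q` on noisy observations is Gaussian with the posterior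
variance, and independent of the observations. -/
lemma IsGPSample.residual_law (hg : IsGPSample P Set.univ μ k g) {σ : ℝ} (hσ : 0 < σ) {n : ℕ}
    {e : Fin n → Ω → ℝ} (hlaw : ∀ i, HasLaw (e i) (gaussianReal 0 (σ ^ 2).toNNReal) P)
    (hind : iIndepFun e P) (hge : IndepFun (fun ω p => g p ω) (fun ω i => e i ω) P)
    (x : Fin n → ℝ) (q : ℝ) :
    IndepFun (fun ω => g q ω - ∑ i, postWeights k σ x q i * (g (x i) ω + e i ω))
        (fun ω i => g (x i) ω + e i ω) P ∧
      P.map (fun ω => g q ω - ∑ i, postWeights k σ x q i * (g (x i) ω + e i ω))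
        = gaussianReal (μ q - ∑ i, postWeights k σ x q i * μ (x i))
            (postCov k σ x q q).toNNReal := by
  have hk := hg.isPSDKernel
  set w := postWeights k σ x q
  set Y : Fin n → Ω → ℝ := fun i ω => g (x i) ω + e i ω
  set W : Ω → ℝ := fun ω => g q ω - ∑ i, w i * Y i ω
  have hG1 := hg.hasGaussianLaw_pi (Fin.cons q x : Fin (n + 1) → ℝ)
  have hG2 : HasGaussianLaw (fun ω i => e i ω) P :=
    hind.hasGaussianLaw fun i => (hlaw i).hasGaussianLaw
  have hG12 := IndepFun.hasGaussianLaw hG1 hG2 <|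
    hge.comp (φ := fun (u : ℝ → ℝ) (i : Fin (n + 1)) => u ((Fin.cons q x : Fin (n + 1) → ℝ) i))
      (by fun_prop) measurable_id
  -- The residual and the observations form a linear image of the Gaussian vector of the values at
  -- `q, x` and the noises, hence are jointly Gaussian.
  let L : ((Fin (n + 1) → ℝ) × (Fin n → ℝ)) →ₗ[ℝ] (Unit → ℝ) × (Fin n → ℝ) :=
    { toFun := fun z => (fun _ => z.1 0 - ∑ i, w i * (z.1 i.succ + z.2 i),
        fun i => z.1 i.succ + z.2 i)
      map_add' := fun z z' => by
        ext i
        · simp only [Prod.fst_add, Prod.snd_add, Pi.add_apply]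
          have : ∀ i, w i * (z.1 (Fin.succ i) + z'.1 (Fin.succ i) + (z.2 i + z'.2 i))
            = w i * (z.1 (Fin.succ i) + z.2 i) + w i * (z'.1 (Fin.succ i) + z'.2 i) :=
              fun i => by ring
          simp only [this, Finset.sum_add_distrib]
          ring
        · simp only [Prod.fst_add, Prod.snd_add, Pi.add_apply]
          ring
      map_smul' := fun c z => by
        ext i
        · simp only [Prod.smul_fst, Prod.smul_snd, Pi.smul_apply, smul_eq_mul, RingHom.id_apply]
          rw [mul_sub, Finset.mul_sum]
          congr 1
          exact Finset.sum_congr rfl fun i _ => by ring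
        · simp only [Prod.smul_fst, Prod.smul_snd, Pi.smul_apply, smul_eq_mul, RingHom.id_apply]
          ring }
  have hWY : HasGaussianLaw (fun ω => ((fun _ : Unit => W ω), fun i => Y i ω)) P :=
    hG12.map_fun (LinearMap.toContinuousLinearMap L)
  have hgL := fun p => hg.memLp p
  have heL : ∀ i, MemLp (e i) 2 P := fun i => (hlaw i).hasGaussianLaw.memLp_two
  have hYL : ∀ i, MemLp (Y i) 2 P := fun i => (hgL _).add (heL i)
  have hgecov : ∀ p i, cov[g p, e i; P] = 0 := fun p i =>
    IndepFun.covariance_eq_zero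
      (hge.comp (measurable_pi_apply p) (measurable_pi_apply i)) (hgL p) (heL i)
  have heecov : ∀ i j, cov[e i, e j; P] = if i = j then σ ^ 2 else 0 := fun i j => by
    split_ifs with h
    · subst h
      rw [covariance_self (heL i).1.aemeasurable, (hlaw i).variance_eq, variance_id_gaussianReal]
      exact Real.coe_toNNReal _ (sq_nonneg σ)
    · exact (hind.indepFun h).covariance_eq_zero (heL i) (heL j)
  have hgY : ∀ p j, cov[g p, Y j; P] = k p (x j) := fun p j => by
    have : cov[g p, g (x j) + e j; P] = _ := covariance_add_right (hgL p) (hgL (x j)) (heL j)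
    rw [hgecov, hg.covariance _ (Set.mem_univ _) _ (Set.mem_univ _), add_zero] at this
    exact this
  have heY : ∀ i j, cov[e i, Y j; P] = if i = j then σ ^ 2 else 0 := fun i j => by
    have : cov[e i, g (x j) + e j; P] = _ := covariance_add_right (heL i) (hgL (x j)) (heL j)
    rw [covariance_comm (X := e i) (Y := g (x j)), hgecov, heecov, zero_add] at this
    exact this
  have hYY : ∀ i j, cov[Y i, Y j; P] = regMatrix k σ x i j := fun i j => by
    have : cov[g (x i) + e i, Y j; P] = _ := covariance_add_left (hgL (x i)) (heL i) (hYL j)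
    rw [hgY, heY] at this
    simpa [regMatrix_eq, kernelMatrix, Matrix.one_apply] using! this
  have hsumL : MemLp (fun ω => ∑ i, w i * Y i ω) 2 P :=
    memLp_finsetSum _ fun i _ => (hYL i).const_mul _
  have hWZ : ∀ {Z : Ω → ℝ}, MemLp Z 2 P →
      cov[W, Z; P] = cov[g q, Z; P] - ∑ i, w i * cov[Y i, Z; P] := fun {Z} hZ => by
    rw [covariance_fun_sub_left (hgL q) hsumL hZ,
      covariance_fun_sum_left (fun i => (hYL i).const_mul _) hZ]
    simp only [covariance_const_mul_left]
  -- These are the normal equations defining the posterior weights. Joint Gaussianity upgrades zero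
  -- covariance to independence; moreover Var W = cov(W, g q), which is the posterior variance.
  have hWYcov : ∀ j, cov[W, Y j; P] = 0 := fun j => by
    rw [hWZ (hYL j), hgY]
    simp only [hYY]
    have h := congrFun (hk.regMatrix_mulVec_postWeights hσ x q) j
    simp only [mulVec, dotProduct] at h
    rw [hk.symm, ← h, sub_eq_zero]
    refine Finset.sum_congr rfl fun i _ => ?_
    have h2 : regMatrix k σ x j i = regMatrix k σ x i j :=
      congrFun (congrFun (hk.regMatrix_transpose σ x) i) j
    rw [h2, mul_comm]
  have hWL : MemLp W 2 P := (hgL q).sub hsumL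
  refine ⟨?_, ?_⟩
  · have := hWY.indepFun_of_covariance_eval (X := fun _ : Unit => W) (Y := Y) fun _ j => hWYcov j
    exact this.comp (measurable_pi_apply ()) measurable_id
  · have hW : HasGaussianLaw W P := hWY.fst.eval ()
    rw [hW.map_eq_gaussianReal]
    congr 1
    · have hYi : ∀ i, Integrable (Y i) P := fun i => (hYL i).integrable one_le_two
      rw [integral_sub ((hgL q).integrable one_le_two) (hsumL.integrable one_le_two),
        integral_finsetSum _ fun i _ => (hYi i).const_mul _, hg.mean q (Set.mem_univ q)]
      congr 1
      refine Finset.sum_congr rfl fun i _ => ?_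
      rw [integral_const_mul, integral_add ((hgL _).integrable one_le_two)
        ((heL i).integrable one_le_two), hg.mean _ (Set.mem_univ _), (hlaw i).integral_eq,
        integral_id_gaussianReal, add_zero]
    · congr 1
      rw [← covariance_self hWL.1.aemeasurable, hWZ hWL]
      have : ∀ i, cov[Y i, W; P] = 0 := fun i => by rw [covariance_comm, hWYcov]
      simp only [this, mul_zero, Finset.sum_const_zero, sub_zero]
      rw [covariance_comm, hWZ (hgL q), hg.covariance _ (Set.mem_univ _) _ (Set.mem_univ _),
        postCov_eq]
      congr 1
      refine Finset.sum_congr rfl fun i _ => ?_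
      rw [covariance_comm, hgY, hk.symm]

lemma observations_const {Θ E : Type*} [Add E] (m : Θ → ℝ → E) (p : ℕ → ℝ) (θ : Θ) (e : ℕ → E)
    (n : ℕ) :
    observations m (fun j _ => p j) θ e n = fun i : Fin n => m θ (p i) + e (i + 1) := by
  induction n with
  | zero => exact Subsingleton.elim _ _
  | succ n ih =>
    funext i
    refine Fin.lastCases ?_ (fun j => ?_) i
    · simp [observations]
    · simp [observations, ih]

lemma continuous_gaussianPDFReal (m : ℝ) (v : NNReal) : Continuous (gaussianPDFReal m v) := by
  unfold gaussianPDFReal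
  fun_prop

lemma gaussianPDFReal_le (m : ℝ) (v : NNReal) (x : ℝ) :
    gaussianPDFReal m v x ≤ (Real.sqrt (2 * Real.pi * v))⁻¹ := by
  unfold gaussianPDFReal
  refine mul_le_of_le_one_right (by positivity) (Real.exp_le_one_iff.2 ?_)
  rw [neg_div]
  exact neg_nonpos.2 (by positivity)

-- Dominated convergence: the Gaussian density is bounded, so a constant multiple of `h` dominates.
-- This continuity passes from almost every `y` to every `y`.
omit [IsProbabilityMeasure P] in
lemma continuous_lintegral_mul_gaussianPDF {n : ℕ} (v : NNReal) {h : Ω → ℝ}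
    (hint : Integrable h P) (h0 : 0 ≤ h) {f : Fin n → Ω → ℝ} (hf : ∀ i, AEMeasurable (f i) P)
    {c : (Fin n → ℝ) → ℝ} (hc : Continuous c) (hc0 : ∀ y, 0 ≤ c y) :
    Continuous fun y : Fin n → ℝ =>
      ∫⁻ ω, ENNReal.ofReal (c y * h ω) * ∏ i, gaussianPDF 0 v (y i - f i ω) ∂P := by
  set C := (Real.sqrt (2 * Real.pi * v))⁻¹
  have hm : ∀ y : Fin n → ℝ, AEStronglyMeasurable
      (fun ω => h ω * ∏ i, gaussianPDFReal 0 v (y i - f i ω)) P := fun y => by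
    refine hint.1.mul (AEMeasurable.aestronglyMeasurable ?_)
    refine Finset.aemeasurable_fun_prod _ fun i _ => ?_
    exact (measurable_gaussianPDFReal 0 v).comp_aemeasurable ((hf i).const_sub _)
  have hb : ∀ (y : Fin n → ℝ) ω, ‖h ω * ∏ i, gaussianPDFReal 0 v (y i - f i ω)‖ ≤ h ω * C ^ n :=
    fun y ω => by
      have hp : 0 ≤ ∏ i, gaussianPDFReal 0 v (y i - f i ω) :=
        Finset.prod_nonneg fun i _ => gaussianPDFReal_nonneg _ _ _
      rw [Real.norm_of_nonneg (mul_nonneg (h0 ω) hp)]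
      refine mul_le_mul_of_nonneg_left ?_ (h0 ω)
      exact (Finset.prod_le_prod (fun i _ => gaussianPDFReal_nonneg _ _ _)
        fun i _ => gaussianPDFReal_le 0 v _).trans_eq (by simp [C])
  have hcont : Continuous fun y : Fin n → ℝ =>
      ∫ ω, h ω * ∏ i, gaussianPDFReal 0 v (y i - f i ω) ∂P := by
    refine continuous_of_dominated hm (bound := fun ω => h ω * C ^ n)
      (fun y => Filter.Eventually.of_forall (hb y)) (hint.mul_const _)
      (Filter.Eventually.of_forall fun ω => ?_)
    refine continuous_const.mul (continuous_finsetProd _ fun i _ => ?_)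
    exact (continuous_gaussianPDFReal 0 v).comp (by fun_prop)
  have heq : ∀ y : Fin n → ℝ,
      ∫⁻ ω, ENNReal.ofReal (c y * h ω) * ∏ i, gaussianPDF 0 v (y i - f i ω) ∂P
        = ENNReal.ofReal (c y * ∫ ω, h ω * ∏ i, gaussianPDFReal 0 v (y i - f i ω) ∂P) := fun y => by
    have hi : Integrable (fun ω => h ω * ∏ i, gaussianPDFReal 0 v (y i - f i ω)) P :=
      Integrable.mono' (hint.mul_const (C ^ n)) (hm y) (Filter.Eventually.of_forall (hb y))
    rw [ENNReal.ofReal_mul (hc0 y), ofReal_integral_eq_lintegral_ofReal hi,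
      ← lintegral_const_mul' _ _ ENNReal.ofReal_ne_top]
    · refine lintegral_congr fun ω => ?_
      rw [ENNReal.ofReal_mul (hc0 y), ENNReal.ofReal_mul (h0 ω), mul_assoc,
        ENNReal.ofReal_prod_of_nonneg fun i _ => gaussianPDFReal_nonneg _ _ _]
      rfl
    · exact Filter.Eventually.of_forall fun ω => mul_nonneg (h0 ω) <|
        Finset.prod_nonneg fun i _ => gaussianPDFReal_nonneg _ _ _
  simp_rw [heq]
  exact ENNReal.continuous_ofReal.comp (hc.mul hcont)

lemma lintegral_exp_gaussianReal (m : ℝ) (v : NNReal) (s : ℝ) :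
    ∫⁻ w, ENNReal.ofReal (Real.exp (s * (w - m))) ∂(gaussianReal m v)
      = ENNReal.ofReal (Real.exp (s ^ 2 * v / 2)) := by
  have h : ∀ w : ℝ, Real.exp (s * (w - m)) = Real.exp (-s * m) * Real.exp (s * w) := fun w => by
    rw [← Real.exp_add]; ring_nf
  have hi := integrable_exp_mul_gaussianReal (μ := m) (v := v) s
  simp_rw [h]
  rw [← ofReal_integral_eq_lintegral_ofReal (hi.const_mul _)
    (Filter.Eventually.of_forall fun w => by positivity), integral_const_mul]
  have h2 : ∫ w, Real.exp (s * w) ∂(gaussianReal m v) = Real.exp (m * s + v * s ^ 2 / 2) :=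
    congrFun (mgf_id_gaussianReal (μ := m) (v := v)) s
  rw [h2, ← Real.exp_add]
  ring_nf

/-- Tilting by the likelihood of observations at fixed points turns the prior of `g q` into its
posterior. -/
theorem lintegral_exp_mul_prod_gaussianPDF {U : Type*} [MeasurableSpace U] {a : U → ℝ → ℝ}
    (ha : Measurable (Function.uncurry a)) {X : Ω → U} (hX : Measurable X)
    (hg : IsGPSample P Set.univ μ k (fun p ω => a (X ω) p)) {σ : ℝ} (hσ : 0 < σ)
    {ε : ℕ → Ω → ℝ} (hεm : ∀ t, Measurable (ε t))
    (hlaw : ∀ t, HasLaw (ε t) (gaussianReal 0 (σ ^ 2).toNNReal) P) (hind : iIndepFun ε P)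
    (hXε : IndepFun X (fun ω t => ε t ω) P) {n : ℕ} (x : Fin n → ℝ) (q s : ℝ) (y : Fin n → ℝ) :
    ∫⁻ ω, ENNReal.ofReal (Real.exp (s * (a (X ω) q - postMean μ k σ x y q))) *
        ∏ i, gaussianPDF 0 (σ ^ 2).toNNReal (y i - a (X ω) (x i)) ∂P
      = ENNReal.ofReal (Real.exp (s ^ 2 * postCov k σ x q q / 2)) *
        ∫⁻ ω, ∏ i, gaussianPDF 0 (σ ^ 2).toNNReal (y i - a (X ω) (x i)) ∂P := by
  set v := (σ ^ 2).toNNReal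
  have hv : v ≠ 0 := (Real.toNNReal_pos.2 (by positivity)).ne'
  have hk := hg.isPSDKernel
  have haX : ∀ p, Measurable fun ω => a (X ω) p := fun p =>
    ha.comp (hX.prodMk measurable_const)
  have hpm : Continuous fun y : Fin n → ℝ => postMean μ k σ x y q := by
    simp only [hk.postMean_eq, dotProduct]
    fun_prop
  set p : ℕ → ℝ := fun i => if h : i < n then x ⟨i, h⟩ else 0
  have hp : ∀ i : Fin n, p i = x i := fun i => by simp [p]
  obtain ⟨𝓖, h𝓖, h𝓖le, hθ, hε, hindep⟩ := exists_noise_filtration hX hεm hXε fun m => by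
    have := hind.indepFun_finset (Finset.Iic m) {m + 1} (by simp) hεm
    exact this.comp measurable_id
      (measurable_pi_apply (⟨m + 1, Finset.mem_singleton_self _⟩ : ({m + 1} : Finset ℕ)))
  have hobs : ∀ ω, observations a (fun j _ => p j) (X ω) (fun t => ε t ω) n
      = fun i => a (X ω) (x i) + ε (i + 1) ω := fun ω => by
    rw [observations_const]
    simp only [hp]
  have hlik : ∀ ω y, likelihood (gaussianPDF 0 v) a (fun j _ => p j) n (X ω) y
      = ∏ i, gaussianPDF 0 v (y i - a (X ω) (x i)) := fun ω y => by
    simp only [likelihood, chosenPoints, hp]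
  have key : ∀ {Ψ : U → (Fin n → ℝ) → ℝ≥0∞}, Measurable (Function.uncurry Ψ) →
      ∫⁻ ω, Ψ (X ω) (fun i => a (X ω) (x i) + ε (i + 1) ω) ∂P
        = ∫⁻ y, ∫⁻ ω, Ψ (X ω) y * ∏ i, gaussianPDF 0 v (y i - a (X ω) (x i)) ∂P := fun {Ψ} hΨ => by
    have := lintegral_observations (measurable_gaussianPDF 0 v) ha (x := fun j _ => p j)
      (fun _ => measurable_const) h𝓖 h𝓖le hθ hε
      (fun t => by rw [(hlaw t).map_eq, gaussianReal_of_var_ne_zero _ hv]) hindep n hΨ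
    simpa only [hobs, hlik] using this
  set Y : Ω → Fin n → ℝ := fun ω i => a (X ω) (x i) + ε (i + 1) ω
  have hY : Measurable Y := measurable_pi_lambda _ fun i => (haX _).add (hεm _)
  obtain ⟨hWind, hWlaw⟩ := hg.residual_law hσ (e := fun (i : Fin n) => ε (i + 1))
    (fun i => hlaw _) (hind.precomp (g := fun i : Fin n => (i : ℕ) + 1)
      fun i j h => Fin.ext (Nat.succ_injective h))
    (hXε.comp (φ := fun u p => a u p) (ψ := fun (e : ℕ → ℝ) (i : Fin n) => e (i + 1))
      (measurable_pi_lambda _ fun p => ha.comp (measurable_id.prodMk measurable_const))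
      (by fun_prop)) x q
  set w := postWeights k σ x q
  set W : Ω → ℝ := fun ω => a (X ω) q - ∑ i, w i * (a (X ω) (x i) + ε (i + 1) ω)
  set mW : ℝ := μ q - ∑ i, w i * μ (x i)
  have hWm : Measurable W :=
    (haX q).sub (Finset.measurable_fun_sum _ fun i _ => ((haX _).add (hεm _)).const_mul _)
  have hres : ∀ ω, a (X ω) q - postMean μ k σ x (Y ω) q = W ω - mW := fun ω => by
    simp only [hk.postMean_eq, dotProduct, W, mW, Y, w, mul_sub, Finset.sum_sub_distrib]
    ring
  have hEm : Measurable fun z : U × (Fin n → ℝ) =>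
      ENNReal.ofReal (Real.exp (s * (a z.1 q - postMean μ k σ x z.2 q))) := by
    have h1 : Measurable fun z : U × (Fin n → ℝ) => a z.1 q :=
      ha.comp (measurable_fst.prodMk measurable_const)
    have h2 : Measurable fun z : U × (Fin n → ℝ) => postMean μ k σ x z.2 q :=
      hpm.measurable.comp measurable_snd
    fun_prop
  have hlm : Measurable fun z : (Fin n → ℝ) × Ω =>
      ∏ i, gaussianPDF 0 v (z.1 i - a (X z.2) (x i)) := by
    refine Finset.measurable_fun_prod _ fun i _ => (measurable_gaussianPDF 0 v).comp ?_
    exact ((measurable_pi_apply i).comp measurable_fst).sub ((haX _).comp measurable_snd)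
  have hEmω : Measurable fun z : (Fin n → ℝ) × Ω =>
      ENNReal.ofReal (Real.exp (s * (a (X z.2) q - postMean μ k σ x z.1 q))) :=
    hEm.comp (f := fun z : (Fin n → ℝ) × Ω => (X z.2, z.1)) (by fun_prop)
  have hcov0 : 0 ≤ postCov k σ x q q := hk.postCov_nonneg hσ x q
  set D := ENNReal.ofReal (Real.exp (s ^ 2 * postCov k σ x q q / 2))
  -- Both sides of the claim are tested against functions of the observations. Under the law of the
  -- model, the prediction error is the centred residual, which is Gaussian and independent of the
  -- observations, so its exponential moment factors out.
  have hψ : ∀ {ψ : (Fin n → ℝ) → ℝ≥0∞}, Measurable ψ →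
      ∫⁻ y, ψ y * ∫⁻ ω, ENNReal.ofReal (Real.exp (s * (a (X ω) q - postMean μ k σ x y q))) *
        ∏ i, gaussianPDF 0 v (y i - a (X ω) (x i)) ∂P
      = ∫⁻ y, ψ y * (D * ∫⁻ ω, ∏ i, gaussianPDF 0 v (y i - a (X ω) (x i)) ∂P) := fun {ψ} hψ => by
    have h1 := key (Ψ := fun u y =>
      ENNReal.ofReal (Real.exp (s * (a u q - postMean μ k σ x y q))) * ψ y)
      (hEm.mul (hψ.comp measurable_snd))
    have h2 := key (Ψ := fun u y => ψ y) (hψ.comp measurable_snd)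
    have h3 : ∫⁻ ω, ENNReal.ofReal (Real.exp (s * (a (X ω) q - postMean μ k σ x (Y ω) q))) *
        ψ (Y ω) ∂P = D * ∫⁻ ω, ψ (Y ω) ∂P := by
      simp only [hres]
      have h5 : Measurable fun ω => ENNReal.ofReal (Real.exp (s * (W ω - mW))) := by fun_prop
      have h6 : Measurable fun ω => ψ (Y ω) := hψ.comp hY
      rw [lintegral_mul_eq_lintegral_mul_lintegral_of_indepFun'' h5.aemeasurable h6.aemeasurable]
      · congr 1
        have h4 : Measurable fun w : ℝ => ENNReal.ofReal (Real.exp (s * (w - mW))) := by fun_prop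
        rw [← lintegral_map (f := fun w : ℝ => ENNReal.ofReal (Real.exp (s * (w - mW)))) h4 hWm,
          hWlaw, lintegral_exp_gaussianReal, Real.coe_toNNReal _ hcov0]
      · exact hWind.comp (φ := fun w : ℝ => ENNReal.ofReal (Real.exp (s * (w - mW))))
          (by fun_prop) hψ
    calc _ = ∫⁻ y, ∫⁻ ω, ENNReal.ofReal (Real.exp (s * (a (X ω) q - postMean μ k σ x y q))) *
          ψ y * ∏ i, gaussianPDF 0 v (y i - a (X ω) (x i)) ∂P := by
          refine lintegral_congr fun y => ?_
          have hm : Measurable fun ω =>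
              ENNReal.ofReal (Real.exp (s * (a (X ω) q - postMean μ k σ x y q))) *
                ∏ i, gaussianPDF 0 v (y i - a (X ω) (x i)) :=
            (hEmω.mul hlm).comp (f := fun ω : Ω => (y, ω)) (by fun_prop)
          rw [← lintegral_const_mul _ hm]
          refine lintegral_congr fun ω => ?_
          ring
      _ = D * ∫⁻ ω, ψ (Y ω) ∂P := by rw [← h1, ← h3]
      _ = _ := by
          rw [h2, ← lintegral_const_mul]
          · refine lintegral_congr fun y => ?_
            rw [lintegral_const_mul]
            · ring
            · exact hlm.comp (f := fun ω : Ω => (y, ω)) (by fun_prop)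
          · exact Measurable.lintegral_prod_right' (f := fun z : (Fin n → ℝ) × Ω =>
              ψ z.1 * ∏ i, gaussianPDF 0 v (z.1 i - a (X z.2) (x i)))
              ((hψ.comp measurable_fst).mul hlm)
  have hcont1 : Continuous fun y : Fin n → ℝ =>
      ∫⁻ ω, ENNReal.ofReal (Real.exp (s * (a (X ω) q - postMean μ k σ x y q))) *
        ∏ i, gaussianPDF 0 v (y i - a (X ω) (x i)) ∂P := by
    have hint : Integrable (fun ω => Real.exp (s * a (X ω) q)) P := by
      have hG := hg.gaussian.hasGaussianLaw_eval ⟨q, Set.mem_univ q⟩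
      have h5 := integrable_exp_mul_gaussianReal (μ := P[fun ω => a (X ω) q])
        (v := Var[fun ω => a (X ω) q; P].toNNReal) s
      rw [← hG.map_eq_gaussianReal] at h5
      exact (integrable_map_measure (by fun_prop) (haX q).aemeasurable).1 h5
    have := continuous_lintegral_mul_gaussianPDF (P := P) v hint (fun ω => by positivity)
      (f := fun i ω => a (X ω) (x i)) (fun i => (haX _).aemeasurable)
      (c := fun y => Real.exp (-s * postMean μ k σ x y q)) (by fun_prop) (fun y => by positivity)
    convert this using 6 with y ω
    rw [← Real.exp_add]
    ring_nf
  have hcont2 : Continuous fun y : Fin n → ℝ =>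
      D * ∫⁻ ω, ∏ i, gaussianPDF 0 v (y i - a (X ω) (x i)) ∂P := by
    have := continuous_lintegral_mul_gaussianPDF (P := P) v (integrable_const (1 : ℝ))
      (fun ω => zero_le_one) (f := fun i ω => a (X ω) (x i)) (fun i => (haX _).aemeasurable)
      (c := fun _ => 1) continuous_const (fun y => zero_le_one)
    simp only [mul_one, ENNReal.ofReal_one, one_mul] at this
    exact (ENNReal.continuous_const_mul ENNReal.ofReal_ne_top).comp this
  -- Indicator test functions give equality for almost every `y`, and continuity of both sides gives
  -- it for every `y`. The pointwise form is essential because `x` and `q` will later be functions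
  -- of `y`.
  have hae := ae_eq_of_forall_setLIntegral_eq_of_sigmaFinite (μ := (volume : Measure (Fin n → ℝ)))
    hcont1.measurable hcont2.measurable fun A hA _ => by
      have := hψ (ψ := A.indicator 1) (measurable_one.indicator hA)
      rw [← lintegral_indicator hA, ← lintegral_indicator hA]
      convert this using 3 with y y
      · by_cases hy : y ∈ A <;> simp [hy]
      · by_cases hy : y ∈ A <;> simp [hy]
  exact congrFun ((hcont1.ae_eq_iff_eq _ hcont2).1 hae) y

end FixedDesign

end GPPricing

namespace GPPricing

open scoped ENNReal
open Matrix Filter Topology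

/-! ### Confidence bounds -/

section Tail

variable {Ω : Type*} {mΩ : MeasurableSpace Ω} {P : Measure Ω}

/-- The positive part of `W` is at most exp(s W)/s for each s > 0; let s tend to infinity. This is
the zero-variance case, where the Chernoff exponent c/√v is not available. -/
lemma lintegral_excess_eq_zero {W : Ω → ℝ} {L : Ω → ℝ≥0∞}
    (hfin : ∫⁻ ω, L ω ∂P ≠ ∞)
    (hmgf : ∀ s : ℝ, ∫⁻ ω, ENNReal.ofReal (Real.exp (s * W ω)) * L ω ∂P = ∫⁻ ω, L ω ∂P) :
    ∫⁻ ω, ENNReal.ofReal (W ω) * L ω ∂P = 0 := by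
  have hj : ∀ j : ℕ, ∫⁻ ω, ENNReal.ofReal (W ω) * L ω ∂P
      ≤ ENNReal.ofReal (1 / ((j : ℝ) + 1)) * ∫⁻ ω, L ω ∂P := fun j => by
    have hs : (0 : ℝ) < (j : ℝ) + 1 := by positivity
    rw [← hmgf ((j : ℝ) + 1), ← lintegral_const_mul' _ _ ENNReal.ofReal_ne_top]
    refine lintegral_mono fun ω => ?_
    rw [← mul_assoc, ← ENNReal.ofReal_mul (by positivity)]
    gcongr
    rw [one_div, inv_mul_eq_div, le_div_iff₀ hs]
    linarith [Real.add_one_le_exp (((j : ℝ) + 1) * W ω)]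
  have hlim : Tendsto (fun j : ℕ => ENNReal.ofReal (1 / ((j : ℝ) + 1)) * ∫⁻ ω, L ω ∂P) atTop
      (𝓝 (0 * ∫⁻ ω, L ω ∂P)) := by
    refine ENNReal.Tendsto.mul_const ?_ (Or.inr hfin)
    have := ENNReal.tendsto_ofReal tendsto_one_div_add_atTop_nhds_zero_nat
    rwa [ENNReal.ofReal_zero] at this
  rw [zero_mul] at hlim
  exact le_antisymm (ge_of_tendsto' hlim hj) zero_le

/-- Chernoff bounds for a centred Gaussian variable of variance `v` under the weight `L`. -/
lemma chernoff_bounds {W : Ω → ℝ} (hW : Measurable W) {L : Ω → ℝ≥0∞} (hL : Measurable L)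
    (hfin : ∫⁻ ω, L ω ∂P ≠ ∞) {v : ℝ} (hv : 0 ≤ v)
    (hmgf : ∀ s : ℝ, ∫⁻ ω, ENNReal.ofReal (Real.exp (s * W ω)) * L ω ∂P
      = ENNReal.ofReal (Real.exp (s ^ 2 * v / 2)) * ∫⁻ ω, L ω ∂P) {c : ℝ} (hc : 0 < c) :
    ∫⁻ ω, {ω | c * Real.sqrt v < W ω}.indicator 1 ω * L ω ∂P
        ≤ ENNReal.ofReal (Real.exp (-c ^ 2 / 2)) * ∫⁻ ω, L ω ∂P ∧
      ∫⁻ ω, ENNReal.ofReal (W ω - c * Real.sqrt v) * L ω ∂P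
        ≤ ENNReal.ofReal (Real.sqrt v * Real.exp (-c ^ 2 / 2) / c) * ∫⁻ ω, L ω ∂P := by
  rcases hv.eq_or_lt with rfl | hv
  · simp only [mul_zero, zero_div, Real.exp_zero, ENNReal.ofReal_one, one_mul] at hmgf
    have h0 := lintegral_excess_eq_zero hfin hmgf
    simp only [Real.sqrt_zero, mul_zero, sub_zero, h0, zero_le, and_true]
    refine le_of_eq_of_le ?_ zero_le
    rw [lintegral_eq_zero_iff (by fun_prop)] at h0
    have hm : Measurable fun ω => {ω | 0 < W ω}.indicator 1 ω * L ω :=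
      (measurable_one.indicator (measurableSet_lt measurable_const hW)).mul hL
    rw [lintegral_eq_zero_iff hm]
    filter_upwards [h0] with ω hω
    by_cases h : 0 < W ω
    · have : ENNReal.ofReal (W ω) ≠ 0 := (ENNReal.ofReal_pos.2 h).ne'
      have hω' : ENNReal.ofReal (W ω) * L ω = 0 := hω
      have hL0 : L ω = 0 := by simpa [this, h.not_ge] using hω'
      simp [hL0]
    · simp [h]
  · set r := Real.sqrt v
    have hr : 0 < r := Real.sqrt_pos.2 hv
    have hr2 : r ^ 2 = v := Real.sq_sqrt hv.le
    -- The minimiser of s²v/2 - s c r; it makes the exponent equal to -c²/2.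
    set s := c / r
    have hs : 0 < s := by positivity
    have hsr : s * r = c := by simp only [s]; field_simp
    have hsv : s ^ 2 * v = c ^ 2 := by rw [← hr2, ← hsr]; ring
    have hbound : ∀ d : ℝ, 0 ≤ d → ∫⁻ ω, ENNReal.ofReal (d * Real.exp (s * (W ω - c * r))) * L ω ∂P
        = ENNReal.ofReal (d * Real.exp (-c ^ 2 / 2)) * ∫⁻ ω, L ω ∂P := fun d hd => by
      have h1 : ∀ ω, ENNReal.ofReal (d * Real.exp (s * (W ω - c * r))) * L ω
          = ENNReal.ofReal (d * Real.exp (-c ^ 2)) *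
            (ENNReal.ofReal (Real.exp (s * W ω)) * L ω) := fun ω => by
        rw [← mul_assoc, ← ENNReal.ofReal_mul (by positivity), mul_assoc d, ← Real.exp_add]
        have : s * (W ω - c * r) = -c ^ 2 + s * W ω := by linear_combination (-c) * hsr
        rw [this]
      simp_rw [h1]
      rw [lintegral_const_mul' _ _ ENNReal.ofReal_ne_top, hmgf, ← mul_assoc,
        ← ENNReal.ofReal_mul (by positivity), mul_assoc d, ← Real.exp_add, hsv]
      ring_nf
    constructor
    · have h := hbound 1 zero_le_one
      simp only [one_mul] at h
      rw [← h]
      refine lintegral_mono fun ω => ?_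
      gcongr
      by_cases hω : c * r < W ω
      · simp only [Set.mem_ofPred_eq, hω, Set.indicator_of_mem, Pi.one_apply,
          ENNReal.one_le_ofReal, Real.one_le_exp_iff]
        exact mul_nonneg hs.le (by linarith)
      · simp [hω]
    · have h := hbound (r / c) (by positivity)
      rw [div_mul_eq_mul_div] at h
      rw [← h]
      refine lintegral_mono fun ω => ?_
      gcongr
      -- With u = W - c r, the inequality s u ≤ exp(s u) and 1/s = r/c bound the excess u by the
      -- exponential already integrated.
      have h2 := Real.add_one_le_exp (s * (W ω - c * r))
      have h3 : r / c * s = 1 := by simp only [s]; field_simp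
      have h4 : r / c * (s * (W ω - c * r)) = W ω - c * r := by rw [← mul_assoc, h3, one_mul]
      have h5 : 0 < r / c := by positivity
      nlinarith

end Tail

/-! ### Joint continuity of posterior quantities in the design, the data and the price. -/

section Continuity

variable {μ : ℝ → ℝ} {k : ℝ → ℝ → ℝ} {σ : ℝ}

lemma IsPSDKernel.continuous_postWeights (hk : IsPSDKernel k) (hσ : 0 < σ)
    (hkc : Continuous (Function.uncurry k)) (n : ℕ) :
    Continuous fun z : (Fin n → ℝ) × ℝ => postWeights k σ z.1 z.2 := by
  have hA : Continuous fun x : Fin n → ℝ => regMatrix k σ x := by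
    refine continuous_matrix fun i j => ?_
    have h : Continuous fun x : Fin n → ℝ => Function.uncurry k (x i, x j) := by fun_prop
    exact h.add continuous_const
  have hinv : Continuous fun x : Fin n → ℝ => (regMatrix k σ x)⁻¹ := by
    simp only [Matrix.inv_def, Ring.inverse_eq_inv']
    exact (hA.matrix_det.inv₀ fun x => (hk.det_pos hσ x).ne').smul hA.matrix_adjugate
  refine (hinv.comp continuous_fst).matrix_mulVec (continuous_pi fun i => ?_)
  change Continuous fun z : (Fin n → ℝ) × ℝ => Function.uncurry k (z.1 i, z.2)
  fun_prop

lemma IsPSDKernel.continuous_postCov (hk : IsPSDKernel k) (hσ : 0 < σ)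
    (hkc : Continuous (Function.uncurry k)) (n : ℕ) :
    Continuous fun z : (Fin n → ℝ) × ℝ => postCov k σ z.1 z.2 z.2 := by
  simp only [postCov_eq]
  have h1 : Continuous fun z : (Fin n → ℝ) × ℝ => Function.uncurry k (z.2, z.2) := by fun_prop
  refine h1.sub ((hk.continuous_postWeights hσ hkc n).dotProduct (continuous_pi fun i => ?_))
  change Continuous fun z : (Fin n → ℝ) × ℝ => Function.uncurry k (z.1 i, z.2)
  fun_prop

lemma IsPSDKernel.continuous_postMean (hk : IsPSDKernel k) (hσ : 0 < σ)
    (hkc : Continuous (Function.uncurry k)) (hμ : Continuous μ) (n : ℕ) :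
    Continuous fun z : (Fin n → ℝ) × (Fin n → ℝ) × ℝ => postMean μ k σ z.1 z.2.1 z.2.2 := by
  simp only [hk.postMean_eq]
  refine (by fun_prop : Continuous fun z : (Fin n → ℝ) × (Fin n → ℝ) × ℝ => μ z.2.2).add ?_
  refine ((hk.continuous_postWeights hσ hkc n).comp
    (by fun_prop : Continuous fun z : (Fin n → ℝ) × (Fin n → ℝ) × ℝ => (z.1, z.2.2))).dotProduct ?_
  fun_prop

end Continuity

/-! ### From pointwise posterior bounds to bounds under adaptive sampling. -/

section PredictionError

variable {Θ E Ω : Type*} [MeasurableSpace Θ] [AddCommGroup E] [MeasureSpace E] [MeasurableAdd₂ E]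
  [MeasurableSub₂ E] {mΩ : MeasurableSpace Ω} {P : Measure Ω} [IsProbabilityMeasure P]
  [SigmaFinite (volume : Measure E)] [(volume : Measure E).IsAddRightInvariant]

/-- Confidence bounds for a quantity that is centred Gaussian with variance `v` a posteriori. -/
theorem posterior_chernoff_bounds {ρ : E → ℝ≥0∞} (hρ : Measurable ρ) {m : Θ → ℝ → E}
    (hm : Measurable (Function.uncurry m)) {x : (n : ℕ) → (Fin n → E) → ℝ}
    (hx : ∀ n, Measurable (x n)) {𝓖 : ℕ → MeasurableSpace Ω} (h𝓖 : Monotone 𝓖)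
    (h𝓖le : ∀ n, 𝓖 n ≤ mΩ) {θ : Ω → Θ} (hθ : Measurable[𝓖 0] θ) {ε : ℕ → Ω → E}
    (hε : ∀ n, Measurable[𝓖 n] (ε n))
    (hlaw : ∀ n, P.map (ε n) = volume.withDensity ρ)
    (hindep : ∀ n, Indep (𝓖 n) (MeasurableSpace.comap (ε (n + 1)) inferInstance) P)
    (n : ℕ) {W : Θ → (Fin n → E) → ℝ} (hW : Measurable (Function.uncurry W))
    {v : (Fin n → E) → ℝ} (hv : Measurable v) (hv0 : ∀ y, 0 ≤ v y) {B : ℝ} (hvB : ∀ y, v y ≤ B)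
    (hfin : ∀ y, ∫⁻ ω, likelihood ρ m x n (θ ω) y ∂P ≠ ∞)
    (hmgf : ∀ y (s : ℝ),
      ∫⁻ ω, ENNReal.ofReal (Real.exp (s * W (θ ω) y)) * likelihood ρ m x n (θ ω) y ∂P
        = ENNReal.ofReal (Real.exp (s ^ 2 * v y / 2)) * ∫⁻ ω, likelihood ρ m x n (θ ω) y ∂P)
    {c : ℝ} (hc : 0 < c) :
    P {ω | c * Real.sqrt (v (observations m x (θ ω) (fun t => ε t ω) n)) <
        W (θ ω) (observations m x (θ ω) (fun t => ε t ω) n)}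
        ≤ ENNReal.ofReal (Real.exp (-c ^ 2 / 2)) ∧
      ∫⁻ ω, ENNReal.ofReal (W (θ ω) (observations m x (θ ω) (fun t => ε t ω) n)
        - c * Real.sqrt (v (observations m x (θ ω) (fun t => ε t ω) n))) ∂P
        ≤ ENNReal.ofReal (Real.sqrt B * Real.exp (-c ^ 2 / 2) / c) := by
  have hθm : Measurable θ := hθ.mono (h𝓖le 0) le_rfl
  have hobs : Measurable fun ω => observations m x (θ ω) (fun t => ε t ω) n :=
    (measurable_observations hm hx h𝓖 hθ hε n).mono (h𝓖le n) le_rfl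
  have hlik : ∀ y, Measurable fun ω => likelihood ρ m x n (θ ω) y := fun y =>
    (measurable_likelihood hρ hm hx n).comp (hθm.prodMk measurable_const)
  have hWy : ∀ y, Measurable fun ω => W (θ ω) y := fun y =>
    hW.comp (hθm.prodMk measurable_const)
  have hbd := fun y => chernoff_bounds (hWy y) (hlik y) (hfin y) (hv0 y) (hmgf y) hc
  have hden {Ψ : Θ → (Fin n → E) → ℝ≥0∞} (hΨ : Measurable (Function.uncurry Ψ)) :=
    lintegral_observations hρ hm hx h𝓖 h𝓖le hθ hε hlaw hindep n hΨ
  -- The marginal density of the observations has total mass one, so bounds that are uniform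
  -- relative to it for each `y` integrate to the same bounds.
  have hone : ∫⁻ y, ∫⁻ ω, likelihood ρ m x n (θ ω) y ∂P = 1 := by
    have := hden (Ψ := fun _ _ => 1) measurable_const
    simpa using this.symm
  have hgap : Measurable fun z : Θ × (Fin n → E) => c * Real.sqrt (v z.2) :=
    ((hv.comp measurable_snd).sqrt).const_mul c
  constructor
  · set S : Set (Θ × (Fin n → E)) := {z | c * Real.sqrt (v z.2) < W z.1 z.2}
    have hS : MeasurableSet S := measurableSet_lt hgap hW
    have h := hden (Ψ := fun t y => S.indicator 1 (t, y)) (measurable_one.indicator hS)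
    have h1 : P {ω | c * Real.sqrt (v (observations m x (θ ω) (fun t => ε t ω) n)) <
        W (θ ω) (observations m x (θ ω) (fun t => ε t ω) n)}
        = ∫⁻ ω, S.indicator 1 (θ ω, observations m x (θ ω) (fun t => ε t ω) n) ∂P := by
      have hpre : MeasurableSet ((fun ω => (θ ω, observations m x (θ ω) (fun t => ε t ω) n)) ⁻¹' S) :=
        (hθm.prodMk hobs) hS
      have h2 := lintegral_indicator_one (μ := P) hpre
      exact h2.symm
    rw [h1, h]
    refine (lintegral_mono fun y => (hbd y).1).trans_eq ?_
    rw [lintegral_const_mul' _ _ ENNReal.ofReal_ne_top, hone, mul_one]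
  · have h := hden (Ψ := fun t y => ENNReal.ofReal (W t y - c * Real.sqrt (v y)))
      (ENNReal.measurable_ofReal.comp (hW.sub hgap))
    rw [h]
    refine (lintegral_mono fun y => (hbd y).2).trans ?_
    refine (lintegral_mono (g := fun y => ENNReal.ofReal (Real.sqrt B * Real.exp (-c ^ 2 / 2) / c) *
      ∫⁻ ω, likelihood ρ m x n (θ ω) y ∂P) fun y => ?_).trans_eq ?_
    · dsimp only
      gcongr
      exact hvB y
    · rw [lintegral_const_mul' _ _ ENNReal.ofReal_ne_top, hone, mul_one]

end PredictionError

end GPPricing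

namespace GPPricing

open scoped ENNReal
open Matrix Filter Topology

/-! ### Confidence bounds for adaptively observed demand and claims -/

section PathModel

variable {U V Ω : Type*} [MeasurableSpace U] [MeasurableSpace V] {mΩ : MeasurableSpace Ω}

/-- The demand function is `a (X ω)` and the claims function is `b (Y ω)` for independent random
paths `X`, `Y`, and both are Gaussian processes on `ℝ` with continuous mean and kernel. -/
structure PathModel (P : Measure Ω) (σ : ℝ) (μd μc : ℝ → ℝ) (kd kc : ℝ → ℝ → ℝ)
    (a : U → ℝ → ℝ) (b : V → ℝ → ℝ) (X : Ω → U) (Y : Ω → V) (εd εc : ℕ → Ω → ℝ) : Prop where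
  pos : 0 < σ
  measurable_a : Measurable (Function.uncurry a)
  measurable_b : Measurable (Function.uncurry b)
  measurable_X : Measurable X
  measurable_Y : Measurable Y
  sample_a : IsGPSample P Set.univ μd kd (fun p ω => a (X ω) p)
  sample_b : IsGPSample P Set.univ μc kc (fun p ω => b (Y ω) p)
  continuous_μd : Continuous μd
  continuous_μc : Continuous μc
  continuous_kd : Continuous (Function.uncurry kd)
  continuous_kc : Continuous (Function.uncurry kc)
  measurable_εd : ∀ t, Measurable (εd t)
  measurable_εc : ∀ t, Measurable (εc t)
  law_εd : ∀ t, HasLaw (εd t) (gaussianReal 0 (σ ^ 2).toNNReal) P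
  law_εc : ∀ t, HasLaw (εc t) (gaussianReal 0 (σ ^ 2).toNNReal) P
  indep_noise : iIndepFun (Sum.elim εd εc) P
  indep_paths : IndepFun X Y P
  indep_paths_noise :
    IndepFun (fun ω => (X ω, Y ω)) (fun ω => ((fun t => εd t ω), (fun t => εc t ω))) P

/-- The pair of the demand and the claims function. -/
def pairPath (a : U → ℝ → ℝ) (b : V → ℝ → ℝ) (θ : U × V) (p : ℝ) : ℝ × ℝ := (a θ.1 p, b θ.2 p)

/-- The density of a pair of independent `N(0, σ²)` noises. -/
noncomputable def pairDensity (σ : ℝ) (e : ℝ × ℝ) : ℝ≥0∞ :=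
  gaussianPDF 0 (σ ^ 2).toNNReal e.1 * gaussianPDF 0 (σ ^ 2).toNNReal e.2

lemma measurable_pairDensity (σ : ℝ) : Measurable (pairDensity σ) :=
  ((measurable_gaussianPDF _ _).comp measurable_fst).mul
    ((measurable_gaussianPDF _ _).comp measurable_snd)

omit [MeasurableSpace U] [MeasurableSpace V] in
lemma likelihood_pair (σ : ℝ) (a : U → ℝ → ℝ) (b : V → ℝ → ℝ)
    (x : (n : ℕ) → (Fin n → ℝ × ℝ) → ℝ) (n : ℕ) (θ : U × V) (y : Fin n → ℝ × ℝ) :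
    likelihood (pairDensity σ) (pairPath a b) x n θ y
      = (∏ i, gaussianPDF 0 (σ ^ 2).toNNReal ((y i).1 - a θ.1 (chosenPoints x n y i))) *
        ∏ i, gaussianPDF 0 (σ ^ 2).toNNReal ((y i).2 - b θ.2 (chosenPoints x n y i)) := by
  rw [likelihood, ← Finset.prod_mul_distrib]
  rfl

lemma gaussianPDF_le (m : ℝ) (v : NNReal) (x : ℝ) :
    gaussianPDF m v x ≤ ENNReal.ofReal (Real.sqrt (2 * Real.pi * v))⁻¹ :=
  ENNReal.ofReal_le_ofReal (gaussianPDFReal_le m v x)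

variable {P : Measure Ω} [IsProbabilityMeasure P] {σ : ℝ} {μd μc : ℝ → ℝ} {kd kc : ℝ → ℝ → ℝ}
  {a : U → ℝ → ℝ} {b : V → ℝ → ℝ} {X : Ω → U} {Y : Ω → V} {εd εc : ℕ → Ω → ℝ}

lemma lintegral_prod_gaussianPDF_ne_top {n : ℕ} (v : NNReal) (f : Fin n → Ω → ℝ) :
    ∫⁻ ω, ∏ i, gaussianPDF 0 v (f i ω) ∂P ≠ ∞ := by
  refine ((lintegral_mono (g := fun _ => ENNReal.ofReal (Real.sqrt (2 * Real.pi * v))⁻¹ ^ n)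
    fun ω => ?_).trans_lt ?_).ne
  · exact (Finset.prod_le_prod (fun _ _ => zero_le) fun i _ => gaussianPDF_le 0 v _).trans_eq
      (by simp)
  · simp only [lintegral_const, measure_univ, mul_one]
    exact ENNReal.pow_lt_top ENNReal.ofReal_lt_top

namespace PathModel

omit [IsProbabilityMeasure P] in
lemma measurable_pairPath (h : PathModel P σ μd μc kd kc a b X Y εd εc) :
    Measurable (Function.uncurry (pairPath a b)) :=
  (h.measurable_a.comp (by fun_prop : Measurable fun z : (U × V) × ℝ => (z.1.1, z.2))).prodMk
    (h.measurable_b.comp (by fun_prop : Measurable fun z : (U × V) × ℝ => (z.1.2, z.2)))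

omit [IsProbabilityMeasure P] in
lemma measurable_pair (h : PathModel P σ μd μc kd kc a b X Y εd εc) :
    Measurable fun ω => (X ω, Y ω) := h.measurable_X.prodMk h.measurable_Y

lemma map_noise (h : PathModel P σ μd μc kd kc a b X Y εd εc) (t : ℕ) :
    P.map (fun ω => (εd t ω, εc t ω)) = volume.withDensity (pairDensity σ) := by
  have hv : (σ ^ 2).toNNReal ≠ 0 := (Real.toNNReal_pos.2 (pow_pos h.pos 2)).ne'
  have hi : IndepFun (εd t) (εc t) P :=
    h.indep_noise.indepFun (i := Sum.inl t) (j := Sum.inr t) (by simp)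
  rw [(indepFun_iff_map_prod_eq_prod_map_map (h.measurable_εd t).aemeasurable
    (h.measurable_εc t).aemeasurable).1 hi, (h.law_εd t).map_eq, (h.law_εc t).map_eq,
    gaussianReal_of_var_ne_zero _ hv, prod_withDensity (measurable_gaussianPDF _ _)
      (measurable_gaussianPDF _ _)]
  rfl

omit [IsProbabilityMeasure P] in
lemma iIndepFun_εd (h : PathModel P σ μd μc kd kc a b X Y εd εc) : iIndepFun εd P :=
  iIndepFun.precomp (f := Sum.elim εd εc) Sum.inl_injective h.indep_noise

omit [IsProbabilityMeasure P] in
lemma iIndepFun_εc (h : PathModel P σ μd μc kd kc a b X Y εd εc) : iIndepFun εc P :=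
  iIndepFun.precomp (f := Sum.elim εd εc) Sum.inr_injective h.indep_noise

lemma exists_filtration (h : PathModel P σ μd μc kd kc a b X Y εd εc) :
    ∃ 𝓖 : ℕ → MeasurableSpace Ω, Monotone 𝓖 ∧ (∀ n, 𝓖 n ≤ mΩ) ∧
      Measurable[𝓖 0] (fun ω => (X ω, Y ω)) ∧
      (∀ n, Measurable[𝓖 n] (fun ω => (εd n ω, εc n ω))) ∧
      ∀ n, Indep (𝓖 n)
        (MeasurableSpace.comap (fun ω => (εd (n + 1) ω, εc (n + 1) ω)) inferInstance) P := by
  refine exists_noise_filtration h.measurable_pair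
    (ε := fun t ω => (εd t ω, εc t ω))
    (fun t => (h.measurable_εd t).prodMk (h.measurable_εc t)) ?_ fun n => ?_
  · exact h.indep_paths_noise.comp measurable_id
      (ψ := fun e : (ℕ → ℝ) × (ℕ → ℝ) => fun t => (e.1 t, e.2 t)) (by fun_prop)
  · set S : Finset (ℕ ⊕ ℕ) := (Finset.Iic n).disjSum (Finset.Iic n)
    set T : Finset (ℕ ⊕ ℕ) := Finset.disjSum {n + 1} {n + 1}
    have hST : Disjoint S T := by
      rw [Finset.disjoint_left]
      rintro (i | i) hi hi' <;> simp [S, T] at hi hi' <;> omega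
    have hm : ∀ i, Measurable (Sum.elim εd εc i) := by
      rintro (i | i)
      exacts [h.measurable_εd i, h.measurable_εc i]
    have hi := h.indep_noise.indepFun_finset S T hST hm
    have hS1 : ∀ i : Finset.Iic n, Sum.inl (i : ℕ) ∈ S := fun i => Finset.inl_mem_disjSum.2 i.2
    have hS2 : ∀ i : Finset.Iic n, Sum.inr (i : ℕ) ∈ S := fun i => Finset.inr_mem_disjSum.2 i.2
    have hT1 : Sum.inl (n + 1) ∈ T := by simp [T]
    have hT2 : Sum.inr (n + 1) ∈ T := by simp [T]
    exact hi.comp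
      (φ := fun (e : S → ℝ) (i : Finset.Iic n) => (e ⟨_, hS1 i⟩, e ⟨_, hS2 i⟩))
      (ψ := fun (e : T → ℝ) => (e ⟨_, hT1⟩, e ⟨_, hT2⟩)) (by fun_prop) (by fun_prop)

omit [IsProbabilityMeasure P] in
lemma measurable_lik_demand (h : PathModel P σ μd μc kd kc a b X Y εd εc) {n : ℕ}
    (x y : Fin n → ℝ) :
    Measurable fun u => ∏ i, gaussianPDF 0 (σ ^ 2).toNNReal (y i - a u (x i)) :=
  Finset.measurable_fun_prod _ fun _ _ => (measurable_gaussianPDF _ _).comp <|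
    measurable_const.sub (h.measurable_a.comp (measurable_id.prodMk measurable_const))

omit [IsProbabilityMeasure P] in
lemma measurable_lik_claims (h : PathModel P σ μd μc kd kc a b X Y εd εc) {n : ℕ}
    (x y : Fin n → ℝ) :
    Measurable fun u => ∏ i, gaussianPDF 0 (σ ^ 2).toNNReal (y i - b u (x i)) :=
  Finset.measurable_fun_prod _ fun _ _ => (measurable_gaussianPDF _ _).comp <|
    measurable_const.sub (h.measurable_b.comp (measurable_id.prodMk measurable_const))

-- With `y` frozen the prices are frozen, so the likelihood is a function of `X` times a function of
-- `Y`, and independence splits the integral. Demand can thus be tilted without affecting the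
-- claims, and conversely.
omit [IsProbabilityMeasure P] in
lemma lintegral_likelihood (h : PathModel P σ μd μc kd kc a b X Y εd εc)
    (x : (n : ℕ) → (Fin n → ℝ × ℝ) → ℝ) (n : ℕ) (y : Fin n → ℝ × ℝ) {f : U → ℝ≥0∞}
    (hf : Measurable f) {g : V → ℝ≥0∞} (hg : Measurable g) :
    ∫⁻ ω, f (X ω) * g (Y ω) * likelihood (pairDensity σ) (pairPath a b) x n (X ω, Y ω) y ∂P
      = (∫⁻ ω, f (X ω) * ∏ i, gaussianPDF 0 (σ ^ 2).toNNReal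
          ((y i).1 - a (X ω) (chosenPoints x n y i)) ∂P) *
        ∫⁻ ω, g (Y ω) * ∏ i, gaussianPDF 0 (σ ^ 2).toNNReal
          ((y i).2 - b (Y ω) (chosenPoints x n y i)) ∂P := by
  have h1 := hf.mul (h.measurable_lik_demand (chosenPoints x n y) fun i => (y i).1)
  have h2 := hg.mul (h.measurable_lik_claims (chosenPoints x n y) fun i => (y i).2)
  have h3 := lintegral_mul_eq_lintegral_mul_lintegral_of_indepFun''
    (h1.comp h.measurable_X).aemeasurable (h2.comp h.measurable_Y).aemeasurable
    (h.indep_paths.comp h1 h2)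
  refine Eq.trans (lintegral_congr fun ω => ?_) h3
  simp only [likelihood_pair, Function.comp, Pi.mul_apply]
  ring

lemma lintegral_likelihood_ne_top (h : PathModel P σ μd μc kd kc a b X Y εd εc)
    (x : (n : ℕ) → (Fin n → ℝ × ℝ) → ℝ) (n : ℕ) (y : Fin n → ℝ × ℝ) :
    ∫⁻ ω, likelihood (pairDensity σ) (pairPath a b) x n (X ω, Y ω) y ∂P ≠ ∞ := by
  have := h.lintegral_likelihood x n y (f := fun _ => 1) (g := fun _ => 1) measurable_const
    measurable_const
  simp only [one_mul] at this
  rw [this]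
  exact ENNReal.mul_ne_top (lintegral_prod_gaussianPDF_ne_top _ _)
    (lintegral_prod_gaussianPDF_ne_top _ _)

/-- The claims factor is common to both sides, so the fixed-design identity for demand applies at
the points selected by this particular `y`. -/
lemma mgf_demand (h : PathModel P σ μd μc kd kc a b X Y εd εc)
    (x : (n : ℕ) → (Fin n → ℝ × ℝ) → ℝ) (n : ℕ) (y : Fin n → ℝ × ℝ) (q s : ℝ) :
    ∫⁻ ω, ENNReal.ofReal (Real.exp (s * (a (X ω) q -
        postMean μd kd σ (chosenPoints x n y) (fun i => (y i).1) q))) *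
        likelihood (pairDensity σ) (pairPath a b) x n (X ω, Y ω) y ∂P
      = ENNReal.ofReal (Real.exp (s ^ 2 * postCov kd σ (chosenPoints x n y) q q / 2)) *
        ∫⁻ ω, likelihood (pairDensity σ) (pairPath a b) x n (X ω, Y ω) y ∂P := by
  have ha : Measurable fun u => a u q :=
    h.measurable_a.comp (measurable_id.prodMk measurable_const)
  have h1 := h.lintegral_likelihood x n y (f := fun u => ENNReal.ofReal (Real.exp (s * (a u q -
        postMean μd kd σ (chosenPoints x n y) (fun i => (y i).1) q)))) (g := fun _ => 1)
        (by fun_prop) measurable_const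
  have h2 := h.lintegral_likelihood x n y (f := fun _ => 1) (g := fun _ => 1) measurable_const
    measurable_const
  have h3 := lintegral_exp_mul_prod_gaussianPDF h.measurable_a h.measurable_X h.sample_a h.pos
    h.measurable_εd h.law_εd h.iIndepFun_εd
    (h.indep_paths_noise.comp measurable_fst measurable_fst) (chosenPoints x n y) q s
    fun i => (y i).1
  simp only [one_mul, mul_one] at h1 h2
  rw [h1, h2, h3, mul_assoc]

lemma mgf_claims (h : PathModel P σ μd μc kd kc a b X Y εd εc)
    (x : (n : ℕ) → (Fin n → ℝ × ℝ) → ℝ) (n : ℕ) (y : Fin n → ℝ × ℝ) (q s : ℝ) :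
    ∫⁻ ω, ENNReal.ofReal (Real.exp (s * (b (Y ω) q -
        postMean μc kc σ (chosenPoints x n y) (fun i => (y i).2) q))) *
        likelihood (pairDensity σ) (pairPath a b) x n (X ω, Y ω) y ∂P
      = ENNReal.ofReal (Real.exp (s ^ 2 * postCov kc σ (chosenPoints x n y) q q / 2)) *
        ∫⁻ ω, likelihood (pairDensity σ) (pairPath a b) x n (X ω, Y ω) y ∂P := by
  have hb : Measurable fun u => b u q :=
    h.measurable_b.comp (measurable_id.prodMk measurable_const)
  have h1 := h.lintegral_likelihood x n y (f := fun _ => 1)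
    (g := fun u => ENNReal.ofReal (Real.exp (s * (b u q -
        postMean μc kc σ (chosenPoints x n y) (fun i => (y i).2) q))))
        measurable_const (by fun_prop)
  have h2 := h.lintegral_likelihood x n y (f := fun _ => 1) (g := fun _ => 1) measurable_const
    measurable_const
  have h3 := lintegral_exp_mul_prod_gaussianPDF h.measurable_b h.measurable_Y h.sample_b h.pos
    h.measurable_εc h.law_εc h.iIndepFun_εc
    (h.indep_paths_noise.comp measurable_snd measurable_snd) (chosenPoints x n y) q s
    fun i => (y i).2
  simp only [one_mul] at h1 h2
  rw [h1, h2, h3, mul_left_comm]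

/-- The observations of demand and claims in the first `n` rounds. -/
abbrev obs (a : U → ℝ → ℝ) (b : V → ℝ → ℝ) (X : Ω → U) (Y : Ω → V) (εd εc : ℕ → Ω → ℝ)
    (x : (n : ℕ) → (Fin n → ℝ × ℝ) → ℝ) (n : ℕ) (ω : Ω) : Fin n → ℝ × ℝ :=
  observations (pairPath a b) x (X ω, Y ω) (fun t => (εd t ω, εc t ω)) n

lemma measurable_obs (h : PathModel P σ μd μc kd kc a b X Y εd εc)
    {x : (n : ℕ) → (Fin n → ℝ × ℝ) → ℝ} (hx : ∀ n, Measurable (x n)) (n : ℕ) :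
    Measurable (obs a b X Y εd εc x n) := by
  obtain ⟨𝓖, h1, h2, h3, h4, -⟩ := h.exists_filtration
  exact (measurable_observations h.measurable_pairPath hx h1 h3 h4 n).mono (h2 n) le_rfl

/-- The sign `r = ±1` yields both tails, since the moment generating function depends on s² only.
The price `q` may depend on the observations because that identity holds for every `y`; constant
grid prices and the charged price are both covered. -/
theorem demand_bounds (h : PathModel P σ μd μc kd kc a b X Y εd εc)
    {x : (n : ℕ) → (Fin n → ℝ × ℝ) → ℝ} (hx : ∀ n, Measurable (x n)) (n : ℕ)
    {q : (Fin n → ℝ × ℝ) → ℝ} (hq : Measurable q) {B : ℝ} (hB : ∀ p, kd p p ≤ B) {c : ℝ}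
    (hc : 0 < c) {r : ℝ} (hr : r ^ 2 = 1) :
    P {ω | c * Real.sqrt (postCov kd σ (chosenPoints x n (obs a b X Y εd εc x n ω))
          (q (obs a b X Y εd εc x n ω)) (q (obs a b X Y εd εc x n ω))) <
        r * (a (X ω) (q (obs a b X Y εd εc x n ω)) - postMean μd kd σ
          (chosenPoints x n (obs a b X Y εd εc x n ω)) (fun i => (obs a b X Y εd εc x n ω i).1)
          (q (obs a b X Y εd εc x n ω)))}
        ≤ ENNReal.ofReal (Real.exp (-c ^ 2 / 2)) ∧
      ∫⁻ ω, ENNReal.ofReal (r * (a (X ω) (q (obs a b X Y εd εc x n ω)) - postMean μd kd σ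
          (chosenPoints x n (obs a b X Y εd εc x n ω)) (fun i => (obs a b X Y εd εc x n ω i).1)
          (q (obs a b X Y εd εc x n ω)))
        - c * Real.sqrt (postCov kd σ (chosenPoints x n (obs a b X Y εd εc x n ω))
          (q (obs a b X Y εd εc x n ω)) (q (obs a b X Y εd εc x n ω)))) ∂P
        ≤ ENNReal.ofReal (Real.sqrt B * Real.exp (-c ^ 2 / 2) / c) := by
  obtain ⟨𝓖, h1, h2, h3, h4, h5⟩ := h.exists_filtration
  have hk := h.sample_a.isPSDKernel
  have hpts := measurable_chosenPoints hx n
  refine posterior_chernoff_bounds (measurable_pairDensity σ) h.measurable_pairPath hx h1 h2 h3 h4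
    h.map_noise h5 n
    (W := fun θ y => r * (a θ.1 (q y) - postMean μd kd σ (chosenPoints x n y)
      (fun i => (y i).1) (q y)))
    (v := fun y => postCov kd σ (chosenPoints x n y) (q y) (q y)) ?_ ?_
    (fun y => hk.postCov_nonneg h.pos _ _) (fun y => (hk.postCov_le h.pos _ _).trans (hB _))
    (h.lintegral_likelihood_ne_top x n) (fun y s => ?_) hc
  · refine Measurable.const_mul (Measurable.sub ?_ ?_) _
    · exact h.measurable_a.comp ((measurable_fst.comp measurable_fst).prodMk
        (hq.comp measurable_snd))
    · have := (hk.continuous_postMean h.pos h.continuous_kd h.continuous_μd n).measurable.comp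
        (hpts.prodMk ((by fun_prop : Measurable fun (y : Fin n → ℝ × ℝ) i => (y i).1).prodMk hq))
      exact this.comp measurable_snd
  · exact (hk.continuous_postCov h.pos h.continuous_kd n).measurable.comp (hpts.prodMk hq)
  · have := h.mgf_demand x n y (q y) (s * r)
    simpa only [mul_assoc, mul_pow, hr, one_mul] using! this

theorem claims_bounds (h : PathModel P σ μd μc kd kc a b X Y εd εc)
    {x : (n : ℕ) → (Fin n → ℝ × ℝ) → ℝ} (hx : ∀ n, Measurable (x n)) (n : ℕ)
    {q : (Fin n → ℝ × ℝ) → ℝ} (hq : Measurable q) {B : ℝ} (hB : ∀ p, kc p p ≤ B) {c : ℝ}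
    (hc : 0 < c) {r : ℝ} (hr : r ^ 2 = 1) :
    P {ω | c * Real.sqrt (postCov kc σ (chosenPoints x n (obs a b X Y εd εc x n ω))
          (q (obs a b X Y εd εc x n ω)) (q (obs a b X Y εd εc x n ω))) <
        r * (b (Y ω) (q (obs a b X Y εd εc x n ω)) - postMean μc kc σ
          (chosenPoints x n (obs a b X Y εd εc x n ω)) (fun i => (obs a b X Y εd εc x n ω i).2)
          (q (obs a b X Y εd εc x n ω)))}
        ≤ ENNReal.ofReal (Real.exp (-c ^ 2 / 2)) ∧
      ∫⁻ ω, ENNReal.ofReal (r * (b (Y ω) (q (obs a b X Y εd εc x n ω)) - postMean μc kc σ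
          (chosenPoints x n (obs a b X Y εd εc x n ω)) (fun i => (obs a b X Y εd εc x n ω i).2)
          (q (obs a b X Y εd εc x n ω)))
        - c * Real.sqrt (postCov kc σ (chosenPoints x n (obs a b X Y εd εc x n ω))
          (q (obs a b X Y εd εc x n ω)) (q (obs a b X Y εd εc x n ω)))) ∂P
        ≤ ENNReal.ofReal (Real.sqrt B * Real.exp (-c ^ 2 / 2) / c) := by
  obtain ⟨𝓖, h1, h2, h3, h4, h5⟩ := h.exists_filtration
  have hk := h.sample_b.isPSDKernel
  have hpts := measurable_chosenPoints hx n
  refine posterior_chernoff_bounds (measurable_pairDensity σ) h.measurable_pairPath hx h1 h2 h3 h4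
    h.map_noise h5 n
    (W := fun θ y => r * (b θ.2 (q y) - postMean μc kc σ (chosenPoints x n y)
      (fun i => (y i).2) (q y)))
    (v := fun y => postCov kc σ (chosenPoints x n y) (q y) (q y)) ?_ ?_
    (fun y => hk.postCov_nonneg h.pos _ _) (fun y => (hk.postCov_le h.pos _ _).trans (hB _))
    (h.lintegral_likelihood_ne_top x n) (fun y s => ?_) hc
  · refine Measurable.const_mul (Measurable.sub ?_ ?_) _
    · exact h.measurable_b.comp ((measurable_snd.comp measurable_fst).prodMk
        (hq.comp measurable_snd))
    · have := (hk.continuous_postMean h.pos h.continuous_kc h.continuous_μc n).measurable.comp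
        (hpts.prodMk ((by fun_prop : Measurable fun (y : Fin n → ℝ × ℝ) i => (y i).2).prodMk hq))
      exact this.comp measurable_snd
  · exact (hk.continuous_postCov h.pos h.continuous_kc n).measurable.comp (hpts.prodMk hq)
  · have := h.mgf_claims x n y (q y) (s * r)
    simpa only [mul_assoc, mul_pow, hr, one_mul] using! this

end PathModel

end PathModel

end GPPricing

namespace GPPricing

open scoped ENNReal
open Filter Topology

/-! ### Envelopes of the sample paths -/

section Envelope

/-- The square of a nonnegative variable with the tail `a * exp (-(J / b) ^ 2)` has a finite mean,
bounded in terms of `a` and `b`. -/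
lemma exists_second_moment_bound (a : ℝ) {b : ℝ} (hb : 0 < b) :
    ∃ M : ℝ, 0 ≤ M ∧ ∀ {Ω : Type*} [MeasurableSpace Ω] (P : Measure Ω) (Λ : Ω → ℝ), Measurable Λ →
      (∀ ω, 0 ≤ Λ ω) →
      (∀ J : ℝ, 0 < J → P {ω | J < Λ ω} ≤ ENNReal.ofReal (a * Real.exp (-(J / b) ^ 2))) →
      ∫⁻ ω, ENNReal.ofReal (Λ ω ^ 2) ∂P ≤ ENNReal.ofReal M := by
  have hint : Integrable fun t : ℝ => a * (t * Real.exp (-(b⁻¹ ^ 2) * t ^ 2)) :=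
    (integrable_mul_exp_neg_mul_sq (by positivity)).const_mul a
  set I : ℝ≥0∞ := 2 * ∫⁻ t in Set.Ioi (0 : ℝ),
    ENNReal.ofReal (a * (t * Real.exp (-(b⁻¹ ^ 2) * t ^ 2)))
  have hI : I ≠ ∞ := by
    refine ENNReal.mul_ne_top ENNReal.ofNat_ne_top (ne_of_lt ?_)
    refine lt_of_le_of_lt (lintegral_mono fun t => ?_) hint.integrableOn.2
    exact Real.ofReal_le_enorm _
  refine ⟨I.toReal, ENNReal.toReal_nonneg, fun {Ω} _ P Λ hm h0 htail => ?_⟩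
  rw [ENNReal.ofReal_toReal hI]
  -- Layer cake formula: the second moment is twice the integral of t times the tail, and t
  -- exp(-(t/b)²) is integrable.
  have h := lintegral_rpow_eq_lintegral_meas_lt_mul P (f := Λ) (Eventually.of_forall h0)
    hm.aemeasurable (p := 2) two_pos
  simp only [Real.rpow_two] at h
  rw [h]
  have h2 : ENNReal.ofReal 2 = 2 := by simp
  rw [h2]
  refine mul_le_mul_right (setLIntegral_mono' measurableSet_Ioi fun t ht => ?_) _
  have ht0 : (0 : ℝ) < t := ht
  have e1 : t ^ ((2 : ℝ) - 1) = t := by norm_num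
  rw [e1]
  refine (mul_le_mul_left (htail t ht0) _).trans_eq ?_
  rw [← ENNReal.ofReal_mul' ht0.le]
  congr 1
  have : -(t / b) ^ 2 = -(b⁻¹ ^ 2) * t ^ 2 := by rw [div_eq_mul_inv]; ring
  rw [this]
  ring

/-- The projection onto `[a, b]`. -/
noncomputable def clamp (a b p : ℝ) : ℝ := max a (min p b)

lemma clamp_mem {a b : ℝ} (hab : a ≤ b) (p : ℝ) : clamp a b p ∈ Set.Icc a b :=
  ⟨le_max_left _ _, max_le hab (min_le_right _ _)⟩

lemma clamp_of_mem {a b p : ℝ} (hp : p ∈ Set.Icc a b) : clamp a b p = p := by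
  rw [clamp, min_eq_left hp.2, max_eq_right hp.1]

lemma continuous_clamp (a b : ℝ) : Continuous (clamp a b) := by
  unfold clamp; fun_prop

lemma abs_clamp_sub_le (a b p q : ℝ) : |clamp a b p - clamp a b q| ≤ |p - q| :=
  (abs_max_sub_max_le_max _ _ _ _).trans <| by
    rw [sub_self, abs_zero, max_eq_right (abs_nonneg _)]
    exact (abs_min_sub_min_le_max _ _ _ _).trans (by simp)

lemma abs_sub_le_of_derivWithin_le {a b : ℝ} {f : ℝ → ℝ}
    (hf : ContDiffOn ℝ 1 f (Set.Icc a b)) {J : ℝ}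
    (hJ : ∀ p ∈ Set.Icc a b, |derivWithin f (Set.Icc a b) p| ≤ J) {p q : ℝ}
    (hp : p ∈ Set.Icc a b) (hq : q ∈ Set.Icc a b) : |f p - f q| ≤ J * |p - q| := by
  have := (convex_Icc a b).norm_image_sub_le_of_norm_derivWithin_le (f := f) (C := J)
    (hf.differentiableOn one_ne_zero) hJ hq hp
  simpa only [Real.norm_eq_abs] using this

/-- The Lipschitz constant of `f` along the sequence `D`. -/
noncomputable def seqLipschitz (D : ℕ → ℝ) (f : ℝ → ℝ) : ℝ≥0∞ :=
  ⨆ i, ⨆ j, ENNReal.ofReal (|f (D i) - f (D j)| / |D i - D j|)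

lemma seqLipschitz_le {D : ℕ → ℝ} {f : ℝ → ℝ} {J : ℝ} (hJ : 0 ≤ J)
    (h : ∀ p q, |f p - f q| ≤ J * |p - q|) : seqLipschitz D f ≤ ENNReal.ofReal J :=
  iSup₂_le fun _ _ => ENNReal.ofReal_le_ofReal <| div_le_of_le_mul₀ (abs_nonneg _) hJ (h _ _)

/-- The inequality is a closed condition on pairs and holds on the dense set of pairs from `D`. -/
lemma abs_sub_le_seqLipschitz {D : ℕ → ℝ} (hD : DenseRange D) {f : ℝ → ℝ} (hf : Continuous f)
    (hfin : seqLipschitz D f ≠ ∞) (p q : ℝ) :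
    |f p - f q| ≤ (seqLipschitz D f).toReal * |p - q| := by
  have hc : IsClosed {z : ℝ × ℝ | |f z.1 - f z.2| ≤ (seqLipschitz D f).toReal * |z.1 - z.2|} :=
    isClosed_le (by fun_prop) (by fun_prop)
  have hDD : DenseRange fun ij : ℕ × ℕ => (D ij.1, D ij.2) := hD.prodMap hD
  refine hDD.induction_on (p := fun z : ℝ × ℝ =>
    |f z.1 - f z.2| ≤ (seqLipschitz D f).toReal * |z.1 - z.2|) (p, q) hc fun ij => ?_
  obtain ⟨i, j⟩ := ij
  rcases eq_or_ne (D i) (D j) with h | h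
  · simp [h]
  · have hpos : 0 < |D i - D j| := abs_pos.2 (sub_ne_zero.2 h)
    rw [← div_le_iff₀ hpos]
    refine (ENNReal.ofReal_le_iff_le_toReal hfin).1 ?_
    exact le_iSup₂ (f := fun i j => ENNReal.ofReal (|f (D i) - f (D j)| / |D i - D j|)) i j

/-- The sample paths have a random Lipschitz constant whose second moment is bounded in terms of
the tail of the derivative. -/
lemma exists_lipschitz_bound {pl ph : ℝ} (hph : pl < ph) (a : ℝ) {b : ℝ} (hb : 0 < b) :
    ∃ M : ℝ, 0 ≤ M ∧ ∀ {Ω : Type*} [MeasurableSpace Ω] (P : Measure Ω) [IsProbabilityMeasure P]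
      (f : ℝ → Ω → ℝ), (∀ p ∈ Set.Icc pl ph, Measurable (f p)) →
      HasSubgaussianDeriv P (Set.Icc pl ph) a b f →
      ∃ Λ : Ω → ℝ, Measurable Λ ∧ (∀ ω, 0 ≤ Λ ω) ∧
        (∀ᵐ ω ∂P, ∀ p ∈ Set.Icc pl ph, ∀ q ∈ Set.Icc pl ph, |f p ω - f q ω| ≤ Λ ω * |p - q|) ∧
        ∫⁻ ω, ENNReal.ofReal (Λ ω ^ 2) ∂P ≤ ENNReal.ofReal M := by
  obtain ⟨M, hM0, hM⟩ := exists_second_moment_bound a hb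
  refine ⟨M, hM0, fun {Ω} _ P _ f hfm hf => ?_⟩
  set D := TopologicalSpace.denseSeq ℝ
  have hD : DenseRange D := TopologicalSpace.denseRange_denseSeq ℝ
  have hcm := fun p => clamp_mem hph.le p
  -- A countable supremum is measurable, which is not clear for the supremum of the derivative. By
  -- the mean value inequality it inherits the tail of the latter.
  set Λ' : Ω → ℝ≥0∞ := fun ω => seqLipschitz D fun p => f (clamp pl ph p) ω
  have hΛ' : Measurable Λ' := by
    refine Measurable.iSup fun i => Measurable.iSup fun j => ENNReal.measurable_ofReal.comp ?_
    exact (measurable_norm.comp ((hfm _ (hcm _)).sub (hfm _ (hcm _)))).div_const _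
  have htail : ∀ J : ℝ, 0 < J →
      P {ω | ENNReal.ofReal J < Λ' ω} ≤ ENNReal.ofReal (a * Real.exp (-(J / b) ^ 2)) := by
    intro J hJ
    refine le_trans (measure_mono_ae ?_) (hf.tail J hJ)
    filter_upwards [hf.contDiffOn] with ω hω hlt
    by_contra hno
    have hno' : ∀ p ∈ Set.Icc pl ph,
        |derivWithin (fun q => f q ω) (Set.Icc pl ph) p| ≤ J := fun p hp => by
      by_contra h
      exact hno ⟨p, hp, not_le.1 h⟩
    refine absurd hlt (not_lt.2 (seqLipschitz_le hJ.le fun p q => ?_))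
    refine (abs_sub_le_of_derivWithin_le hω hno' (hcm p) (hcm q)).trans ?_
    exact mul_le_mul_of_nonneg_left (abs_clamp_sub_le _ _ _ _) hJ.le
  have hfin : ∀ᵐ ω ∂P, Λ' ω ≠ ∞ := by
    have hle : ∀ j : ℕ, P {ω | Λ' ω = ∞}
        ≤ ENNReal.ofReal (a * Real.exp (-(((j : ℝ) + 1) / b) ^ 2)) := fun j =>
      (measure_mono fun ω (hω : Λ' ω = ∞) => by
        change ENNReal.ofReal _ < Λ' ω
        rw [hω]; exact ENNReal.ofReal_lt_top).trans (htail _ (by positivity))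
    have hlim : Tendsto (fun j : ℕ => ENNReal.ofReal (a * Real.exp (-(((j : ℝ) + 1) / b) ^ 2)))
        atTop (𝓝 (ENNReal.ofReal (a * 0))) := by
      refine ENNReal.tendsto_ofReal (Tendsto.const_mul a (Real.tendsto_exp_neg_atTop_nhds_zero.comp ?_))
      refine (tendsto_pow_atTop two_ne_zero).comp (Tendsto.atTop_div_const hb ?_)
      exact tendsto_atTop_add_const_right _ _ tendsto_natCast_atTop_atTop
    rw [mul_zero, ENNReal.ofReal_zero] at hlim
    rw [ae_iff]
    simp only [ne_eq, not_not]
    exact le_antisymm (ge_of_tendsto' hlim hle) zero_le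
  refine ⟨fun ω => (Λ' ω).toReal, hΛ'.ennreal_toReal, fun ω => ENNReal.toReal_nonneg, ?_, ?_⟩
  · filter_upwards [hf.contDiffOn, hfin] with ω hω hωfin p hp q hq
    have hcont : Continuous fun p => f (clamp pl ph p) ω :=
      hω.continuousOn.comp_continuous (continuous_clamp pl ph) hcm
    have := abs_sub_le_seqLipschitz hD hcont hωfin p q
    rwa [clamp_of_mem hp, clamp_of_mem hq] at this
  · refine hM P _ hΛ'.ennreal_toReal (fun ω => ENNReal.toReal_nonneg) fun J hJ => ?_
    refine le_trans (measure_mono fun ω hω => ?_) (htail J hJ)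
    have hω' : J < (Λ' ω).toReal := hω
    exact (ENNReal.ofReal_lt_ofReal_iff_of_nonneg hJ.le).2 hω' |>.trans_le ENNReal.ofReal_toReal_le

/-- A random variable bounding the sample path and its Lipschitz constant. -/
structure IsEnvelope {Ω : Type*} [MeasurableSpace Ω] (P : Measure Ω) (S : Set ℝ)
    (f : ℝ → Ω → ℝ) (B : ℝ) (H : Ω → ℝ) : Prop where
  measurable : Measurable H
  nonneg : ∀ ω, 0 ≤ H ω
  abs_le : ∀ᵐ ω ∂P, ∀ p ∈ S, |f p ω| ≤ H ω
  abs_sub_le : ∀ᵐ ω ∂P, ∀ p ∈ S, ∀ q ∈ S, |f p ω - f q ω| ≤ H ω * |p - q|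
  second_moment : ∫⁻ ω, ENNReal.ofReal (H ω ^ 2) ∂P ≤ ENNReal.ofReal B

lemma exists_envelope {pl ph : ℝ} (hph : pl < ph) (μ : ℝ → ℝ) (k : ℝ → ℝ → ℝ) (a : ℝ) {b : ℝ}
    (hb : 0 < b) :
    ∃ B : ℝ, 0 ≤ B ∧ ∀ {Ω : Type*} [MeasurableSpace Ω] (P : Measure Ω) [IsProbabilityMeasure P]
      (f : ℝ → Ω → ℝ), IsGPSample P (Set.Icc pl ph) μ k f →
      HasSubgaussianDeriv P (Set.Icc pl ph) a b f →
      ∃ H : Ω → ℝ, IsEnvelope P (Set.Icc pl ph) f B H := by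
  obtain ⟨M, hM0, hM⟩ := exists_lipschitz_bound hph a hb
  -- `w ≥ 1` preserves the Lipschitz bound, and `w` exceeds the distance to `pl`, so |f(pl)| + wΛ
  -- also bounds the path.
  set w := 1 + (ph - pl)
  have hw : 0 < w := by simp only [w]; linarith
  -- The constant comes from (u + v)² ≤ 2u² + 2v². The absolute value makes it nonnegative before
  -- any process with this mean and kernel is given.
  refine ⟨|2 * (k pl pl + μ pl ^ 2) + 2 * w ^ 2 * M|, abs_nonneg _, fun {Ω} _ P _ f hg hf => ?_⟩
  obtain ⟨Λ, hΛm, hΛ0, hΛ, hΛ2⟩ := hM P f hg.measurable hf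
  have hpl : pl ∈ Set.Icc pl ph := ⟨le_rfl, hph.le⟩
  refine ⟨fun ω => |f pl ω| + w * Λ ω, ?_, fun ω => ?_, ?_, ?_, ?_⟩
  · exact (measurable_norm.comp (hg.measurable pl hpl)).add (hΛm.const_mul w)
  · have := hΛ0 ω
    positivity
  · filter_upwards [hΛ] with ω hω p hp
    have h1 := hω p hp pl hpl
    have h2 : |p - pl| ≤ w := by
      rw [abs_of_nonneg (by linarith [hp.1])]
      simp only [w]
      linarith [hp.2]
    have h3 : |f p ω| ≤ |f p ω - f pl ω| + |f pl ω| := by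
      simpa using abs_add_le (f p ω - f pl ω) (f pl ω)
    nlinarith [hΛ0 ω, mul_le_mul_of_nonneg_left h2 (hΛ0 ω)]
  · filter_upwards [hΛ] with ω hω p hp q hq
    refine (hω p hp q hq).trans (mul_le_mul_of_nonneg_right ?_ (abs_nonneg _))
    have h1 : 1 ≤ w := by simp only [w]; linarith
    nlinarith [hΛ0 ω, abs_nonneg (f pl ω)]
  · have hL2 : MemLp (f pl) 2 P := (hg.gaussian.hasGaussianLaw_eval ⟨pl, hpl⟩).memLp_two
    have hsq : ∫ ω, f pl ω ^ 2 ∂P = k pl pl + μ pl ^ 2 := by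
      have h1 := hg.covariance pl hpl pl hpl
      rw [covariance_self hL2.1.aemeasurable, variance_eq_sub hL2, hg.mean pl hpl] at h1
      have h2 : P[f pl ^ 2] = ∫ ω, f pl ω ^ 2 ∂P := rfl
      linarith
    have hsq0 : 0 ≤ k pl pl + μ pl ^ 2 := hsq ▸ integral_nonneg fun ω => sq_nonneg _
    have hsql : ∫⁻ ω, ENNReal.ofReal (f pl ω ^ 2) ∂P = ENNReal.ofReal (k pl pl + μ pl ^ 2) := by
      rw [← hsq, ofReal_integral_eq_lintegral_ofReal hL2.integrable_sq
        (Eventually.of_forall fun ω => sq_nonneg _)]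
    calc ∫⁻ ω, ENNReal.ofReal ((|f pl ω| + w * Λ ω) ^ 2) ∂P
        ≤ ∫⁻ ω, (ENNReal.ofReal 2 * ENNReal.ofReal (f pl ω ^ 2)
            + ENNReal.ofReal (2 * w ^ 2) * ENNReal.ofReal (Λ ω ^ 2)) ∂P := by
          refine lintegral_mono fun ω => ?_
          rw [← ENNReal.ofReal_mul (by positivity), ← ENNReal.ofReal_mul (by positivity),
            ← ENNReal.ofReal_add (by positivity) (by positivity)]
          refine ENNReal.ofReal_le_ofReal ?_
          rw [← sq_abs (f pl ω)]
          nlinarith [sq_nonneg (|f pl ω| - w * Λ ω)]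
      _ = ENNReal.ofReal 2 * ∫⁻ ω, ENNReal.ofReal (f pl ω ^ 2) ∂P
            + ENNReal.ofReal (2 * w ^ 2) * ∫⁻ ω, ENNReal.ofReal (Λ ω ^ 2) ∂P := by
          have hm := hg.measurable pl hpl
          rw [lintegral_add_left (by fun_prop), lintegral_const_mul _ (by fun_prop),
            lintegral_const_mul _ (by fun_prop)]
      _ ≤ ENNReal.ofReal 2 * ENNReal.ofReal (k pl pl + μ pl ^ 2)
            + ENNReal.ofReal (2 * w ^ 2) * ENNReal.ofReal M := by
          rw [hsql]; gcongr
      _ = ENNReal.ofReal (2 * (k pl pl + μ pl ^ 2) + 2 * w ^ 2 * M) := by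
          rw [← ENNReal.ofReal_mul (by positivity), ← ENNReal.ofReal_mul (by positivity),
            ← ENNReal.ofReal_add (by positivity) (by positivity)]
      _ ≤ _ := ENNReal.ofReal_le_ofReal (le_abs_self _)

end Envelope

end GPPricing

namespace GPPricing

open scoped ENNReal
open Filter Topology

/-! ### Reduction to Gaussian processes on the line given by measurable paths -/

/-- The value at `p` of the continuous function with the values `u` along a dense sequence. -/
noncomputable def pathEval (u : ℕ → ℝ) (p : ℝ) : ℝ :=
  limsup (fun N => u (SimpleFunc.nearestPtInd (TopologicalSpace.denseSeq ℝ) N p)) atTop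

/-- Joint measurability is what allows a path to be evaluated at a random price. The limsup is
measurable on all sequences, including those that do not come from a continuous function. -/
lemma measurable_pathEval : Measurable (Function.uncurry pathEval) := by
  refine Measurable.limsup fun N => ?_
  have h : Measurable fun z : (ℕ → ℝ) × ℕ => z.1 z.2 :=
    measurable_from_prod_countable_left fun i => measurable_pi_apply i
  exact h.comp (measurable_fst.prodMk ((SimpleFunc.measurable _).comp measurable_snd))

lemma pathEval_eq {f : ℝ → ℝ} (hf : Continuous f) (p : ℝ) :
    pathEval (fun n => f (TopologicalSpace.denseSeq ℝ n)) p = f p := by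
  have h := (SimpleFunc.tendsto_nearestPt (e := TopologicalSpace.denseSeq ℝ) (x := p)
    (TopologicalSpace.denseRange_denseSeq ℝ p))
  exact ((hf.tendsto p).comp h).limsup_eq

section Clamp

variable {Ω : Type*} {mΩ : MeasurableSpace Ω} {P : Measure Ω} [IsProbabilityMeasure P]
  {pl ph : ℝ} {μ : ℝ → ℝ} {k : ℝ → ℝ → ℝ} {f : ℝ → Ω → ℝ} {B : ℝ} {H : Ω → ℝ}

omit [IsProbabilityMeasure P] in
lemma IsEnvelope.memLp (hH : IsEnvelope P (Set.Icc pl ph) f B H) : MemLp H 2 P := by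
  rw [memLp_two_iff_integrable_sq hH.measurable.aestronglyMeasurable]
  refine ⟨(hH.measurable.pow_const 2).aestronglyMeasurable, ?_⟩
  rw [hasFiniteIntegral_iff_ofReal (Eventually.of_forall fun ω => sq_nonneg _)]
  exact hH.second_moment.trans_lt ENNReal.ofReal_lt_top

omit [IsProbabilityMeasure P] in
lemma IsEnvelope.integral_sq_le (hB : 0 ≤ B) (hH : IsEnvelope P (Set.Icc pl ph) f B H) :
    ∫ ω, H ω ^ 2 ∂P ≤ B := by
  rw [integral_eq_lintegral_of_nonneg_ae (Eventually.of_forall fun ω => sq_nonneg _)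
    (hH.measurable.pow_const 2).aestronglyMeasurable]
  exact ENNReal.toReal_le_of_le_ofReal hB hH.second_moment

omit [IsProbabilityMeasure P] in
/-- A Gaussian process on an interval, continued by its boundary values. -/
lemma IsGPSample.comp_clamp (hph : pl ≤ ph) (hg : IsGPSample P (Set.Icc pl ph) μ k f) :
    IsGPSample P Set.univ (fun p => μ (clamp pl ph p))
      (fun p q => k (clamp pl ph p) (clamp pl ph q)) (fun p => f (clamp pl ph p)) where
  measurable p _ := hg.measurable _ (clamp_mem hph p)
  gaussian := hg.gaussian.comp_right
    fun p : (Set.univ : Set ℝ) => (⟨clamp pl ph p, clamp_mem hph p⟩ : Set.Icc pl ph)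
  mean p _ := hg.mean _ (clamp_mem hph p)
  covariance p _ q _ := hg.covariance _ (clamp_mem hph p) _ (clamp_mem hph q)

omit [IsProbabilityMeasure P] in
lemma IsGPSample.congr {g : ℝ → Ω → ℝ} (hg : IsGPSample P Set.univ μ k f)
    (hm : ∀ p, Measurable (g p)) (h : ∀ p, f p =ᵐ[P] g p) : IsGPSample P Set.univ μ k g where
  measurable p _ := hm p
  gaussian := hg.gaussian.congr fun p => h p
  mean p hp := by rw [← hg.mean p hp]; exact (integral_congr_ae (h p)).symm
  covariance p hp q hq := by
    rw [← hg.covariance p hp q hq]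
    simp only [ProbabilityTheory.covariance]
    rw [integral_congr_ae (h p), integral_congr_ae (h q)]
    refine integral_congr_ae ?_
    filter_upwards [h p, h q] with ω h1 h2
    rw [h1, h2]

omit [IsProbabilityMeasure P] in
lemma IsEnvelope.ae_continuous (hph : pl ≤ ph) (hH : IsEnvelope P (Set.Icc pl ph) f B H) :
    ∀ᵐ ω ∂P, Continuous fun p => f (clamp pl ph p) ω := by
  filter_upwards [hH.abs_sub_le] with ω hω
  refine LipschitzWith.continuous (K := (H ω).toNNReal) (LipschitzWith.of_dist_le_mul fun p q => ?_)
  rw [Real.dist_eq, Real.dist_eq, Real.coe_toNNReal _ (hH.nonneg ω)]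
  refine (hω _ (clamp_mem hph p) _ (clamp_mem hph q)).trans ?_
  exact mul_le_mul_of_nonneg_left (abs_clamp_sub_le _ _ _ _) (hH.nonneg ω)

/-- Dominated convergence with the envelope, the paths being almost surely continuous. Continuity of
the mean, and likewise of the kernel, is thus a consequence of the model. -/
lemma IsGPSample.continuous_mean (hph : pl ≤ ph) (hg : IsGPSample P (Set.Icc pl ph) μ k f)
    (hH : IsEnvelope P (Set.Icc pl ph) f B H) :
    Continuous fun p => μ (clamp pl ph p) := by
  have heq : (fun p => μ (clamp pl ph p))
      = fun p => ∫ ω, f (clamp pl ph p) ω ∂P :=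
    funext fun p => (hg.mean _ (clamp_mem hph p)).symm
  rw [heq]
  refine continuous_of_dominated
    (fun p => (hg.measurable _ (clamp_mem hph p)).aestronglyMeasurable) (bound := H) (fun p => ?_)
    (hH.memLp.integrable one_le_two) (hH.ae_continuous hph)
  filter_upwards [hH.abs_le] with ω hω
  exact hω _ (clamp_mem hph p)

lemma IsGPSample.continuous_kernel (hph : pl ≤ ph) (hg : IsGPSample P (Set.Icc pl ph) μ k f)
    (hH : IsEnvelope P (Set.Icc pl ph) f B H) :
    Continuous (Function.uncurry fun p q =>
      k (clamp pl ph p) (clamp pl ph q)) := by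
  have hg' := hg.comp_clamp hph
  have heq : (Function.uncurry fun p q =>
      k (clamp pl ph p) (clamp pl ph q)) = fun z : ℝ × ℝ =>
      ∫ ω, f (clamp pl ph z.1) ω * f (clamp pl ph z.2) ω ∂P
        - μ (clamp pl ph z.1) * μ (clamp pl ph z.2) := by
    funext z
    have := hg'.covariance z.1 (Set.mem_univ _) z.2 (Set.mem_univ _)
    rw [covariance_eq_sub (hg'.memLp _) (hg'.memLp _), hg'.mean _ (Set.mem_univ _),
      hg'.mean _ (Set.mem_univ _)] at this
    exact this.symm
  rw [heq]
  have hμ := hg.continuous_mean hph hH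
  refine Continuous.sub ?_ ((hμ.comp continuous_fst).mul (hμ.comp continuous_snd))
  refine continuous_of_dominated (bound := fun ω => H ω ^ 2) (fun z =>
    ((hg.measurable _ (clamp_mem hph _)).mul
      (hg.measurable _ (clamp_mem hph _))).aestronglyMeasurable) (fun z => ?_)
    hH.memLp.integrable_sq ?_
  · filter_upwards [hH.abs_le] with ω hω
    rw [norm_mul, sq]
    exact mul_le_mul (hω _ (clamp_mem hph _)) (hω _ (clamp_mem hph _)) (norm_nonneg _)
      (hH.nonneg ω)
  · filter_upwards [hH.ae_continuous hph] with ω hω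
    exact (hω.comp continuous_fst).mul (hω.comp continuous_snd)

/-- A variance is at most a second moment, and the envelope dominates the path. -/
lemma IsGPSample.kernel_le (hph : pl ≤ ph) (hB : 0 ≤ B)
    (hg : IsGPSample P (Set.Icc pl ph) μ k f) (hH : IsEnvelope P (Set.Icc pl ph) f B H) (p : ℝ) :
    k (clamp pl ph p) (clamp pl ph p) ≤ B := by
  have hg' := hg.comp_clamp hph
  have h1 := hg'.covariance p (Set.mem_univ _) p (Set.mem_univ _)
  rw [covariance_self (hg'.memLp p).1.aemeasurable] at h1
  rw [← h1]
  refine (variance_le_expectation_sq (hg'.memLp p).1).trans ?_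
  refine le_trans (integral_mono_ae (hg'.memLp p).integrable_sq hH.memLp.integrable_sq ?_)
    (hH.integral_sq_le hB)
  filter_upwards [hH.abs_le] with ω hω
  exact sq_le_sq' (abs_le.1 (hω _ (clamp_mem hph p))).1 (abs_le.1 (hω _ (clamp_mem hph p))).2

/-- The path of the clamped process along the dense sequence. -/
noncomputable def densePath (pl ph : ℝ) (f : ℝ → Ω → ℝ) (ω : Ω) (n : ℕ) : ℝ :=
  f (clamp pl ph (TopologicalSpace.denseSeq ℝ n)) ω

omit [IsProbabilityMeasure P] in
lemma measurable_densePath (hph : pl ≤ ph) (hf : ∀ p ∈ Set.Icc pl ph, Measurable (f p)) :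
    Measurable (densePath pl ph f) :=
  measurable_pi_lambda _ fun _ => hf _ (clamp_mem hph _)

omit [IsProbabilityMeasure P] in
lemma IsEnvelope.ae_pathEval_eq (hph : pl ≤ ph) (hH : IsEnvelope P (Set.Icc pl ph) f B H) :
    ∀ᵐ ω ∂P, ∀ p, pathEval (densePath pl ph f ω) p = f (clamp pl ph p) ω := by
  filter_upwards [hH.ae_continuous hph] with ω hω p
  exact pathEval_eq (f := fun p => f (clamp pl ph p) ω) hω p

omit [IsProbabilityMeasure P] in
lemma IsGPSample.comp_pathEval (hph : pl ≤ ph) (hg : IsGPSample P (Set.Icc pl ph) μ k f)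
    (hH : IsEnvelope P (Set.Icc pl ph) f B H) :
    IsGPSample P Set.univ (fun p => μ (clamp pl ph p))
      (fun p q => k (clamp pl ph p) (clamp pl ph q))
      (fun p ω => pathEval (densePath pl ph f ω) p) := by
  refine (hg.comp_clamp hph).congr (fun p => ?_) fun p => ?_
  · exact measurable_pathEval.of_uncurry_right.comp (measurable_densePath hph hg.measurable)
  · filter_upwards [hH.ae_pathEval_eq hph] with ω hω
    exact (hω p).symm

/-- The dense sequence of values is a measurable function of the process on the interval, so the
independence assumptions carry over. -/
theorem pathModel_of_noisyModel {σ : ℝ} (hσ : 0 < σ) (hph : pl ≤ ph) {μd μc : ℝ → ℝ}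
    {kd kc : ℝ → ℝ → ℝ} {fd fc : ℝ → Ω → ℝ} {εd εc : ℕ → Ω → ℝ} {Bd Bc : ℝ} {Hd Hc : Ω → ℝ}
    (hgd : IsGPSample P (Set.Icc pl ph) μd kd fd) (hgc : IsGPSample P (Set.Icc pl ph) μc kc fc)
    (hHd : IsEnvelope P (Set.Icc pl ph) fd Bd Hd) (hHc : IsEnvelope P (Set.Icc pl ph) fc Bc Hc)
    (hmod : IsIndependentNoisyModel P (Set.Icc pl ph) σ fd fc εd εc) :
    PathModel P σ (fun p => μd (clamp pl ph p)) (fun p => μc (clamp pl ph p))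
      (fun p q => kd (clamp pl ph p) (clamp pl ph q))
      (fun p q => kc (clamp pl ph p) (clamp pl ph q))
      pathEval pathEval (densePath pl ph fd) (densePath pl ph fc) εd εc := by
  let R : (Set.Icc pl ph → ℝ) → ℕ → ℝ := fun u n =>
    u ⟨clamp pl ph (TopologicalSpace.denseSeq ℝ n), clamp_mem hph _⟩
  have hR : Measurable R := measurable_pi_lambda _ fun n => measurable_pi_apply _
  exact
  { pos := hσ
    measurable_a := measurable_pathEval
    measurable_b := measurable_pathEval
    measurable_X := measurable_densePath hph hgd.measurable
    measurable_Y := measurable_densePath hph hgc.measurable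
    sample_a := hgd.comp_pathEval hph hHd
    sample_b := hgc.comp_pathEval hph hHc
    continuous_μd := hgd.continuous_mean hph hHd
    continuous_μc := hgc.continuous_mean hph hHc
    continuous_kd := hgd.continuous_kernel hph hHd
    continuous_kc := hgc.continuous_kernel hph hHc
    measurable_εd := hmod.measurable_demand
    measurable_εc := hmod.measurable_claims
    law_εd := hmod.law_demand
    law_εc := hmod.law_claims
    indep_noise := hmod.indep_noise
    indep_paths := hmod.indep_functions.comp hR hR
    indep_paths_noise := hmod.indep_functions_noise.comp
      (φ := fun u : (Set.Icc pl ph → ℝ) × (Set.Icc pl ph → ℝ) => (R u.1, R u.2))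
      ((hR.comp measurable_fst).prodMk (hR.comp measurable_snd)) measurable_id }

end Clamp

end GPPricing

namespace GPPricing

/-! ### The exploration weights -/

section Phi

variable {δ : ℝ}

lemma phi_eq (hδ : 0 < δ) {t : ℕ} (ht : 1 ≤ t) : phi δ t = phi δ 1 + 8 * Real.log t := by
  have h0 : (0 : ℝ) < t := by exact_mod_cast ht
  have e : 2 * (t : ℝ) ^ 2 * Real.pi ^ 2 / (3 * δ) = 2 * Real.pi ^ 2 / (3 * δ) * (t : ℝ) ^ 2 := by
    ring
  have hne : 2 * Real.pi ^ 2 / (3 * δ) ≠ 0 := by positivity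
  simp only [phi, Nat.cast_one, one_pow, mul_one, Real.log_one, mul_zero, add_zero]
  rw [e, Real.log_mul hne (by positivity), Real.log_pow]
  push_cast
  ring

lemma phi_one_pos (hδ : 0 < δ) (hδ1 : δ < 1) : 0 < phi δ 1 := by
  simp only [phi, Nat.cast_one, one_pow, mul_one, Real.log_one, mul_zero, add_zero]
  refine mul_pos two_pos (Real.log_pos ?_)
  rw [lt_div_iff₀ (by positivity)]
  nlinarith [Real.pi_gt_three]

lemma phi_mono (hδ : 0 < δ) {s t : ℕ} (hs : 1 ≤ s) (hst : s ≤ t) : phi δ s ≤ phi δ t := by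
  rw [phi_eq hδ hs, phi_eq hδ (hs.trans hst)]
  have h0 : (0 : ℝ) < s := by exact_mod_cast hs
  have := Real.log_le_log h0 (Nat.cast_le.2 hst)
  linarith

lemma phi_pos (hδ : 0 < δ) (hδ1 : δ < 1) {t : ℕ} (ht : 1 ≤ t) : 0 < phi δ t :=
  (phi_one_pos hδ hδ1).trans_le (phi_mono hδ le_rfl ht)

lemma phi_le (hδ : 0 < δ) (hδ1 : δ < 1) {t : ℕ} (ht : 1 ≤ t) :
    phi δ t ≤ (phi δ 1 / Real.log 2 + 8) * Real.log (t + 1) := by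
  have h1 : (1 : ℝ) ≤ t := by exact_mod_cast ht
  have hl2 : 0 < Real.log 2 := Real.log_pos one_lt_two
  have ha : Real.log 2 ≤ Real.log (t + 1) := Real.log_le_log two_pos (by linarith)
  have hb : Real.log t ≤ Real.log (t + 1) := Real.log_le_log (by linarith) (by linarith)
  have hc : phi δ 1 ≤ phi δ 1 / Real.log 2 * Real.log (t + 1) := by
    rw [div_mul_eq_mul_div, le_div_iff₀ hl2]
    exact mul_le_mul_of_nonneg_left ha (phi_one_pos hδ hδ1).le
  rw [phi_eq hδ ht, add_mul]
  linarith

/-- The exploration weight is chosen so that the failure probability decays like t⁻⁴: a union over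
t² grid prices still leaves a summable t⁻². -/
lemma exp_neg_phi (hδ : 0 < δ) {t : ℕ} (ht : 1 ≤ t) :
    Real.exp (-(Real.sqrt (phi δ t)) ^ 2 / 2) ≤ 3 * δ / (2 * Real.pi ^ 2 * (t : ℝ) ^ 4) := by
  have h0 : (0 : ℝ) < t := by exact_mod_cast ht
  have hle : phi δ t ≤ Real.sqrt (phi δ t) ^ 2 := by
    rcases le_total 0 (phi δ t) with h | h
    · rw [Real.sq_sqrt h]
    · exact h.trans (sq_nonneg _)
  have e : 3 * δ / (2 * Real.pi ^ 2 * (t : ℝ) ^ 4) = Real.exp (-phi δ t / 2) := by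
    have hA : 0 < 2 * (t : ℝ) ^ 2 * Real.pi ^ 2 / (3 * δ) := by positivity
    have : -phi δ t / 2
        = -Real.log (2 * (t : ℝ) ^ 2 * Real.pi ^ 2 / (3 * δ) * (t : ℝ) ^ 2) := by
      rw [Real.log_mul hA.ne' (by positivity), phi]
      ring
    rw [this, Real.exp_neg, Real.exp_log (by positivity)]
    field_simp
  rw [e]
  exact Real.exp_le_exp.2 (by linarith)

/-- The total failure probability of the confidence bounds in all rounds. -/
lemma hasSum_failure (δ : ℝ) :
    HasSum (fun n : ℕ => 2 * (((n : ℝ) + 1) ^ 2 + 1) *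
      (3 * δ / (2 * Real.pi ^ 2 * ((n : ℝ) + 1) ^ 4))) (δ * (1 / 2 + Real.pi ^ 2 / 30)) := by
  -- Round t = n + 1 involves 2(t² + 1) one-sided bounds: demand and claims, on the grid and at the
  -- charged price. The series splits into ζ(2) + ζ(4); the shift drops the index 0, where 1/0 is 0.
  have h2 := (hasSum_nat_add_iff' 1).2 hasSum_zeta_two
  have h4 := (hasSum_nat_add_iff' 1).2 hasSum_zeta_four
  have h := (h2.add h4).mul_left (3 * δ / Real.pi ^ 2)
  have hpi := Real.pi_pos
  have e1 : ∀ n : ℕ, 2 * (((n : ℝ) + 1) ^ 2 + 1) * (3 * δ / (2 * Real.pi ^ 2 * ((n : ℝ) + 1) ^ 4))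
      = 3 * δ / Real.pi ^ 2 * (1 / ((n + 1 : ℕ) : ℝ) ^ 2 + 1 / ((n + 1 : ℕ) : ℝ) ^ 4) := by
    intro n
    push_cast
    have : (n : ℝ) + 1 ≠ 0 := by positivity
    field_simp
  have e2 : δ * (1 / 2 + Real.pi ^ 2 / 30) = 3 * δ / Real.pi ^ 2 *
      (Real.pi ^ 2 / 6 - ∑ i ∈ Finset.range 1, 1 / (i : ℝ) ^ 2
        + (Real.pi ^ 4 / 90 - ∑ i ∈ Finset.range 1, 1 / (i : ℝ) ^ 4)) := by
    simp
    field_simp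
    ring
  simp only [e1]
  rw [e2]
  exact h

/-- The remaining δ/6 is kept for the random Lipschitz constant. -/
lemma failure_total_le {δ : ℝ} (hδ : 0 < δ) : δ * (1 / 2 + Real.pi ^ 2 / 30) ≤ 5 / 6 * δ := by
  have : Real.pi ^ 2 ≤ 10 := by nlinarith [Real.pi_lt_d2, Real.pi_pos]
  nlinarith

lemma sum_inv_sq_le (T : ℕ) : ∑ n ∈ Finset.range T, 1 / ((n : ℝ) + 1) ^ 2 ≤ 2 := by
  have h2 := (hasSum_nat_add_iff' 1).2 hasSum_zeta_two
  simp only [Finset.range_one, Finset.sum_singleton, Nat.cast_zero, ne_eq, OfNat.ofNat_ne_zero,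
    not_false_eq_true, zero_pow, div_zero, sub_zero] at h2
  push_cast at h2
  refine (sum_le_hasSum _ (fun n _ => by positivity) h2).trans ?_
  nlinarith [Real.pi_lt_d2, Real.pi_pos]

end Phi

/-! ### The regret of one round -/

/-- The left end points of the partition of `[a, b]` into `N` intervals of the same length. -/
noncomputable def gridPoint (a b : ℝ) (N i : ℕ) : ℝ := a + (b - a) * i / N

lemma gridPoint_mem {a b : ℝ} (hab : a ≤ b) {N i : ℕ} (hi : i < N) :
    gridPoint a b N i ∈ Set.Icc a b := by
  have hN : (0 : ℝ) < N := by exact_mod_cast (Nat.zero_le i).trans_lt hi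
  have hi' : (i : ℝ) ≤ N := by exact_mod_cast hi.le
  have hw := sub_nonneg.2 hab
  refine ⟨?_, ?_⟩
  · have : 0 ≤ (b - a) * i / N := by positivity
    rw [gridPoint]; linarith
  · have : (b - a) * i / N ≤ b - a := by
      rw [div_le_iff₀ hN]; exact mul_le_mul_of_nonneg_left hi' hw
    rw [gridPoint]; linarith

/-- Rounding down gives the cell of `q`; at the right end point this would give the index `N`, so
the last cell is taken there. -/
lemma exists_gridPoint_near {a b : ℝ} (hab : a < b) {N : ℕ} (hN : 0 < N) {q : ℝ}
    (hq : q ∈ Set.Icc a b) : ∃ i < N, |q - gridPoint a b N i| ≤ (b - a) / N := by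
  have hN' : (0 : ℝ) < N := by exact_mod_cast hN
  have hw := sub_pos.2 hab
  rcases eq_or_lt_of_le hq.2 with h | h
  · refine ⟨N - 1, by omega, le_of_eq ?_⟩
    rw [gridPoint, h, Nat.cast_sub hN, Nat.cast_one]
    have : b - (a + (b - a) * (N - 1) / N) = (b - a) / N := by field_simp; ring
    rw [this, abs_of_pos (by positivity)]
  · set s := (q - a) * N / (b - a) with hs
    have hs0 : 0 ≤ s := div_nonneg (mul_nonneg (sub_nonneg.2 hq.1) hN'.le) hw.le
    have hsN : s < N := by
      rw [hs, div_lt_iff₀ hw, mul_comm]; exact mul_lt_mul_of_pos_left (by linarith) hN'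
    refine ⟨⌊s⌋₊, (Nat.floor_lt hs0).2 hsN, ?_⟩
    have e : q - gridPoint a b N ⌊s⌋₊ = (b - a) / N * (s - ⌊s⌋₊) := by
      rw [gridPoint, hs]; field_simp; ring
    have h1 := Nat.floor_le hs0
    have h2 := Nat.lt_floor_add_one s
    rw [e, abs_of_nonneg (mul_nonneg (by positivity) (by linarith))]
    exact mul_le_of_le_one_right (by positivity) (by linarith)

/-- The total violation of the confidence bounds for the demand `f` and the claims `g` on the grid
and at the chosen price `p`. -/
noncomputable def boundExcess (pl ph : ℝ) (N : ℕ) (β : ℝ) (f g md mc sd sc : ℝ → ℝ) (p : ℝ) : ℝ :=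
  ∑ i ∈ Finset.range N,
      (ph * max (1 * (f (gridPoint pl ph N i) - md (gridPoint pl ph N i))
          - β * sd (gridPoint pl ph N i)) 0
        + max (-1 * (g (gridPoint pl ph N i) - mc (gridPoint pl ph N i))
          - β * sc (gridPoint pl ph N i)) 0)
    + (ph * max (-1 * (f p - md p) - β * sd p) 0 + max (1 * (g p - mc p) - β * sc p) 0)

lemma boundExcess_nonneg {pl ph : ℝ} (hph : 0 ≤ ph) (N : ℕ) (β : ℝ) (f g md mc sd sc : ℝ → ℝ)
    (p : ℝ) : 0 ≤ boundExcess pl ph N β f g md mc sd sc p := by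
  unfold boundExcess
  positivity

/-- Pass from `q` to a grid neighbour `z`. Up to the excess terms, the revenue at `z` is below its
upper confidence value, hence below that of `p`, which exceeds the revenue at `p` by at most two
widths. The positive parts make this hold on every path. -/
lemma revenue_sub_le_of_isMaxOn {pl ph : ℝ} (hpl : 0 < pl) (hph : pl < ph)
    {f g md mc sd sc : ℝ → ℝ} {β L : ℝ} {N : ℕ} (hN : 0 < N)
    (hL : 0 ≤ L) (hLip : ∀ p ∈ Set.Icc pl ph, ∀ q ∈ Set.Icc pl ph,
      |(p * f p - g p) - (q * f q - g q)| ≤ L * |p - q|) {p : ℝ} (hp : p ∈ Set.Icc pl ph)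
    (hmax : IsMaxOn (fun z => z * md z - mc z + β * (z * sd z + sc z)) (Set.Icc pl ph) p)
    {q : ℝ} (hq : q ∈ Set.Icc pl ph) :
    (q * f q - g q) - (p * f p - g p) ≤ L * ((ph - pl) / N)
      + boundExcess pl ph N β f g md mc sd sc p + 2 * β * (p * sd p + sc p) := by
  obtain ⟨i, hi, hqi⟩ := exists_gridPoint_near hph hN hq
  have hph0 : 0 < ph := hpl.trans hph
  set z := gridPoint pl ph N i with hz
  have hzm : z ∈ Set.Icc pl ph := gridPoint_mem hph.le hi
  have h1 := (abs_le.1 ((hLip q hq z hzm).trans (mul_le_mul_of_nonneg_left hqi hL))).2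
  have h2 : z * md z - mc z + β * (z * sd z + sc z) ≤ p * md p - mc p + β * (p * sd p + sc p) :=
    hmax hzm
  have hsum := Finset.single_le_sum (s := Finset.range N) (f := fun i =>
      (ph * max (1 * (f (gridPoint pl ph N i) - md (gridPoint pl ph N i))
          - β * sd (gridPoint pl ph N i)) 0
        + max (-1 * (g (gridPoint pl ph N i) - mc (gridPoint pl ph N i))
          - β * sc (gridPoint pl ph N i)) 0)) (fun j _ => by positivity) (Finset.mem_range.2 hi)
  simp only [← hz] at hsum
  unfold boundExcess
  have hbound : ∀ {y u : ℝ}, y ∈ Set.Icc pl ph → y * u ≤ ph * max u 0 := fun {y u} hy =>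
    (mul_le_mul_of_nonneg_left (le_max_left u 0) (hpl.le.trans hy.1)).trans
      (mul_le_mul_of_nonneg_right hy.2 (le_max_right _ _))
  have e1 := hbound (u := 1 * (f z - md z) - β * sd z) hzm
  have e2 := le_max_left (-1 * (g z - mc z) - β * sc z) 0
  have e3 := hbound (u := -1 * (f p - md p) - β * sd p) hp
  have e4 := le_max_left (1 * (g p - mc p) - β * sc p) 0
  linarith

/-! ### The sum of the confidence widths -/

lemma sum_sqrt_le_sqrt_mul_sum {v : ℕ → ℝ} (hv : ∀ n, 0 ≤ v n) (T : ℕ) :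
    ∑ n ∈ Finset.range T, Real.sqrt (v n)
      ≤ Real.sqrt (T * ∑ n ∈ Finset.range T, v n) := by
  refine Real.le_sqrt_of_sq_le ?_
  have h := sq_sum_le_card_mul_sum_sq (s := Finset.range T) (f := fun n => Real.sqrt (v n))
  simpa [Real.sq_sqrt (hv _)] using h

lemma maxInfoGain_congr {S : Set ℝ} {k k' : ℝ → ℝ → ℝ} (h : ∀ p ∈ S, ∀ q ∈ S, k p q = k' p q)
    (σ : ℝ) (T : ℕ) : maxInfoGain S k σ T = maxInfoGain S k' σ T := by
  unfold maxInfoGain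
  congr 1
  refine Set.image_congr fun A hA => ?_
  unfold infoGain
  congr 5
  ext p q
  exact h _ (hA.1 p.2) _ (hA.1 q.2)

end GPPricing

namespace GPPricing

open scoped ENNReal
open Filter Topology

/-! ### Tail bounds for the excess over the confidence bounds -/

section Tail

variable {Ω : Type*} {mΩ : MeasurableSpace Ω} {P : Measure Ω} {U V : Ω → ℝ} {ε η ε' η' : ℝ}

/-- `U` is positive with probability at most `ε`, and its positive part has mean at most `η`. -/
structure HasTailBounds (P : Measure Ω) (U : Ω → ℝ) (ε η : ℝ) : Prop where
  measurable : Measurable U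
  prob_le : P {ω | 0 < U ω} ≤ ENNReal.ofReal ε
  lintegral_le : ∫⁻ ω, ENNReal.ofReal (U ω) ∂P ≤ ENNReal.ofReal η

namespace HasTailBounds

lemma mono (h : HasTailBounds P U ε η) (hε : ε ≤ ε') (hη : η ≤ η') : HasTailBounds P U ε' η' where
  measurable := h.measurable
  prob_le := h.prob_le.trans (ENNReal.ofReal_le_ofReal hε)
  lintegral_le := h.lintegral_le.trans (ENNReal.ofReal_le_ofReal hη)

lemma add (h : HasTailBounds P U ε η) (h' : HasTailBounds P V ε' η') (hε : 0 ≤ ε) (hη : 0 ≤ η)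
    (hε' : 0 ≤ ε') (hη' : 0 ≤ η') : HasTailBounds P (fun ω => U ω + V ω) (ε + ε') (η + η') where
  measurable := h.measurable.add h'.measurable
  prob_le := by
    rw [ENNReal.ofReal_add hε hε']
    refine le_trans (measure_mono fun ω (hω : 0 < U ω + V ω) => ?_)
      ((measure_union_le _ _).trans (add_le_add h.prob_le h'.prob_le))
    by_contra hno
    simp only [Set.mem_union, Set.mem_ofPred_eq, not_or, not_lt] at hno
    linarith
  lintegral_le := by
    rw [ENNReal.ofReal_add hη hη']
    refine (lintegral_mono fun ω => ENNReal.ofReal_add_le).trans ?_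
    rw [lintegral_add_left h.measurable.ennreal_ofReal]
    exact add_le_add h.lintegral_le h'.lintegral_le

lemma const_mul_max (h : HasTailBounds P U ε η) {c : ℝ} (hc : 0 ≤ c) :
    HasTailBounds P (fun ω => c * max (U ω) 0) ε (c * η) where
  measurable := (h.measurable.max measurable_const).const_mul c
  prob_le := by
    refine le_trans (measure_mono fun ω (hω : 0 < c * max (U ω) 0) => ?_) h.prob_le
    by_contra hno
    have : U ω ≤ 0 := not_lt.1 hno
    rw [max_eq_right this, mul_zero] at hω
    exact lt_irrefl _ hω
  lintegral_le := by
    rw [ENNReal.ofReal_mul hc]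
    simp only [ENNReal.ofReal_mul hc, ENNReal.ofReal_max, ENNReal.ofReal_zero, max_eq_left zero_le]
    rw [lintegral_const_mul _ h.measurable.ennreal_ofReal]
    exact mul_le_mul_right h.lintegral_le _

lemma sum {W : ℕ → Ω → ℝ} (hε : 0 ≤ ε) (hη : 0 ≤ η) {N : ℕ}
    (h : ∀ i < N, HasTailBounds P (W i) ε η) :
    HasTailBounds P (fun ω => ∑ i ∈ Finset.range N, W i ω) (N * ε) (N * η) := by
  induction N with
  | zero => exact ⟨by simp, by simp, by simp⟩
  | succ N ih =>
    simp only [Finset.sum_range_succ]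
    refine ((ih fun i hi => h i (by omega)).add (h N (by omega)) (by positivity) (by positivity)
      hε hη).mono ?_ ?_ <;> push_cast <;> linarith

/-- A demand violation of weight `c` together with a claims violation. -/
lemma pair (hU : HasTailBounds P U ε η) (hV : HasTailBounds P V ε η) (hε : 0 ≤ ε) (hη : 0 ≤ η)
    {c : ℝ} (hc : 0 ≤ c) :
    HasTailBounds P (fun ω => c * max (U ω) 0 + max (V ω) 0) (2 * ε) ((c + 1) * η) := by
  have h := (hU.const_mul_max hc).add (hV.const_mul_max zero_le_one) hε (by positivity) hε
    (by positivity)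
  simp only [one_mul] at h
  exact h.mono (by linarith) (by linarith)

end HasTailBounds

lemma integrable_of_lintegral_ofReal_le (hU : Measurable U) (h0 : ∀ ω, 0 ≤ U ω)
    (h : ∫⁻ ω, ENNReal.ofReal (U ω) ∂P ≤ ENNReal.ofReal η) : Integrable U P :=
  ⟨hU.aestronglyMeasurable, (hasFiniteIntegral_iff_ofReal (Eventually.of_forall h0)).2
    (h.trans_lt ENNReal.ofReal_lt_top)⟩

lemma integral_le_of_lintegral_ofReal_le (hU : Measurable U) (h0 : ∀ ω, 0 ≤ U ω) (hη : 0 ≤ η)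
    (h : ∫⁻ ω, ENNReal.ofReal (U ω) ∂P ≤ ENNReal.ofReal η) : ∫ ω, U ω ∂P ≤ η := by
  rw [integral_eq_lintegral_of_nonneg_ae (Eventually.of_forall h0) hU.aestronglyMeasurable]
  exact ENNReal.toReal_le_of_le_ofReal hη h

end Tail

/-! ### The cumulative regret in a model given by measurable paths -/

lemma observations_castLE {E Θ : Type*} [Add E] (m : Θ → ℝ → E)
    (x : (n : ℕ) → (Fin n → E) → ℝ) (θ : Θ) (e : ℕ → E) {i n : ℕ} (hin : i ≤ n) (j : Fin i) :
    observations m x θ e n (Fin.castLE hin j) = observations m x θ e i j := by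
  induction n, hin using Nat.le_induction with
  | base => rfl
  | succ n hin ih =>
    rw [← ih, observations]
    exact Fin.snoc_castSucc (α := fun _ => E) _ _ (Fin.castLE hin j)

lemma chosenPoints_observations {E Θ : Type*} [Add E] (m : Θ → ℝ → E)
    (x : (n : ℕ) → (Fin n → E) → ℝ) (θ : Θ) (e : ℕ → E) (n : ℕ) :
    chosenPoints x n (observations m x θ e n)
      = fun i : Fin n => x i (observations m x θ e i) := by
  funext i
  rw [chosenPoints]
  congr 1
  funext j
  exact observations_castLE m x θ e i.2.le j

/-- The violation of the confidence bounds in round `n + 1` after the observations `y`, for the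
demand function `f` and the claims function `g`. -/
noncomputable def roundExcess (pl ph : ℝ) (μd μc : ℝ → ℝ) (kd kc : ℝ → ℝ → ℝ) (σ δ : ℝ)
    (x : (n : ℕ) → (Fin n → ℝ × ℝ) → ℝ) (n : ℕ) (f g : ℝ → ℝ) (y : Fin n → ℝ × ℝ) : ℝ :=
  boundExcess pl ph ((n + 1) ^ 2) (Real.sqrt (phi δ (n + 1))) f g
    (postMean μd kd σ (chosenPoints x n y) fun i => (y i).1)
    (postMean μc kc σ (chosenPoints x n y) fun i => (y i).2)
    (postStd kd σ (chosenPoints x n y)) (postStd kc σ (chosenPoints x n y)) (x n y)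

/-- The upper confidence function of round `n + 1` after the observations `y`. -/
noncomputable def roundUcb (μd μc : ℝ → ℝ) (kd kc : ℝ → ℝ → ℝ) (σ δ : ℝ)
    (x : (n : ℕ) → (Fin n → ℝ × ℝ) → ℝ) (n : ℕ) (y : Fin n → ℝ × ℝ) (z : ℝ) : ℝ :=
  z * postMean μd kd σ (chosenPoints x n y) (fun i => (y i).1) z
    - postMean μc kc σ (chosenPoints x n y) (fun i => (y i).2) z
    + Real.sqrt (phi δ (n + 1)) * (z * postStd kd σ (chosenPoints x n y) z
        + postStd kc σ (chosenPoints x n y) z)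

/-- The factor of the sum of the confidence widths. -/
noncomputable def widthConst (ph σ δ B : ℝ) : ℝ :=
  2 * (ph + 1) * Real.sqrt ((phi δ 1 / Real.log 2 + 8) * (2 * (σ ^ 2 + B)))

/-- Both standard deviations are at most √v for the posterior variance v of kd + kc. Monotonicity of
φ, Cauchy-Schwarz, the information bound on the sum of v and the logarithmic growth of φ give the
claim. -/
lemma sum_width_le {pl ph : ℝ} (hpl : 0 < pl) (hph : pl < ph) {kd kc : ℝ → ℝ → ℝ} {σ δ B : ℝ}
    (hσ : 0 < σ) (hδ : 0 < δ) (hδ1 : δ < 1) (hkd : IsPSDKernel kd) (hkc : IsPSDKernel kc)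
    (hcd : Continuous (Function.uncurry kd)) (hcc : Continuous (Function.uncurry kc))
    (hB : ∀ p, kd p p + kc p p ≤ B) {p : ℕ → ℝ} (hp : ∀ n, p n ∈ Set.Icc pl ph) (T : ℕ)
    (hT : 1 ≤ T) :
    ∑ n ∈ Finset.range T, 2 * Real.sqrt (phi δ (n + 1)) *
        (p n * postStd kd σ (fun j : Fin n => p j) (p n)
          + postStd kc σ (fun j : Fin n => p j) (p n))
      ≤ widthConst ph σ δ B * Real.sqrt
        (maxInfoGain (Set.Icc pl ph) (fun p q => kd p q + kc p q) σ T * T * Real.log (T + 1)) := by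
  have hph0 : 0 < ph := hpl.trans hph
  set v : ℕ → ℝ := fun n => postCov (fun p q => kd p q + kc p q) σ (fun j : Fin n => p j) (p n) (p n)
  have hv0 : ∀ n, 0 ≤ v n := fun n => (hkd.add hkc).postCov_nonneg hσ _ _
  have hd : ∀ n, postStd kd σ (fun j : Fin n => p j) (p n) ≤ Real.sqrt (v n) := fun n =>
    Real.sqrt_le_sqrt (hkd.postCov_le_add hkc hσ _ _)
  have hc : ∀ n, postStd kc σ (fun j : Fin n => p j) (p n) ≤ Real.sqrt (v n) := fun n =>
    Real.sqrt_le_sqrt (by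
      have := hkc.postCov_le_add hkd hσ (fun j : Fin n => p j) (p n)
      simpa only [add_comm (kc _ _)] using this)
  have hterm : ∀ n ∈ Finset.range T, 2 * Real.sqrt (phi δ (n + 1)) *
        (p n * postStd kd σ (fun j : Fin n => p j) (p n)
          + postStd kc σ (fun j : Fin n => p j) (p n))
      ≤ 2 * (ph + 1) * Real.sqrt (phi δ T) * Real.sqrt (v n) := by
    intro n hn
    have hn' : n + 1 ≤ T := Finset.mem_range.1 hn
    have h1 : Real.sqrt (phi δ (n + 1)) ≤ Real.sqrt (phi δ T) :=
      Real.sqrt_le_sqrt (phi_mono hδ (by omega) hn')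
    have h2 : p n * postStd kd σ (fun j : Fin n => p j) (p n)
        ≤ ph * Real.sqrt (v n) :=
      mul_le_mul (hp n).2 (hd n) (Real.sqrt_nonneg _) hph0.le
    have h3 : p n * postStd kd σ (fun j : Fin n => p j) (p n)
          + postStd kc σ (fun j : Fin n => p j) (p n) ≤ (ph + 1) * Real.sqrt (v n) := by
      linarith [hc n]
    calc _ ≤ 2 * Real.sqrt (phi δ (n + 1)) * ((ph + 1) * Real.sqrt (v n)) :=
          mul_le_mul_of_nonneg_left h3 (by positivity)
      _ ≤ 2 * Real.sqrt (phi δ T) * ((ph + 1) * Real.sqrt (v n)) := by gcongr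
      _ = _ := by ring
  refine (Finset.sum_le_sum hterm).trans ?_
  rw [← Finset.mul_sum, widthConst]
  set γ := maxInfoGain (Set.Icc pl ph) (fun p q => kd p q + kc p q) σ T
  have hsum : ∑ n ∈ Finset.range T, v n ≤ 2 * (σ ^ 2 + B) * γ :=
    (hkd.add hkc).sum_postCov_le hσ hB (hcd.add hcc) hph p hp T
  have hphi := phi_le hδ hδ1 hT
  have hB0 : 0 ≤ B := ((hkd.add hkc).self_nonneg 0).trans (hB 0)
  have hC0 : 0 ≤ (phi δ 1 / Real.log 2 + 8) * (2 * (σ ^ 2 + B)) := by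
    have := phi_one_pos hδ hδ1
    have := Real.log_pos one_lt_two
    positivity
  rw [mul_assoc, mul_assoc _ (Real.sqrt _) (Real.sqrt _)]
  refine mul_le_mul_of_nonneg_left ?_ (by positivity)
  rw [← Real.sqrt_mul hC0]
  calc Real.sqrt (phi δ T) * ∑ n ∈ Finset.range T, Real.sqrt (v n)
      ≤ Real.sqrt (phi δ T) * Real.sqrt (T * ∑ n ∈ Finset.range T, v n) :=
        mul_le_mul_of_nonneg_left (sum_sqrt_le_sqrt_mul_sum hv0 T) (Real.sqrt_nonneg _)
    _ = Real.sqrt (phi δ T * (T * ∑ n ∈ Finset.range T, v n)) :=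
        (Real.sqrt_mul (phi_pos hδ hδ1 hT).le _).symm
    _ ≤ _ := by
        refine Real.sqrt_le_sqrt ?_
        have hs0 : 0 ≤ ∑ n ∈ Finset.range T, v n := Finset.sum_nonneg fun n _ => hv0 n
        have hp0 := (phi_pos hδ hδ1 hT).le
        calc _ ≤ (phi δ 1 / Real.log 2 + 8) * Real.log (T + 1) * (T * (2 * (σ ^ 2 + B) * γ)) := by
              refine mul_le_mul hphi (mul_le_mul_of_nonneg_left hsum (Nat.cast_nonneg _))
                (by positivity) (hp0.trans hphi)
          _ = _ := by ring

end GPPricing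

namespace GPPricing

open scoped ENNReal
open Filter Topology

/-! ### Violations of the confidence bounds and the pathwise regret bound. -/

section ModelRegret

variable {U V Ω : Type*} [MeasurableSpace U] [MeasurableSpace V] {mΩ : MeasurableSpace Ω}
  {P : Measure Ω} [IsProbabilityMeasure P] {σ : ℝ} {μd μc : ℝ → ℝ} {kd kc : ℝ → ℝ → ℝ}
  {a : U → ℝ → ℝ} {b : V → ℝ → ℝ} {X : Ω → U} {Y : Ω → V} {εd εc : ℕ → Ω → ℝ}

namespace PathModel

lemma hasTailBounds_demand (h : PathModel P σ μd μc kd kc a b X Y εd εc)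
    {x : (n : ℕ) → (Fin n → ℝ × ℝ) → ℝ} (hx : ∀ n, Measurable (x n)) (n : ℕ)
    {q : (Fin n → ℝ × ℝ) → ℝ} (hq : Measurable q) {B : ℝ} (hB : ∀ p, kd p p ≤ B) {c : ℝ}
    (hc : 0 < c) {r : ℝ} (hr : r ^ 2 = 1) :
    HasTailBounds P (fun ω => r * (a (X ω) (q (obs a b X Y εd εc x n ω)) - postMean μd kd σ
          (chosenPoints x n (obs a b X Y εd εc x n ω)) (fun i => (obs a b X Y εd εc x n ω i).1)
          (q (obs a b X Y εd εc x n ω)))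
        - c * postStd kd σ (chosenPoints x n (obs a b X Y εd εc x n ω))
          (q (obs a b X Y εd εc x n ω)))
      (Real.exp (-c ^ 2 / 2)) (Real.sqrt B * Real.exp (-c ^ 2 / 2) / c) where
  measurable := by
    have hk := h.sample_a.isPSDKernel
    have ho := h.measurable_obs hx n
    have hpts := measurable_chosenPoints hx n
    have h1 : Measurable fun ω => a (X ω) (q (obs a b X Y εd εc x n ω)) :=
      h.measurable_a.comp (h.measurable_X.prodMk (hq.comp ho))
    have h2 := ((hk.continuous_postMean h.pos h.continuous_kd h.continuous_μd n).measurable.comp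
      (hpts.prodMk ((by fun_prop : Measurable fun (y : Fin n → ℝ × ℝ) i =>
        (y i).1).prodMk hq))).comp ho
    have h3 := ((hk.continuous_postCov h.pos h.continuous_kd n).measurable.comp
      (hpts.prodMk hq)).comp ho
    exact ((h1.sub h2).const_mul r).sub (h3.sqrt.const_mul c)
  prob_le := by
    simp only [sub_pos]
    exact (h.demand_bounds hx n hq hB hc hr).1
  lintegral_le := (h.demand_bounds hx n hq hB hc hr).2

lemma hasTailBounds_claims (h : PathModel P σ μd μc kd kc a b X Y εd εc)
    {x : (n : ℕ) → (Fin n → ℝ × ℝ) → ℝ} (hx : ∀ n, Measurable (x n)) (n : ℕ)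
    {q : (Fin n → ℝ × ℝ) → ℝ} (hq : Measurable q) {B : ℝ} (hB : ∀ p, kc p p ≤ B) {c : ℝ}
    (hc : 0 < c) {r : ℝ} (hr : r ^ 2 = 1) :
    HasTailBounds P (fun ω => r * (b (Y ω) (q (obs a b X Y εd εc x n ω)) - postMean μc kc σ
          (chosenPoints x n (obs a b X Y εd εc x n ω)) (fun i => (obs a b X Y εd εc x n ω i).2)
          (q (obs a b X Y εd εc x n ω)))
        - c * postStd kc σ (chosenPoints x n (obs a b X Y εd εc x n ω))
          (q (obs a b X Y εd εc x n ω)))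
      (Real.exp (-c ^ 2 / 2)) (Real.sqrt B * Real.exp (-c ^ 2 / 2) / c) where
  measurable := by
    have hk := h.sample_b.isPSDKernel
    have ho := h.measurable_obs hx n
    have hpts := measurable_chosenPoints hx n
    have h1 : Measurable fun ω => b (Y ω) (q (obs a b X Y εd εc x n ω)) :=
      h.measurable_b.comp (h.measurable_Y.prodMk (hq.comp ho))
    have h2 := ((hk.continuous_postMean h.pos h.continuous_kc h.continuous_μc n).measurable.comp
      (hpts.prodMk ((by fun_prop : Measurable fun (y : Fin n → ℝ × ℝ) i =>
        (y i).2).prodMk hq))).comp ho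
    have h3 := ((hk.continuous_postCov h.pos h.continuous_kc n).measurable.comp
      (hpts.prodMk hq)).comp ho
    exact ((h1.sub h2).const_mul r).sub (h3.sqrt.const_mul c)
  prob_le := by
    simp only [sub_pos]
    exact (h.claims_bounds hx n hq hB hc hr).1
  lintegral_le := (h.claims_bounds hx n hq hB hc hr).2

/-- The failure probability allowed in round `n + 1`. -/
noncomputable def failure (δ : ℝ) (n : ℕ) : ℝ :=
  2 * (((n : ℝ) + 1) ^ 2 + 1) * (3 * δ / (2 * Real.pi ^ 2 * ((n : ℝ) + 1) ^ 4))

lemma failure_nonneg {δ : ℝ} (hδ : 0 < δ) (n : ℕ) : 0 ≤ failure δ n := by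
  unfold failure; positivity

/-- A union bound over the (n+1)² grid prices and the charged price, each carrying one demand and
one claims bound. The factor 1/√φ_{n+1} in the mean excess is bounded by its value in round one. -/
theorem hasTailBounds_roundExcess (h : PathModel P σ μd μc kd kc a b X Y εd εc)
    {pl ph : ℝ} (hph0 : 0 ≤ ph) {δ : ℝ} (hδ : 0 < δ) (hδ1 : δ < 1)
    {x : (n : ℕ) → (Fin n → ℝ × ℝ) → ℝ} (hx : ∀ n, Measurable (x n)) {B : ℝ}
    (hBd : ∀ p, kd p p ≤ B) (hBc : ∀ p, kc p p ≤ B) (n : ℕ) :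
    HasTailBounds P (fun ω => roundExcess pl ph μd μc kd kc σ δ x n (a (X ω)) (b (Y ω))
        (obs a b X Y εd εc x n ω)) (failure δ n)
      ((ph + 1) * Real.sqrt B / Real.sqrt (phi δ 1) * failure δ n) := by
  set c := Real.sqrt (phi δ (n + 1)) with hcdef
  have hc1 : 0 < Real.sqrt (phi δ 1) := Real.sqrt_pos.2 (phi_one_pos hδ hδ1)
  have hc1c : Real.sqrt (phi δ 1) ≤ c := Real.sqrt_le_sqrt (phi_mono hδ le_rfl (by omega))
  have hc : 0 < c := hc1.trans_le hc1c
  set e := Real.exp (-c ^ 2 / 2) with he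
  have hee : e ≤ 3 * δ / (2 * Real.pi ^ 2 * ((n : ℝ) + 1) ^ 4) := by
    have := exp_neg_phi hδ (t := n + 1) (by omega)
    push_cast at this
    exact this
  have he0 : 0 ≤ e := (Real.exp_pos _).le
  set η := Real.sqrt B * e / c with hη
  have hη0 : 0 ≤ η := by positivity
  have m1 : (-1 : ℝ) ^ 2 = 1 := by norm_num
  have hgrid := HasTailBounds.sum (N := (n + 1) ^ 2) (ε := 2 * e) (η := (ph + 1) * η)
    (by positivity) (by positivity) fun i _ =>
    (h.hasTailBounds_demand hx n (q := fun _ => gridPoint pl ph ((n + 1) ^ 2) i) measurable_const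
      hBd hc (one_pow 2)).pair
    (h.hasTailBounds_claims hx n (q := fun _ => gridPoint pl ph ((n + 1) ^ 2) i) measurable_const
      hBc hc m1) he0 hη0 hph0
  have hlast := (h.hasTailBounds_demand hx n (hx n) hBd hc m1).pair
    (h.hasTailBounds_claims hx n (hx n) hBc hc (one_pow 2)) he0 hη0 hph0
  have hall := hgrid.add hlast (by positivity) (by positivity) (by positivity) (by positivity)
  refine HasTailBounds.mono hall ?_ ?_
  · push_cast
    have : 2 * (((n : ℝ) + 1) ^ 2 + 1) * e ≤ failure δ n :=
      mul_le_mul_of_nonneg_left hee (by positivity)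
    linarith
  · push_cast
    have h1 : (((n : ℝ) + 1) ^ 2 + 1) * e ≤ failure δ n := by
      have : 2 * (((n : ℝ) + 1) ^ 2 + 1) * e ≤ failure δ n :=
        mul_le_mul_of_nonneg_left hee (by positivity)
      have h0 : 0 ≤ (((n : ℝ) + 1) ^ 2 + 1) * e := by positivity
      linarith
    calc _ = (ph + 1) * Real.sqrt B / c * ((((n : ℝ) + 1) ^ 2 + 1) * e) := by rw [hη]; ring
      _ ≤ (ph + 1) * Real.sqrt B / Real.sqrt (phi δ 1) * failure δ n := by
        refine mul_le_mul ?_ h1 (by positivity) (by positivity)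
        exact div_le_div_of_nonneg_left (by positivity) hc1 hc1c

/-- With probability at least `1 - 5 δ / 6`, all the confidence bounds hold. -/
lemma prob_roundExcess_pos_le (h : PathModel P σ μd μc kd kc a b X Y εd εc)
    {pl ph : ℝ} (hph0 : 0 ≤ ph) {δ : ℝ} (hδ : 0 < δ) (hδ1 : δ < 1)
    {x : (n : ℕ) → (Fin n → ℝ × ℝ) → ℝ} (hx : ∀ n, Measurable (x n)) {B : ℝ}
    (hBd : ∀ p, kd p p ≤ B) (hBc : ∀ p, kc p p ≤ B) :
    P {ω | ∃ n, 0 < roundExcess pl ph μd μc kd kc σ δ x n (a (X ω)) (b (Y ω))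
        (obs a b X Y εd εc x n ω)} ≤ ENNReal.ofReal (5 / 6 * δ) := by
  have hs := hasSum_failure δ
  rw [Set.ofPred_exists]
  refine (measure_iUnion_le _).trans ((ENNReal.tsum_le_tsum fun n =>
    (h.hasTailBounds_roundExcess hph0 hδ hδ1 hx hBd hBc n).prob_le).trans ?_)
  rw [← ENNReal.ofReal_tsum_of_nonneg (failure_nonneg hδ) hs.summable]
  exact ENNReal.ofReal_le_ofReal (hs.tsum_eq.trans_le (failure_total_le hδ))

lemma sum_integral_roundExcess_le (h : PathModel P σ μd μc kd kc a b X Y εd εc)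
    {pl ph : ℝ} (hph0 : 0 ≤ ph) {δ : ℝ} (hδ : 0 < δ) (hδ1 : δ < 1)
    {x : (n : ℕ) → (Fin n → ℝ × ℝ) → ℝ} (hx : ∀ n, Measurable (x n)) {B : ℝ}
    (hBd : ∀ p, kd p p ≤ B) (hBc : ∀ p, kc p p ≤ B) (T : ℕ) :
    ∑ n ∈ Finset.range T, ∫ ω, roundExcess pl ph μd μc kd kc σ δ x n (a (X ω)) (b (Y ω))
        (obs a b X Y εd εc x n ω) ∂P ≤ (ph + 1) * Real.sqrt B / Real.sqrt (phi δ 1) := by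
  have hs := hasSum_failure δ
  have hK : 0 ≤ (ph + 1) * Real.sqrt B / Real.sqrt (phi δ 1) := by positivity
  have hf : ∑ n ∈ Finset.range T, failure δ n ≤ 1 :=
    (sum_le_hasSum _ (fun n _ => failure_nonneg hδ n) hs).trans
      ((failure_total_le hδ).trans (by linarith))
  refine (Finset.sum_le_sum fun n _ => ?_).trans
    ((Finset.mul_sum _ _ _).symm.trans_le (mul_le_of_le_one_right hK hf))
  have ht := h.hasTailBounds_roundExcess (pl := pl) hph0 hδ hδ1 hx hBd hBc n
  exact integral_le_of_lintegral_ofReal_le ht.measurable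
    (fun _ => boundExcess_nonneg hph0 _ _ _ _ _ _ _ _ _)
    (mul_nonneg hK (failure_nonneg hδ n)) ht.lintegral_le

lemma integrable_roundExcess (h : PathModel P σ μd μc kd kc a b X Y εd εc)
    {pl ph : ℝ} (hph0 : 0 ≤ ph) {δ : ℝ} (hδ : 0 < δ) (hδ1 : δ < 1)
    {x : (n : ℕ) → (Fin n → ℝ × ℝ) → ℝ} (hx : ∀ n, Measurable (x n)) {B : ℝ}
    (hBd : ∀ p, kd p p ≤ B) (hBc : ∀ p, kc p p ≤ B) (n : ℕ) :
    Integrable (fun ω => roundExcess pl ph μd μc kd kc σ δ x n (a (X ω)) (b (Y ω))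
        (obs a b X Y εd εc x n ω)) P :=
  have ht := h.hasTailBounds_roundExcess (pl := pl) hph0 hδ hδ1 hx hBd hBc n
  integrable_of_lintegral_ofReal_le ht.measurable
    (fun _ => boundExcess_nonneg hph0 _ _ _ _ _ _ _ _ _) ht.lintegral_le

/-- The revenue function of the model. -/
def rev (a : U → ℝ → ℝ) (b : V → ℝ → ℝ) (X : Ω → U) (Y : Ω → V) (ω : Ω) (p : ℝ) : ℝ :=
  p * a (X ω) p - b (Y ω) p

/-- The cumulative regret over `T` rounds when the prices are chosen by `x`. -/
noncomputable def cumRegret (S : Set ℝ) (a : U → ℝ → ℝ) (b : V → ℝ → ℝ) (X : Ω → U) (Y : Ω → V)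
    (εd εc : ℕ → Ω → ℝ) (x : (n : ℕ) → (Fin n → ℝ × ℝ) → ℝ) (T : ℕ) (ω : Ω) : ℝ :=
  ∑ n ∈ Finset.range T,
    (sSup (rev a b X Y ω '' S) - rev a b X Y ω (x n (obs a b X Y εd εc x n ω)))

/-- With (n+1)² grid prices the discretisation errors sum to at most 2(ph - pl)L, since Σ 1/t² ≤ 2.
-/
theorem cumRegret_le (h : PathModel P σ μd μc kd kc a b X Y εd εc)
    {pl ph : ℝ} (hpl : 0 < pl) (hph : pl < ph) {δ : ℝ} (hδ : 0 < δ) (hδ1 : δ < 1)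
    {x : (n : ℕ) → (Fin n → ℝ × ℝ) → ℝ} (hxS : ∀ n y, x n y ∈ Set.Icc pl ph)
    (hmax : ∀ n y, IsMaxOn (roundUcb μd μc kd kc σ δ x n y) (Set.Icc pl ph) (x n y)) {B : ℝ}
    (hB : ∀ p, kd p p + kc p p ≤ B) {L : ℝ} (hL : 0 ≤ L) {ω : Ω}
    (hLip : ∀ p ∈ Set.Icc pl ph, ∀ q ∈ Set.Icc pl ph,
      |rev a b X Y ω p - rev a b X Y ω q| ≤ L * |p - q|) {T : ℕ} (hT : 1 ≤ T) :
    cumRegret (Set.Icc pl ph) a b X Y εd εc x T ω ≤ 2 * (ph - pl) * L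
      + ∑ n ∈ Finset.range T, roundExcess pl ph μd μc kd kc σ δ x n (a (X ω)) (b (Y ω))
          (obs a b X Y εd εc x n ω)
      + widthConst ph σ δ B * Real.sqrt
        (maxInfoGain (Set.Icc pl ph) (fun p q => kd p q + kc p q) σ T * T * Real.log (T + 1)) := by
  set p : ℕ → ℝ := fun n => x n (obs a b X Y εd εc x n ω) with hp
  have hpts : ∀ n, chosenPoints x n (obs a b X Y εd εc x n ω) = fun j : Fin n => p j := fun n =>
    chosenPoints_observations _ x _ _ n
  have hround : ∀ n, sSup (rev a b X Y ω '' Set.Icc pl ph) - rev a b X Y ω (p n)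
      ≤ (ph - pl) * L * (1 / ((n : ℝ) + 1) ^ 2)
        + roundExcess pl ph μd μc kd kc σ δ x n (a (X ω)) (b (Y ω)) (obs a b X Y εd εc x n ω)
        + 2 * Real.sqrt (phi δ (n + 1)) * (p n * postStd kd σ (fun j : Fin n => p j) (p n)
          + postStd kc σ (fun j : Fin n => p j) (p n)) := by
    intro n
    rw [sub_le_iff_le_add]
    refine csSup_le ((Set.nonempty_Icc.2 hph.le).image _) ?_
    rintro _ ⟨q, hq, rfl⟩
    have := revenue_sub_le_of_isMaxOn (N := (n + 1) ^ 2) hpl hph (by positivity) hL hLip (hxS n _)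
      (hmax n (obs a b X Y εd εc x n ω)) hq
    rw [← sub_le_iff_le_add]
    rw [← hpts n]
    refine this.trans (le_of_eq ?_)
    push_cast
    rw [roundExcess]
    ring
  refine (Finset.sum_le_sum fun n _ => hround n).trans ?_
  rw [Finset.sum_add_distrib, Finset.sum_add_distrib, ← Finset.mul_sum]
  refine add_le_add (add_le_add_left ?_ _) ?_
  · have := mul_le_mul_of_nonneg_left (sum_inv_sq_le T)
      (mul_nonneg (sub_nonneg.2 hph.le) hL)
    linarith
  · exact sum_width_le hpl hph h.pos hδ hδ1 h.sample_a.isPSDKernel h.sample_b.isPSDKernel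
      h.continuous_kd h.continuous_kc hB (fun n => hxS n _) T hT

end PathModel

end ModelRegret

end GPPricing

namespace GPPricing

open scoped ENNReal
open Filter Topology

/-! ### Regret bounds in a model given by measurable paths -/

/-- Rewriting the optimal revenue as a countable supremum makes the regret almost everywhere
measurable. -/
lemma sSup_image_Icc_eq_iSup {pl ph : ℝ} (hph : pl ≤ ph) {r : ℝ → ℝ}
    (hr : ContinuousOn r (Set.Icc pl ph)) :
    sSup (r '' Set.Icc pl ph) = ⨆ n, r (clamp pl ph (TopologicalSpace.denseSeq ℝ n)) := by
  have hb : BddAbove (r '' Set.Icc pl ph) := isCompact_Icc.bddAbove_image hr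
  have hmem : ∀ p, r (clamp pl ph p) ∈ r '' Set.Icc pl ph := fun p =>
    Set.mem_image_of_mem r (clamp_mem hph p)
  have hb' : BddAbove (Set.range fun n => r (clamp pl ph (TopologicalSpace.denseSeq ℝ n))) :=
    hb.mono (Set.range_subset_iff.2 fun n => hmem _)
  refine le_antisymm (csSup_le ((Set.nonempty_Icc.2 hph).image r) ?_)
    (ciSup_le fun n => le_csSup hb (hmem _))
  rintro _ ⟨q, hq, rfl⟩
  have hc : Continuous fun p => r (clamp pl ph p) :=
    hr.comp_continuous (continuous_clamp pl ph) (clamp_mem hph)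
  have := (TopologicalSpace.denseRange_denseSeq ℝ).induction_on
    (p := fun p => r (clamp pl ph p) ≤ ⨆ n, r (clamp pl ph (TopologicalSpace.denseSeq ℝ n))) q
    (isClosed_le hc continuous_const) fun n =>
      le_ciSup (f := fun n => r (clamp pl ph (TopologicalSpace.denseSeq ℝ n))) hb' n
  rwa [clamp_of_mem hq] at this

lemma continuousOn_of_abs_sub_le {S : Set ℝ} {r : ℝ → ℝ} {L : ℝ} (hL : 0 ≤ L)
    (h : ∀ p ∈ S, ∀ q ∈ S, |r p - r q| ≤ L * |p - q|) : ContinuousOn r S := by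
  refine (LipschitzOnWith.of_dist_le_mul (K := L.toNNReal) fun p hp q hq => ?_).continuousOn
  rw [Real.dist_eq, Real.dist_eq, Real.coe_toNNReal _ hL]
  exact h p hp q hq

section ModelRegret

variable {U V Ω : Type*} [MeasurableSpace U] [MeasurableSpace V] {mΩ : MeasurableSpace Ω}
  {P : Measure Ω} [IsProbabilityMeasure P] {σ : ℝ} {μd μc : ℝ → ℝ} {kd kc : ℝ → ℝ → ℝ}
  {a : U → ℝ → ℝ} {b : V → ℝ → ℝ} {X : Ω → U} {Y : Ω → V} {εd εc : ℕ → Ω → ℝ}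

namespace PathModel

omit [IsProbabilityMeasure P] in
lemma measurable_rev (h : PathModel P σ μd μc kd kc a b X Y εd εc) {p : Ω → ℝ}
    (hp : Measurable p) : Measurable fun ω => rev a b X Y ω (p ω) :=
  (hp.mul (h.measurable_a.comp (h.measurable_X.prodMk hp))).sub
    (h.measurable_b.comp (h.measurable_Y.prodMk hp))

lemma aestronglyMeasurable_cumRegret (h : PathModel P σ μd μc kd kc a b X Y εd εc)
    {pl ph : ℝ} (hph : pl ≤ ph) {x : (n : ℕ) → (Fin n → ℝ × ℝ) → ℝ} (hx : ∀ n, Measurable (x n))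
    (hc : ∀ᵐ ω ∂P, ContinuousOn (rev a b X Y ω) (Set.Icc pl ph)) (T : ℕ) :
    AEStronglyMeasurable (cumRegret (Set.Icc pl ph) a b X Y εd εc x T) P := by
  have hm : Measurable fun ω => ∑ n ∈ Finset.range T,
      ((⨆ n, rev a b X Y ω (clamp pl ph (TopologicalSpace.denseSeq ℝ n)))
        - rev a b X Y ω (x n (obs a b X Y εd εc x n ω))) :=
    Finset.measurable_fun_sum _ fun n _ =>
      (Measurable.iSup fun n => h.measurable_rev measurable_const).sub
        (h.measurable_rev ((hx n).comp (h.measurable_obs hx n)))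
  refine hm.aestronglyMeasurable.congr ?_
  filter_upwards [hc] with ω hω
  rw [cumRegret, sSup_image_Icc_eq_iSup hph hω]

omit [MeasurableSpace U] [MeasurableSpace V] in
lemma cumRegret_nonneg {pl ph : ℝ} {x : (n : ℕ) → (Fin n → ℝ × ℝ) → ℝ}
    (hxS : ∀ n y, x n y ∈ Set.Icc pl ph) {ω : Ω}
    (hc : ContinuousOn (rev a b X Y ω) (Set.Icc pl ph)) (T : ℕ) :
    0 ≤ cumRegret (Set.Icc pl ph) a b X Y εd εc x T ω :=
  Finset.sum_nonneg fun n _ => sub_nonneg.2 <|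
    le_csSup (isCompact_Icc.bddAbove_image hc) (Set.mem_image_of_mem _ (hxS n _))

theorem cumRegret_bounds (h : PathModel P σ μd μc kd kc a b X Y εd εc)
    {pl ph : ℝ} (hpl : 0 < pl) (hph : pl < ph) {δ : ℝ} (hδ : 0 < δ) (hδ1 : δ < 1)
    {x : (n : ℕ) → (Fin n → ℝ × ℝ) → ℝ} (hx : ∀ n, Measurable (x n))
    (hxS : ∀ n y, x n y ∈ Set.Icc pl ph)
    (hmax : ∀ n y, IsMaxOn (roundUcb μd μc kd kc σ δ x n y) (Set.Icc pl ph) (x n y)) {B : ℝ}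
    (hBd : ∀ p, kd p p ≤ B) (hBc : ∀ p, kc p p ≤ B) {L : Ω → ℝ} (hL : ∀ ω, 0 ≤ L ω)
    (hLip : ∀ᵐ ω ∂P, ∀ p ∈ Set.Icc pl ph, ∀ q ∈ Set.Icc pl ph,
      |rev a b X Y ω p - rev a b X Y ω q| ≤ L ω * |p - q|) (hLi : Integrable L P) {M : ℝ}
    (hM : 0 < M) (hLM : ∫ ω, L ω ∂P ≤ M) :
    P {ω | ¬ ∀ T : ℕ, 1 ≤ T → cumRegret (Set.Icc pl ph) a b X Y εd εc x T ω
        ≤ 2 * (ph - pl) * (6 * M / δ) + widthConst ph σ δ (2 * B) * Real.sqrt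
        (maxInfoGain (Set.Icc pl ph) (fun p q => kd p q + kc p q) σ T * T * Real.log (T + 1))}
      ≤ ENNReal.ofReal δ ∧
    ∀ T : ℕ, 1 ≤ T → Integrable (cumRegret (Set.Icc pl ph) a b X Y εd εc x T) P ∧
      ∫ ω, cumRegret (Set.Icc pl ph) a b X Y εd εc x T ω ∂P
        ≤ 2 * (ph - pl) * M + (ph + 1) * Real.sqrt B / Real.sqrt (phi δ 1)
          + widthConst ph σ δ (2 * B) * Real.sqrt
          (maxInfoGain (Set.Icc pl ph) (fun p q => kd p q + kc p q) σ T * T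
            * Real.log (T + 1)) := by
  have hph0 : 0 < ph := hpl.trans hph
  have hw : 0 ≤ 2 * (ph - pl) := by linarith
  have hB : ∀ p, kd p p + kc p p ≤ 2 * B := fun p => by linarith [hBd p, hBc p]
  have hle := hLip.mono fun ω hω (T : ℕ) (hT : 1 ≤ T) =>
    h.cumRegret_le hpl hph hδ hδ1 hxS hmax hB (hL ω) hω hT
  have hcont : ∀ᵐ ω ∂P, ContinuousOn (rev a b X Y ω) (Set.Icc pl ph) := by
    filter_upwards [hLip] with ω hω
    exact continuousOn_of_abs_sub_le (hL ω) hω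
  constructor
  · have hmarkov : P {ω | 6 * M / δ ≤ L ω} ≤ ENNReal.ofReal (1 / 6 * δ) := by
      have h1 := mul_meas_ge_le_integral_of_nonneg (Eventually.of_forall hL) hLi (6 * M / δ)
      rw [← ofReal_measureReal]
      refine ENNReal.ofReal_le_ofReal ?_
      have h2 : 6 * M / δ * P.real {ω | 6 * M / δ ≤ L ω} ≤ 6 * M / δ * (1 / 6 * δ) := by
        refine (h1.trans hLM).trans_eq ?_
        field_simp
      exact le_of_mul_le_mul_left h2 (by positivity)
    have hsplit : ENNReal.ofReal δ = ENNReal.ofReal (5 / 6 * δ) + ENNReal.ofReal (1 / 6 * δ) := by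
      rw [← ENNReal.ofReal_add (by positivity) (by positivity)]
      congr 1
      ring
    rw [hsplit]
    refine le_trans (measure_mono_ae ?_) ((measure_union_le _ _).trans (add_le_add
      (h.prob_roundExcess_pos_le (pl := pl) hph0.le hδ hδ1 hx hBd hBc) hmarkov))
    filter_upwards [hle] with ω hω
    intro hbad
    by_contra hno
    obtain ⟨hno1, hno2⟩ := not_or.1 hno
    refine hbad fun T hT => (hω T hT).trans (add_le_add_left ?_ _)
    have h0 : ∑ n ∈ Finset.range T, roundExcess pl ph μd μc kd kc σ δ x n (a (X ω)) (b (Y ω))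
        (obs a b X Y εd εc x n ω) ≤ 0 :=
      Finset.sum_nonpos fun n _ => not_lt.1 fun hlt => hno1 ⟨n, hlt⟩
    have h1 := mul_le_mul_of_nonneg_left (not_le.1 hno2).le hw
    linarith
  · intro T hT
    have hei := fun n => h.integrable_roundExcess (pl := pl) hph0.le hδ hδ1 hx hBd hBc n
    set W := widthConst ph σ δ (2 * B) * Real.sqrt
        (maxInfoGain (Set.Icc pl ph) (fun p q => kd p q + kc p q) σ T * T * Real.log (T + 1))
    have hsi : Integrable (fun ω => ∑ n ∈ Finset.range T,
        roundExcess pl ph μd μc kd kc σ δ x n (a (X ω)) (b (Y ω)) (obs a b X Y εd εc x n ω)) P :=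
      integrable_finsetSum _ fun n _ => hei n
    have hLsi : Integrable (fun ω => 2 * (ph - pl) * L ω + ∑ n ∈ Finset.range T,
        roundExcess pl ph μd μc kd kc σ δ x n (a (X ω)) (b (Y ω)) (obs a b X Y εd εc x n ω)) P :=
      (hLi.const_mul _).add hsi
    have hGi : Integrable (fun ω => 2 * (ph - pl) * L ω + ∑ n ∈ Finset.range T,
        roundExcess pl ph μd μc kd kc σ δ x n (a (X ω)) (b (Y ω)) (obs a b X Y εd εc x n ω) + W)
        P := hLsi.add (integrable_const W)
    have hRi : Integrable (cumRegret (Set.Icc pl ph) a b X Y εd εc x T) P := by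
      refine hGi.mono' (h.aestronglyMeasurable_cumRegret hph.le hx hcont T) ?_
      filter_upwards [hle, hcont] with ω h1 h2
      rw [Real.norm_of_nonneg (cumRegret_nonneg hxS h2 T)]
      exact h1 T hT
    refine ⟨hRi, (integral_mono_ae hRi hGi ?_).trans ?_⟩
    · filter_upwards [hle] with ω h1
      exact h1 T hT
    · rw [integral_add hLsi (integrable_const W), integral_add (hLi.const_mul _) hsi,
        integral_const_mul, integral_finsetSum _ fun n _ => hei n]
      have h1 := mul_le_mul_of_nonneg_left hLM hw
      have h2 := h.sum_integral_roundExcess_le (pl := pl) hph0.le hδ hδ1 hx hBd hBc T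
      simp only [integral_const, probReal_univ, one_smul]
      linarith

end PathModel

end ModelRegret

/-! ### Policies as functions of the observations -/

/-- The history of the policy `π` that belongs to the observations `y`. -/
def historyOf (π : (n : ℕ) → History n → ℝ) : (n : ℕ) → (Fin n → ℝ × ℝ) → History n
  | 0, _ => Fin.elim0
  | n + 1, y => Fin.snoc (α := fun _ => ℝ × ℝ × ℝ) (historyOf π n (Fin.init y))
      (π n (historyOf π n (Fin.init y)), y (Fin.last n))

/-- The price of round `n + 1` as a function of the observations. -/
def priceOf (π : (n : ℕ) → History n → ℝ) (n : ℕ) (y : Fin n → ℝ × ℝ) : ℝ := π n (historyOf π n y)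

section Policy

variable {π : (n : ℕ) → History n → ℝ}

lemma measurable_historyOf (hπ : ∀ n, Measurable (π n)) (n : ℕ) : Measurable (historyOf π n) := by
  induction n with
  | zero => exact measurable_const
  | succ n ih =>
    have hi : Measurable fun y : Fin (n + 1) → ℝ × ℝ => historyOf π n (Fin.init y) :=
      ih.comp (measurable_pi_lambda _ fun i => measurable_pi_apply _)
    refine measurable_pi_lambda _ fun i => ?_
    refine Fin.lastCases ?_ (fun j => ?_) i
    · simp only [historyOf, Fin.snoc_last]
      exact ((hπ n).comp hi).prodMk (measurable_pi_apply _)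
    · simp only [historyOf, Fin.snoc_castSucc]
      exact (measurable_pi_apply j).comp hi

lemma historyOf_snd (n : ℕ) (y : Fin n → ℝ × ℝ) (i : Fin n) : (historyOf π n y i).2 = y i := by
  induction n with
  | zero => exact i.elim0
  | succ n ih =>
    refine Fin.lastCases ?_ (fun j => ?_) i
    · simp only [historyOf, Fin.snoc_last]
    · simp only [historyOf, Fin.snoc_castSucc]
      exact ih _ j

lemma historyOf_fst (n : ℕ) (y : Fin n → ℝ × ℝ) (i : Fin n) :
    (historyOf π n y i).1 = chosenPoints (priceOf π) n y i := by
  induction n with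
  | zero => exact i.elim0
  | succ n ih =>
    refine Fin.lastCases ?_ (fun j => ?_) i
    · simp only [historyOf, Fin.snoc_last]
      rfl
    · simp only [historyOf, Fin.snoc_castSucc]
      exact ih _ j

lemma historyOf_fst_mem {S : Set ℝ} (hπ : ∀ n (h : History n), (∀ i, (h i).1 ∈ S) → π n h ∈ S)
    (n : ℕ) (y : Fin n → ℝ × ℝ) (i : Fin n) : (historyOf π n y i).1 ∈ S := by
  induction n with
  | zero => exact i.elim0
  | succ n ih =>
    refine Fin.lastCases ?_ (fun j => ?_) i
    · simp only [historyOf, Fin.snoc_last]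
      exact hπ n _ (ih _)
    · simp only [historyOf, Fin.snoc_castSucc]
      exact ih _ j

/-- Prices are deterministic functions of earlier observations, so the observations determine the
history. All charged prices lie in `S`, so agreement of the paths on `S` suffices. -/
lemma history_eq_historyOf {Ω U V : Type*} {S : Set ℝ}
    (hπ : ∀ n (h : History n), (∀ i, (h i).1 ∈ S) → π n h ∈ S) {fd fc : ℝ → Ω → ℝ}
    {εd εc : ℕ → Ω → ℝ} {a : U → ℝ → ℝ} {b : V → ℝ → ℝ} {X : Ω → U} {Y : Ω → V} {ω : Ω}
    (ha : ∀ p ∈ S, a (X ω) p = fd p ω) (hb : ∀ p ∈ S, b (Y ω) p = fc p ω) (n : ℕ) :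
    history π fd fc εd εc ω n
      = historyOf π n (PathModel.obs a b X Y εd εc (priceOf π) n ω) := by
  induction n with
  | zero => rfl
  | succ n ih =>
    have hp : π n (history π fd fc εd εc ω n) ∈ S := by
      rw [ih]; exact hπ n _ (historyOf_fst_mem hπ n _)
    rw [history, historyOf]
    have e1 : Fin.init (PathModel.obs a b X Y εd εc (priceOf π) (n + 1) ω)
        = PathModel.obs a b X Y εd εc (priceOf π) n ω := by
      rw [PathModel.obs, observations]
      exact Fin.init_snoc (α := fun _ => ℝ × ℝ) _ _
    rw [e1, ← ih]
    congr 2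
    rw [PathModel.obs, observations, Fin.snoc_last, priceOf]
    change _ = pairPath a b (X ω, Y ω) (π n (historyOf π n
      (PathModel.obs a b X Y εd εc (priceOf π) n ω))) + (εd (n + 1) ω, εc (n + 1) ω)
    rw [← ih]
    simp only [pairPath, Prod.mk_add_mk, ha _ hp, hb _ hp]

end Policy

end GPPricing

namespace GPPricing

open scoped ENNReal
open Filter Topology

/-! ### Removing the clamp from the posterior quantities. -/

section Clamp

variable {pl ph : ℝ} {μ : ℝ → ℝ} {k : ℝ → ℝ → ℝ} {σ : ℝ} {n : ℕ} {x y : Fin n → ℝ} {p : ℝ}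

lemma regMatrix_clamp (hx : ∀ i, x i ∈ Set.Icc pl ph) :
    regMatrix (fun p q => k (clamp pl ph p) (clamp pl ph q)) σ x = regMatrix k σ x := by
  simp only [regMatrix, clamp_of_mem (hx _)]

lemma postMean_clamp (hx : ∀ i, x i ∈ Set.Icc pl ph) (hp : p ∈ Set.Icc pl ph) :
    postMean (fun p => μ (clamp pl ph p)) (fun p q => k (clamp pl ph p) (clamp pl ph q)) σ x y p
      = postMean μ k σ x y p := by
  simp only [postMean, regMatrix_clamp hx, clamp_of_mem (hx _), clamp_of_mem hp]

lemma postStd_clamp (hx : ∀ i, x i ∈ Set.Icc pl ph) (hp : p ∈ Set.Icc pl ph) :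
    postStd (fun p q => k (clamp pl ph p) (clamp pl ph q)) σ x p = postStd k σ x p := by
  simp only [postStd, postCov, regMatrix_clamp hx, clamp_of_mem (hx _), clamp_of_mem hp]

end Clamp

lemma roundUcb_priceOf {pl ph : ℝ} {μd μc : ℝ → ℝ} {kd kc : ℝ → ℝ → ℝ} {σ δ : ℝ}
    {π : (n : ℕ) → History n → ℝ}
    (hπ : ∀ n (h : History n), (∀ i, (h i).1 ∈ Set.Icc pl ph) → π n h ∈ Set.Icc pl ph)
    (n : ℕ) (y : Fin n → ℝ × ℝ) {p : ℝ} (hp : p ∈ Set.Icc pl ph) :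
    roundUcb (fun p => μd (clamp pl ph p)) (fun p => μc (clamp pl ph p))
        (fun p q => kd (clamp pl ph p) (clamp pl ph q))
        (fun p q => kc (clamp pl ph p) (clamp pl ph q)) σ δ (priceOf π) n y p
      = ucb μd μc kd kc σ δ (historyOf π n y) p := by
  have hS := historyOf_fst_mem hπ n y
  simp only [ucb, historyOf_snd]
  have e : chosenPoints (priceOf π) n y = fun i => (historyOf π n y i).1 :=
    funext fun i => (historyOf_fst n y i).symm
  rw [roundUcb, e, postMean_clamp hS hp, postMean_clamp hS hp, postStd_clamp hS hp,
    postStd_clamp hS hp]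

/-! ### Degenerate priors -/

section Degenerate

variable {Ω : Type*} {mΩ : MeasurableSpace Ω} {P : Measure Ω} [IsProbabilityMeasure P]
  {pl ph : ℝ} {μ : ℝ → ℝ} {k : ℝ → ℝ → ℝ} {f : ℝ → Ω → ℝ} {B : ℝ} {H : Ω → ℝ}

omit [IsProbabilityMeasure P] in
lemma IsGPSample.kernel_self_nonneg {S : Set ℝ} (hg : IsGPSample P S μ k f) {p : ℝ} (hp : p ∈ S) :
    0 ≤ k p p := by
  rw [← hg.covariance p hp p hp, covariance_self (hg.measurable p hp).aemeasurable]
  exact variance_nonneg _ _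

/-- Zero variance gives almost sure equality at each point of a countable dense set; continuity
extends it to all prices simultaneously. -/
lemma IsGPSample.ae_eq_mean (hph : pl ≤ ph) (hg : IsGPSample P (Set.Icc pl ph) μ k f)
    (hH : IsEnvelope P (Set.Icc pl ph) f B H) (h0 : ∀ p ∈ Set.Icc pl ph, k p p = 0) :
    ∀ᵐ ω ∂P, ∀ p ∈ Set.Icc pl ph, f p ω = μ p := by
  have hg' := hg.comp_clamp hph
  have hpt : ∀ p, ∀ᵐ ω ∂P, f (clamp pl ph p) ω = μ (clamp pl ph p) := by
    intro p
    have hv : Var[f (clamp pl ph p); P] = 0 := by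
      rw [← covariance_self (hg'.memLp p).1.aemeasurable]
      exact (hg'.covariance p (Set.mem_univ _) p (Set.mem_univ _)).trans (h0 _ (clamp_mem hph p))
    have hev : eVar[f (clamp pl ph p); P] = 0 := by
      rw [← (hg'.memLp p).ofReal_variance_eq, hv, ENNReal.ofReal_zero]
    have := (evariance_eq_zero_iff (hg'.memLp p).1.aemeasurable).1 hev
    filter_upwards [this] with ω hω
    rw [hω, hg.mean _ (clamp_mem hph p)]
  filter_upwards [ae_all_iff.2 fun n => hpt (TopologicalSpace.denseSeq ℝ n),
    hH.ae_continuous hph] with ω hω hc p hp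
  have := (TopologicalSpace.denseRange_denseSeq ℝ).induction_on
    (p := fun p => f (clamp pl ph p) ω = μ (clamp pl ph p)) p
    (isClosed_eq hc (hg.continuous_mean hph hH)) hω
  rwa [clamp_of_mem hp] at this

lemma IsGPSample.kernel_eq_zero (hph : pl ≤ ph) (hg : IsGPSample P (Set.Icc pl ph) μ k f)
    (hH : IsEnvelope P (Set.Icc pl ph) f B H) (h0 : ∀ p ∈ Set.Icc pl ph, k p p = 0)
    {p q : ℝ} (hp : p ∈ Set.Icc pl ph) (hq : q ∈ Set.Icc pl ph) : k p q = 0 := by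
  rw [← hg.covariance p hp q hq, ProbabilityTheory.covariance, hg.mean p hp]
  refine integral_eq_zero_of_ae ?_
  filter_upwards [hg.ae_eq_mean hph hH h0] with ω hω
  simp [hω p hp]

omit [IsProbabilityMeasure P] in
lemma ucb_eq_of_kernel_eq_zero {S : Set ℝ} {μd μc : ℝ → ℝ} {kd kc : ℝ → ℝ → ℝ} {σ δ : ℝ}
    (hd : ∀ p ∈ S, ∀ q ∈ S, kd p q = 0) (hc : ∀ p ∈ S, ∀ q ∈ S, kc p q = 0) {n : ℕ}
    {h : History n} (hh : ∀ i, (h i).1 ∈ S) {p : ℝ} (hp : p ∈ S) :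
    ucb μd μc kd kc σ δ h p = p * μd p - μc p := by
  have e1 : (fun i => kd (h i).1 p) = 0 := funext fun i => hd _ (hh i) _ hp
  have e2 : (fun i => kc (h i).1 p) = 0 := funext fun i => hc _ (hh i) _ hp
  simp [ucb, postMean, postStd, postCov, e1, e2, hd p hp p hp, hc p hp p hp]

/-- The posterior is the prior with zero width, so the upper confidence function is almost surely
the true revenue and the policy charges an exact maximiser. -/
lemma regret_eq_zero_of_degenerate {μd μc : ℝ → ℝ} {kd kc : ℝ → ℝ → ℝ} {σ δ : ℝ}
    {fd fc : ℝ → Ω → ℝ} {εd εc : ℕ → Ω → ℝ} {π : (n : ℕ) → History n → ℝ} {Bd Bc : ℝ}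
    {Hd Hc : Ω → ℝ} (hph : pl ≤ ph)
    (hgd : IsGPSample P (Set.Icc pl ph) μd kd fd) (hgc : IsGPSample P (Set.Icc pl ph) μc kc fc)
    (hHd : IsEnvelope P (Set.Icc pl ph) fd Bd Hd) (hHc : IsEnvelope P (Set.Icc pl ph) fc Bc Hc)
    (h0d : ∀ p ∈ Set.Icc pl ph, kd p p = 0) (h0c : ∀ p ∈ Set.Icc pl ph, kc p p = 0)
    (hπ : IsUCBPolicy (Set.Icc pl ph) μd μc kd kc σ δ π) :
    ∀ᵐ ω ∂P, ∀ T, regret (Set.Icc pl ph) fd fc (price π fd fc εd εc) T ω = 0 := by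
  filter_upwards [hgd.ae_eq_mean hph hHd h0d, hgc.ae_eq_mean hph hHc h0c] with ω hωd hωc T
  refine Finset.sum_eq_zero fun t _ => sub_eq_zero.2 ?_
  have hh : ∀ n i, (history π fd fc εd εc ω n i).1 ∈ Set.Icc pl ph := by
    intro n
    rw [history_eq_historyOf (a := fun (u : ℝ → ℝ) p => u p) (b := fun (u : ℝ → ℝ) p => u p)
      (X := fun ω p => fd p ω) (Y := fun ω p => fc p ω) hπ.mem (fun _ _ => rfl) (fun _ _ => rfl) n]
    exact historyOf_fst_mem hπ.mem n _
  have hmem := hπ.mem _ _ (hh (t - 1))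
  refine IsGreatest.csSup_eq ⟨Set.mem_image_of_mem _ hmem, ?_⟩
  rintro _ ⟨q, hq, rfl⟩
  have hmax := hπ.isMaxOn _ _ (hh (t - 1)) hq
  have hz : ∀ p ∈ Set.Icc pl ph, ucb μd μc kd kc σ δ (history π fd fc εd εc ω (t - 1)) p
      = revenue fd fc p ω := fun p hp => by
    rw [ucb_eq_of_kernel_eq_zero (fun p hp q hq => hgd.kernel_eq_zero hph hHd h0d hp hq)
      (fun p hp q hq => hgc.kernel_eq_zero hph hHc h0c hp hq) (hh _) hp, revenue, hωd p hp,
      hωc p hp]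
  have hmax' : ucb μd μc kd kc σ δ (history π fd fc εd εc ω (t - 1)) q
      ≤ ucb μd μc kd kc σ δ (history π fd fc εd εc ω (t - 1))
        (π (t - 1) (history π fd fc εd εc ω (t - 1))) := hmax
  rw [hz q hq, hz _ hmem] at hmax'
  exact hmax'

end Degenerate

/-! ### The regret of the upper confidence bound policy -/

section Final

variable {Ω : Type*} {mΩ : MeasurableSpace Ω} {P : Measure Ω} [IsProbabilityMeasure P]
  {pl ph : ℝ} {μd μc : ℝ → ℝ} {kd kc : ℝ → ℝ → ℝ} {σ δ : ℝ} {fd fc : ℝ → Ω → ℝ}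
  {εd εc : ℕ → Ω → ℝ} {π : (n : ℕ) → History n → ℝ} {Bd Bc : ℝ} {Hd Hc : Ω → ℝ}

lemma IsEnvelope.integral_le {f : ℝ → Ω → ℝ} {B : ℝ} {H : Ω → ℝ} (hB : 0 ≤ B)
    (hH : IsEnvelope P (Set.Icc pl ph) f B H) : ∫ ω, H ω ∂P ≤ 1 + B := by
  have h1 : ∫ ω, H ω ∂P ≤ ∫ ω, (1 + H ω ^ 2) ∂P :=
    integral_mono (hH.memLp.integrable one_le_two)
      ((integrable_const 1).add hH.memLp.integrable_sq) fun ω => by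
        change H ω ≤ 1 + H ω ^ 2
        nlinarith [sq_nonneg (H ω - 1)]
  rw [integral_add (integrable_const 1) hH.memLp.integrable_sq] at h1
  have h2 := hH.integral_sq_le hB
  simp only [integral_const, probReal_univ, one_smul] at h1
  linarith

-- From p f(p) - q f(q) = p (f(p) - f(q)) + (p - q) f(q), where the envelope bounds both the
-- increment and the value.
omit [IsProbabilityMeasure P] in
lemma ae_abs_revenue_sub_le (hpl : 0 < pl) (hHd : IsEnvelope P (Set.Icc pl ph) fd Bd Hd)
    (hHc : IsEnvelope P (Set.Icc pl ph) fc Bc Hc) :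
    ∀ᵐ ω ∂P, ∀ p ∈ Set.Icc pl ph, ∀ q ∈ Set.Icc pl ph,
      |revenue fd fc p ω - revenue fd fc q ω| ≤ ((1 + ph) * Hd ω + Hc ω) * |p - q| := by
  filter_upwards [hHd.abs_le, hHd.abs_sub_le, hHc.abs_sub_le] with ω h1 h2 h3 p hp q hq
  have e : revenue fd fc p ω - revenue fd fc q ω
      = p * (fd p ω - fd q ω) + (p - q) * fd q ω - (fc p ω - fc q ω) := by
    rw [revenue, revenue]; ring
  have hp0 : 0 < p := hpl.trans_le hp.1
  have t1 : |p * (fd p ω - fd q ω)| ≤ ph * (Hd ω * |p - q|) := by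
    rw [abs_mul, abs_of_pos hp0]
    exact mul_le_mul hp.2 (h2 p hp q hq) (abs_nonneg _) (hp0.le.trans hp.2)
  have t2 : |(p - q) * fd q ω| ≤ |p - q| * Hd ω := by
    rw [abs_mul]
    exact mul_le_mul_of_nonneg_left (h1 q hq) (abs_nonneg _)
  have t3 := h3 p hp q hq
  rw [e]
  have := (abs_sub (p * (fd p ω - fd q ω) + (p - q) * fd q ω) (fc p ω - fc q ω)).trans
    (add_le_add_left (abs_add_le _ _) _)
  linarith

lemma regret_eq_cumRegret {U V : Type*} {S : Set ℝ}
    (hπ : ∀ n (h : History n), (∀ i, (h i).1 ∈ S) → π n h ∈ S)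
    {a : U → ℝ → ℝ} {b : V → ℝ → ℝ} {X : Ω → U} {Y : Ω → V} {ω : Ω}
    (ha : ∀ p ∈ S, a (X ω) p = fd p ω) (hb : ∀ p ∈ S, b (Y ω) p = fc p ω) (T : ℕ) :
    regret S fd fc (price π fd fc εd εc) T ω
      = PathModel.cumRegret S a b X Y εd εc (priceOf π) T ω := by
  have hrev : ∀ p ∈ S, revenue fd fc p ω = PathModel.rev a b X Y ω p := fun p hp => by
    rw [revenue, PathModel.rev, ha p hp, hb p hp]
  have hshift := Finset.sum_Ico_add' (fun t => sSup (PathModel.rev a b X Y ω '' S)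
    - PathModel.rev a b X Y ω
      (priceOf π (t - 1) (PathModel.obs a b X Y εd εc (priceOf π) (t - 1) ω))) 0 T 1
  rw [regret, PathModel.cumRegret, Finset.range_eq_Ico]
  refine Eq.trans ?_ hshift.symm
  refine Finset.sum_congr (by ext; simp) fun t _ => ?_
  have hp : price π fd fc εd εc t ω
      = priceOf π (t - 1) (PathModel.obs a b X Y εd εc (priceOf π) (t - 1) ω) := by
    rw [price, history_eq_historyOf hπ ha hb, priceOf]
  rw [hp, hrev (priceOf π _ _) (hπ _ _ (historyOf_fst_mem hπ _ _)), Set.image_congr hrev]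

/-- The regret agrees almost surely with that of the path model. `M` bounds the mean of the
revenue's Lipschitz constant (1 + ph) Hd + Hc, because H ≤ 1 + H². -/
theorem regret_bounds (hpl : 0 < pl) (hph : pl < ph) (hσ : 0 < σ) (hδ : 0 < δ) (hδ1 : δ < 1)
    (hBd : 0 ≤ Bd) (hBc : 0 ≤ Bc)
    (hgd : IsGPSample P (Set.Icc pl ph) μd kd fd) (hgc : IsGPSample P (Set.Icc pl ph) μc kc fc)
    (hHd : IsEnvelope P (Set.Icc pl ph) fd Bd Hd) (hHc : IsEnvelope P (Set.Icc pl ph) fc Bc Hc)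
    (hmod : IsIndependentNoisyModel P (Set.Icc pl ph) σ fd fc εd εc)
    (hπ : IsUCBPolicy (Set.Icc pl ph) μd μc kd kc σ δ π) {M : ℝ}
    (hM : M = (1 + ph) * (1 + Bd) + (1 + Bc)) :
    P {ω | ¬ ∀ T : ℕ, 1 ≤ T → regret (Set.Icc pl ph) fd fc (price π fd fc εd εc) T ω
        ≤ 2 * (ph - pl) * (6 * M / δ) + widthConst ph σ δ (2 * (Bd + Bc)) * Real.sqrt
        (maxInfoGain (Set.Icc pl ph) (fun p q => kd p q + kc p q) σ T * T * Real.log (T + 1))}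
      ≤ ENNReal.ofReal δ ∧
    ∀ T : ℕ, 1 ≤ T →
      Integrable (regret (Set.Icc pl ph) fd fc (price π fd fc εd εc) T) P ∧
      ∫ ω, regret (Set.Icc pl ph) fd fc (price π fd fc εd εc) T ω ∂P
        ≤ 2 * (ph - pl) * M + (ph + 1) * Real.sqrt (Bd + Bc) / Real.sqrt (phi δ 1)
          + widthConst ph σ δ (2 * (Bd + Bc)) * Real.sqrt
          (maxInfoGain (Set.Icc pl ph) (fun p q => kd p q + kc p q) σ T * T
            * Real.log (T + 1)) := by
  have hph0 : 0 < ph := hpl.trans hph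
  have hmodel := pathModel_of_noisyModel hσ hph.le hgd hgc hHd hHc hmod
  have hgood : ∀ᵐ ω ∂P, (∀ p ∈ Set.Icc pl ph, pathEval (densePath pl ph fd ω) p = fd p ω) ∧
      ∀ p ∈ Set.Icc pl ph, pathEval (densePath pl ph fc ω) p = fc p ω := by
    filter_upwards [hHd.ae_pathEval_eq hph.le, hHc.ae_pathEval_eq hph.le] with ω h1 h2
    exact ⟨fun p hp => by rw [h1 p, clamp_of_mem hp], fun p hp => by rw [h2 p, clamp_of_mem hp]⟩
  have hregret : ∀ᵐ ω ∂P, ∀ T, regret (Set.Icc pl ph) fd fc (price π fd fc εd εc) T ω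
      = PathModel.cumRegret (Set.Icc pl ph) pathEval pathEval (densePath pl ph fd)
        (densePath pl ph fc) εd εc (priceOf π) T ω := by
    filter_upwards [hgood] with ω hω T
    exact regret_eq_cumRegret hπ.mem hω.1 hω.2 T
  have hxS : ∀ n y, priceOf π n y ∈ Set.Icc pl ph := fun n y =>
    hπ.mem n _ (historyOf_fst_mem hπ.mem n y)
  have hinfo : ∀ T, maxInfoGain (Set.Icc pl ph) (fun p q => kd p q + kc p q) σ T
      = maxInfoGain (Set.Icc pl ph) (fun p q => kd (clamp pl ph p) (clamp pl ph q)
        + kc (clamp pl ph p) (clamp pl ph q)) σ T := fun T =>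
    maxInfoGain_congr (fun p hp q hq => by rw [clamp_of_mem hp, clamp_of_mem hq]) σ T
  have hHdi := hHd.memLp.integrable one_le_two
  have hHci := hHc.memLp.integrable one_le_two
  have hbounds := hmodel.cumRegret_bounds hpl hph hδ hδ1 (x := priceOf π)
    (fun n => (hπ.measurable n).comp (measurable_historyOf hπ.measurable n)) hxS
    (fun n y q hq => by
      change roundUcb _ _ _ _ _ _ _ _ _ _ ≤ roundUcb _ _ _ _ _ _ _ _ _ _
      rw [roundUcb_priceOf hπ.mem n y hq, roundUcb_priceOf hπ.mem n y (hxS n y)]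
      exact hπ.isMaxOn n _ (historyOf_fst_mem hπ.mem n y) hq)
    (B := Bd + Bc)
    (fun p => (hgd.kernel_le hph.le hBd hHd p).trans (by linarith))
    (fun p => (hgc.kernel_le hph.le hBc hHc p).trans (by linarith))
    (L := fun ω => (1 + ph) * Hd ω + Hc ω)
    (fun ω => add_nonneg (mul_nonneg (by linarith) (hHd.nonneg ω)) (hHc.nonneg ω))
    (by
      filter_upwards [hgood, ae_abs_revenue_sub_le hpl hHd hHc] with ω h1 h2 p hp q hq
      have := h2 p hp q hq
      simp only [revenue] at this
      simp only [PathModel.rev, h1.1 p hp, h1.1 q hq, h1.2 p hp, h1.2 q hq]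
      exact this)
    ((hHdi.const_mul _).add hHci) (M := M) (by rw [hM]; positivity)
    (by
      rw [integral_add (hHdi.const_mul _) hHci, integral_const_mul, hM]
      exact add_le_add (mul_le_mul_of_nonneg_left (hHd.integral_le hBd) (by linarith))
        (hHc.integral_le hBc))
  simp only [hinfo]
  refine ⟨le_trans (measure_mono_ae ?_) hbounds.1, fun T hT => ?_⟩
  · filter_upwards [hregret] with ω hω hbad
    intro hall
    exact hbad fun T hT => (hω T).trans_le (hall T hT)
  · have heq : regret (Set.Icc pl ph) fd fc (price π fd fc εd εc) T
        =ᵐ[P] PathModel.cumRegret (Set.Icc pl ph) pathEval pathEval (densePath pl ph fd)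
          (densePath pl ph fc) εd εc (priceOf π) T := by
      filter_upwards [hregret] with ω hω
      exact hω T
    refine ⟨(hbounds.2 T hT).1.congr heq.symm, ?_⟩
    rw [integral_congr_ae heq]
    exact (hbounds.2 T hT).2

/-- The information gain of `T ≥ 1` prices is bounded below if the kernel does not vanish. -/
lemma log_le_maxInfoGain_mul (hph : pl < ph) (hσ : 0 < σ) (hBd : 0 ≤ Bd) (hBc : 0 ≤ Bc)
    (hgd : IsGPSample P (Set.Icc pl ph) μd kd fd) (hgc : IsGPSample P (Set.Icc pl ph) μc kc fc)
    (hHd : IsEnvelope P (Set.Icc pl ph) fd Bd Hd) (hHc : IsEnvelope P (Set.Icc pl ph) fc Bc Hc)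
    {p : ℝ} (hp : p ∈ Set.Icc pl ph) {T : ℕ} (hT : 1 ≤ T) :
    1 / 2 * Real.log (1 + (σ ^ 2)⁻¹ * (kd p p + kc p p)) * Real.log 2
      ≤ maxInfoGain (Set.Icc pl ph) (fun p q => kd p q + kc p q) σ T * T * Real.log (T + 1) := by
  have hT1 : (1 : ℝ) ≤ T := by exact_mod_cast hT
  have h0 : 0 ≤ (σ ^ 2)⁻¹ * (kd p p + kc p p) := by
    have := hgd.kernel_self_nonneg hp
    have := hgc.kernel_self_nonneg hp
    positivity
  have hlog : 0 ≤ Real.log (1 + (σ ^ 2)⁻¹ * (kd p p + kc p p)) := Real.log_nonneg (by linarith)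
  have h1 := ((hgd.comp_clamp hph.le).isPSDKernel.add (hgc.comp_clamp hph.le).isPSDKernel
    ).log_le_maxInfoGain hσ (B := Bd + Bc)
      (fun p => add_le_add (hgd.kernel_le hph.le hBd hHd p) (hgc.kernel_le hph.le hBc hHc p))
      ((hgd.continuous_kernel hph.le hHd).add (hgc.continuous_kernel hph.le hHc)) hph hp hT
  rw [clamp_of_mem hp] at h1
  rw [maxInfoGain_congr (k' := fun p q => kd (clamp pl ph p) (clamp pl ph q)
        + kc (clamp pl ph p) (clamp pl ph q))
    (fun p hp q hq => by rw [clamp_of_mem hp, clamp_of_mem hq]) σ T]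
  set γ := maxInfoGain (Set.Icc pl ph) (fun p q => kd (clamp pl ph p) (clamp pl ph q)
        + kc (clamp pl ph p) (clamp pl ph q)) σ T
  have hγ : 0 ≤ γ := le_trans (by positivity) h1
  have h2 : Real.log 2 ≤ Real.log (T + 1) := Real.log_le_log two_pos (by linarith)
  have h3 : 1 / 2 * Real.log (1 + (σ ^ 2)⁻¹ * (kd p p + kc p p)) ≤ γ * T :=
    h1.trans (le_mul_of_one_le_right hγ hT1)
  exact mul_le_mul h3 h2 (Real.log_nonneg one_le_two) (by positivity)

end Final

end GPPricing

/-! ### The main theorem and the choice of the constant. -/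

theorem theorem2 (pl ph : ℝ) (hpl : 0 < pl) (hph : pl < ph)
    (μd μc : ℝ → ℝ) (kd kc : ℝ → ℝ → ℝ) (σ : ℝ) (hσ : 0 < σ)
    (ad bd ac bc : ℝ) (had : 0 < ad) (hbd : 0 < bd) (hac : 0 < ac) (hbc : 0 < bc)
    (δ : ℝ) (hδ : δ ∈ Set.Ioo (0 : ℝ) 1) :
    -- the constant depends only on the data above, not on `T`, the sample or the tie-breaking
    ∃ C : ℝ, 0 < C ∧
      ∀ (Ω : Type*) [MeasurableSpace Ω] (P : Measure Ω) [IsProbabilityMeasure P]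
        (fd fc : ℝ → Ω → ℝ) (εd εc : ℕ → Ω → ℝ)
        (π : (n : ℕ) → GPPricing.History n → ℝ),
        GPPricing.IsGPSample P (Set.Icc pl ph) μd kd fd →
        GPPricing.IsGPSample P (Set.Icc pl ph) μc kc fc →
        GPPricing.HasSubgaussianDeriv P (Set.Icc pl ph) ad bd fd →
        GPPricing.HasSubgaussianDeriv P (Set.Icc pl ph) ac bc fc →
        GPPricing.IsIndependentNoisyModel P (Set.Icc pl ph) σ fd fc εd εc →
        GPPricing.IsUCBPolicy (Set.Icc pl ph) μd μc kd kc σ δ π →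
        -- with probability at least `1 - δ`, the regret bound holds for all `T ≥ 1`
        P {ω | ¬ ∀ T : ℕ, 1 ≤ T →
            GPPricing.regret (Set.Icc pl ph) fd fc (GPPricing.price π fd fc εd εc) T ω
              ≤ C * Real.sqrt
                (GPPricing.maxInfoGain (Set.Icc pl ph) (fun p q => kd p q + kc p q) σ T
                  * T * Real.log (T + 1))} ≤ ENNReal.ofReal δ ∧
        -- and the expected regret obeys the same bound
        ∀ T : ℕ, 1 ≤ T →
          Integrable
            (GPPricing.regret (Set.Icc pl ph) fd fc (GPPricing.price π fd fc εd εc) T) P ∧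
          ∫ ω, GPPricing.regret (Set.Icc pl ph) fd fc (GPPricing.price π fd fc εd εc) T ω ∂P
            ≤ C * Real.sqrt
              (GPPricing.maxInfoGain (Set.Icc pl ph) (fun p q => kd p q + kc p q) σ T
                * T * Real.log (T + 1)) := by
  obtain ⟨Bd, hBd, henvd⟩ := GPPricing.exists_envelope hph μd kd ad hbd
  obtain ⟨Bc, hBc, henvc⟩ := GPPricing.exists_envelope hph μc kc ac hbc
  -- The distinction concerns the kernels only, so the constant stays independent of the probability
  -- space. If both variances vanish, γ_T gives no positive lower bound that could absorb an
  -- additive constant.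
  by_cases hdeg : ∃ p ∈ Set.Icc pl ph, 0 < kd p p + kc p p
  · obtain ⟨p, hp, hkp⟩ := hdeg
    have hph0 : 0 < ph := hpl.trans hph
    have hw : 0 < ph - pl := sub_pos.2 hph
    have hδ0 := hδ.1
    have hphi := GPPricing.phi_one_pos hδ.1 hδ.2
    obtain ⟨M, hM⟩ : ∃ M, M = (1 + ph) * (1 + Bd) + (1 + Bc) := ⟨_, rfl⟩
    have hM0 : 0 < M := by rw [hM]; positivity
    obtain ⟨W, hW⟩ : ∃ W, W = GPPricing.widthConst ph σ δ (2 * (Bd + Bc)) := ⟨_, rfl⟩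
    have hW0 : 0 ≤ W := by
      rw [hW, GPPricing.widthConst]; positivity
    -- The sum of the additive constants of both claims, so that one `D` dominates each.
    obtain ⟨D, hD⟩ : ∃ D, D = 2 * (ph - pl) * (6 * M / δ) + 2 * (ph - pl) * M
      + (ph + 1) * Real.sqrt (Bd + Bc) / Real.sqrt (GPPricing.phi δ 1) := ⟨_, rfl⟩
    -- A lower bound for √(γ_T T log(T+1)) valid for all T ≥ 1; hence `D` is at most `D / c` times
    -- that root.
    obtain ⟨c, hc⟩ : ∃ c, c = Real.sqrt
      (1 / 2 * Real.log (1 + (σ ^ 2)⁻¹ * (kd p p + kc p p)) * Real.log 2) := ⟨_, rfl⟩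
    have hc0 : 0 < c := by
      rw [hc]
      refine Real.sqrt_pos.2 (mul_pos (mul_pos one_half_pos (Real.log_pos ?_))
        (Real.log_pos one_lt_two))
      have : 0 < (σ ^ 2)⁻¹ * (kd p p + kc p p) := by positivity
      linarith
    have hD0 : 0 < D := by rw [hD]; positivity
    refine ⟨D / c + W, by positivity, fun Ω _ P _ fd fc εd εc π hgd hgc hdd hdc hmod hπ => ?_⟩
    obtain ⟨Hd, hHd⟩ := henvd P fd hgd hdd
    obtain ⟨Hc, hHc⟩ := henvc P fc hgc hdc
    have hbounds := GPPricing.regret_bounds hpl hph hσ hδ.1 hδ.2 hBd hBc hgd hgc hHd hHc hmod hπ hM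
    rw [← hW] at hbounds
    have habsorb : ∀ (T : ℕ), 1 ≤ T → ∀ E ≤ D, E + W * Real.sqrt
        (GPPricing.maxInfoGain (Set.Icc pl ph) (fun p q => kd p q + kc p q) σ T
          * T * Real.log (T + 1)) ≤ (D / c + W) * Real.sqrt
        (GPPricing.maxInfoGain (Set.Icc pl ph) (fun p q => kd p q + kc p q) σ T
          * T * Real.log (T + 1)) := by
      intro T hT E hE
      have h1 : c ≤ Real.sqrt (GPPricing.maxInfoGain (Set.Icc pl ph)
          (fun p q => kd p q + kc p q) σ T * T * Real.log (T + 1)) := by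
        rw [hc]
        exact Real.sqrt_le_sqrt
          (GPPricing.log_le_maxInfoGain_mul hph hσ hBd hBc hgd hgc hHd hHc hp hT)
      have h2 := mul_le_mul_of_nonneg_left h1 (div_pos hD0 hc0).le
      rw [div_mul_cancel₀ _ hc0.ne'] at h2
      rw [add_mul]
      linarith
    have hr1 : 0 ≤ 2 * (ph - pl) * (6 * M / δ) := by positivity
    have hr2 : 0 ≤ 2 * (ph - pl) * M := by positivity
    have hr3 : 0 ≤ (ph + 1) * Real.sqrt (Bd + Bc) / Real.sqrt (GPPricing.phi δ 1) := by positivity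
    refine ⟨le_trans (measure_mono ?_) hbounds.1, fun T hT => ?_⟩
    · intro ω hω hall
      exact hω fun T hT => (hall T hT).trans (habsorb T hT _ (by rw [hD]; linarith))
    · exact ⟨(hbounds.2 T hT).1, (hbounds.2 T hT).2.trans
        (habsorb T hT _ (by rw [hD]; linarith))⟩
  · refine ⟨1, one_pos, fun Ω _ P _ fd fc εd εc π hgd hgc hdd hdc hmod hπ => ?_⟩
    obtain ⟨Hd, hHd⟩ := henvd P fd hgd hdd
    obtain ⟨Hc, hHc⟩ := henvc P fc hgc hdc
    have hle : ∀ p ∈ Set.Icc pl ph, kd p p + kc p p ≤ 0 := fun p hp =>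
      not_lt.1 fun h => hdeg ⟨p, hp, h⟩
    have h0 := GPPricing.regret_eq_zero_of_degenerate (εd := εd) (εc := εc) hph.le hgd hgc hHd hHc
      (fun p hp => le_antisymm (by linarith [hle p hp, hgc.kernel_self_nonneg hp])
        (hgd.kernel_self_nonneg hp))
      (fun p hp => le_antisymm (by linarith [hle p hp, hgd.kernel_self_nonneg hp])
        (hgc.kernel_self_nonneg hp)) hπ
    refine ⟨?_, fun T _ => ?_⟩
    · refine le_of_eq_of_le ?_ zero_le
      refine ae_iff.1 ?_
      filter_upwards [h0] with ω hω T _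
      rw [hω T]
      positivity
    · have heq : GPPricing.regret (Set.Icc pl ph) fd fc (GPPricing.price π fd fc εd εc) T
          =ᵐ[P] fun _ => 0 := by
        filter_upwards [h0] with ω hω
        exact hω T
      refine ⟨(integrable_zero _ _ _).congr heq.symm, ?_⟩
      rw [integral_congr_ae heq, integral_zero]
      positivity
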